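/- Conventions. A kernel is a family $k=(k_d)_{d\ge 1}$ of functions $k_d:\mathbb R^d\times\mathbb R^d\to\mathbb R$. We call it a rotationally invariant kernel if all $k_d$ are continuous and positive semi-definite and there is one function $g$ with $k_d(x,x')=g(\|x\|_2^2,\|x'\|_2^2,x^\top x')$ for all $d$. For $\tau>0$ put $k_\tau(x,x')=g(\|x\|_2^2/\tau,\|x'\|_2^2/\tau,x^\top x'/\tau)$. Fix $\beta>0$. Kernel assumptions (for $\beta$, with coefficient functions $g_0,g_1,\dots$). (i) $k$ is a rotationally invariant kernel and for some $\delta>0$ and all $d$, $k_d(x,x')=\sum_{j\ge0}g_j(\|x\|_2^2,\|x'\|_2^2)(x^\top x')^j$ whenever $\|x\|_2^2,\|x'\|_2^2\in[1-\delta,1+\delta]$, where the $g_j$ do not depend on $d$ and are positive semi-definite kernels on $[0,\infty)$. (ii) For some $\delta_L>0$ the restriction of $k_d$ to $\{(x,x):\|x\|_2^2\in[1-\delta_L,1+\delta_L]\}$ is Lipschitz continuous, with a constant independent of $d$. (iii) For $i\le\lfloor 2/\beta\rfloor+1$, $g_i$ is $(\lfloor 2/\beta\rfloor+1-i)$-times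 continuously differentiable in a neighbourhood of $(1,1)$, and $g_j(1,1)>0$ for some $j>\lfloor 2/\beta\rfloor$. Polynomial approximation barrier for $k$ and $\beta$. This is the following statement. Let $c>0$ and, for each $n$, let $\Sigma_n\in\mathbb R^{d_n\times d_n}$ be positive semi-definite with operator norm $1$, and let $\tau_n=\operatorname{tr}\Sigma_n$ be its effective dimension, with $\tau_n/n^\beta\to c$. Let $P$ be the standard normal law or a law on $\mathbb R$ with bounded support, mean zero and variance one. Let $W$ have $d_n$ i.i.d. entries of law $P$, and let $\mathbb P_X=\mathbb P_X^{(n)}$ be, either for all $n$ the law of $\Sigma_n^{1/2}W$ (then $m=2\lfloor2/\beta\rfloor$), or for all $n$ the law of $\sqrt{\tau_n}\,Z/\|Z\|_2$ with $Z=\Sigma_n^{1/2}W$ (then $m=\lfloor 2/\beta\rfloor$; $Z/\|Z\|_2$ is read as $0$ where $Z=0$). Let the conditional law of the response $y$ given the input have the mean $f^*(x)=f_n^*(x)=\mathbb E[y\mid X=x]$, bounded uniformly in $n$ and $x$. For each $n$ let $x_1,\dots,x_n$ be i.i.d. of law $\mathbb P_X$ and, given these, let $y_1,\dots,y_n$ be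 independent responses; let $\lambda=\lambda_n\ge0$, and let $\hat f_\lambda$ be the minimizer of $\sum_i(y_i-f(x_i))^2+\lambda\|f\|^2$ over the reproducing kernel Hilbert space of $k_{\tau_n}$ if $\lambda>0$, and the minimum norm interpolator in that space if $\lambda=0$. Let $\mathbb E_Y\hat f_\lambda$ be the expectation over $y_1,\dots,y_n$ given $x_1,\dots,x_n$, and $\mathbf B(\hat f_\lambda)=\|\mathbb E_Y\hat f_\lambda-f^*\|^2_{L_2(\mathbb P_X)}$. Let $\mathcal P_m$ be the polynomials on $\mathbb R^{d_n}$ of degree at most $m$. Then 1. for every $\varepsilon>0$, almost surely for all sufficiently large $n$, $\mathbf B(\hat f_\lambda)\ge\inf_{p\in\mathcal P_m}\|f^*-p\|^2_{L_2(\mathbb P_X)}-\varepsilon$; 2. if for every $n$ the kernel $k_{\tau_n}$ is bounded on the support of $\mathbb P_X$, then almost surely there are polynomials $p_n\in\mathcal P_m$ with $\|\mathbb E_Y\hat f_\lambda-p_n\|_{L_2(\mathbb P_X)}\to0$ as $n\to\infty$. Neural tangent kernel. For $\sigma:\mathbb R\to\mathbb R$ with derivative $\dot\sigma$ let $\Sigma^{(0)}(x,x')=x^\top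 x'$ and, for $i\ge 1$, $\Sigma^{(i)}(x,x')=c_\sigma\mathbb E[\sigma(u)\sigma(v)]$ and $\dot\Sigma^{(i)}(x,x')=c_{\dot\sigma}\mathbb E[\dot\sigma(u)\dot\sigma(v)]$, where $(u,v)$ is centred normal with covariance matrix $\begin{pmatrix}\Sigma^{(i-1)}(x,x)&\Sigma^{(i-1)}(x,x')\\\Sigma^{(i-1)}(x,x')&\Sigma^{(i-1)}(x',x')\end{pmatrix}$ and $c_\varphi=\mathbb E_{v\sim N(0,1)}[\varphi(v)^2]^{-1}$. The neural tangent kernel of depth $L\ge1$ is $\sum_{i=1}^{L+1}\Sigma^{(i-1)}(x,x')\prod_{j=i}^{L+1}\dot\Sigma^{(j)}(x,x')$; the claims below are also made for the variant in which $\dot\Sigma^{(L+1)}$ is replaced by $1$. Call $\sigma$ regular (for $\beta$, with exponent $\kappa\in\mathbb R$) if $\sigma(av)=a^\kappa\sigma(v)$ for all $v\in\mathbb R$, $a>0$, if $\mathbb E_{v\sim N(0,1)}[\dot\sigma(v)^2]\ne0$, and if $\sigma$ and $\dot\sigma$ are in $L_2(N(0,1))$ and are there the sums of Hermite expansions, where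 the expansion $\sum_ja_jh_j$ of $\sigma$ has a coefficient $a_j\ne0$ with $j>\lfloor2/\beta\rfloor$. Statement. Let $\beta>0$. (a) The exponential inner product kernel $k(x,x')=\exp(x^\top x')$ satisfies the kernel assumptions, and the polynomial approximation barrier holds for it. (b) For every $\alpha\in(0,2]$ the $\alpha$-exponential kernel $k(x,x')=\exp(-\|x-x'\|_2^\alpha)$, in particular the Laplace kernel ($\alpha=1$) and the Gaussian kernel ($\alpha=2$), is a rotationally invariant kernel and the polynomial approximation barrier holds for it. The Gaussian kernel satisfies the kernel assumptions. (c) For every regular activation function $\sigma$ and every $L\ge1$, the neural tangent kernel of depth $L$ satisfies the kernel assumptions with coefficient functions $g_j$ for which the expansion in powers of $x^\top x'$ holds for all nonzero $x,x'$, and which, if $\kappa$ is a natural number, are of the form $g_j(u,v)=\sum_{l\in\mathbb Z}\eta_{j,l}(uv)^{l/2}$ for $u,v>0$, with $\eta_{j,l}\ge0$. The polynomial approximation barrier holds for it. (d) The ReLU activation function $\sigma(v)=\max(v,0)$ is regular for every $\beta>0$, with $\kappa=1$. -/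

import Mathlib

open MeasureTheory ProbabilityTheory Filter Topology
open scoped ENNReal NNReal RealInnerProductSpace MatrixOrder

universe u

namespace PolyBarrier

noncomputable section

/-- The input space `ℝ^d` with its Euclidean norm. -/
abbrev E (d : ℕ) : Type := EuclideanSpace ℝ (Fin d)

/-! ### Kernels -/

/-- A positive semi-definite kernel on a subset `s`: every kernel matrix with nodes in `s`
is positive semi-definite. -/
def IsPSDKernelOn {X : Type*} (s : Set X) (k : X → X → ℝ) : Prop :=
  ∀ (n : ℕ) (x : Fin n → X), (∀ i, x i ∈ s) →
    (Matrix.of fun i j => k (x i) (x j)).PosSemidef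

/-- A kernel is a family with one kernel for each dimension `d`. It is continuous, positive
semi-definite and rotationally invariant, with a profile `g` that is the same for all `d`. -/
structure IsRotationallyInvariantKernel (k : ∀ d : ℕ, E d → E d → ℝ) : Prop where
  continuous : ∀ d, Continuous fun p : E d × E d => k d p.1 p.2
  posSemidef : ∀ d, IsPSDKernelOn Set.univ (k d)
  exists_profile : ∃ g : ℝ → ℝ → ℝ → ℝ, ∀ (d : ℕ) (x x' : E d),
    k d x x' = g (‖x‖ ^ 2) (‖x'‖ ^ 2) ⟪x, x'⟫

/-- The closed annulus `{x | ‖x‖² ∈ [1 - δ, 1 + δ]}` around the unit sphere of `ℝ^d`. -/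
def annulus (d : ℕ) (δ : ℝ) : Set (E d) := {x | ‖x‖ ^ 2 ∈ Set.Icc (1 - δ) (1 + δ)}

/-- The assumptions on the kernel family `k` with respect to the coefficient functions
`gc 0, gc 1, …` of its expansion in powers of `⟪x, x'⟫` (which do not depend on `d`). -/
structure SatisfiesKernelAssumptions (k : ∀ d : ℕ, E d → E d → ℝ) (β : ℝ)
    (gc : ℕ → ℝ → ℝ → ℝ) : Prop where
  /-- continuous, positive semi-definite, rotationally invariant -/
  rotInv : IsRotationallyInvariantKernel k
  /-- local power series expansion around the sphere -/
  powerSeries : ∃ δ : ℝ, 0 < δ ∧ ∀ d : ℕ, ∀ x ∈ annulus d δ, ∀ x' ∈ annulus d δ,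
    HasSum (fun j : ℕ => gc j (‖x‖ ^ 2) (‖x'‖ ^ 2) * ⟪x, x'⟫ ^ j) (k d x x')
  /-- the coefficients are positive semi-definite kernels (of squared norms) -/
  coeffPSD : ∀ j, IsPSDKernelOn (Set.Ici 0) (gc j)
  /-- restricted Lipschitz continuity on the diagonal -/
  lipschitz : ∃ δ : ℝ, 0 < δ ∧ ∃ K : ℝ≥0, ∀ d : ℕ,
    LipschitzOnWith K (fun p : E d × E d => k d p.1 p.2)
      ((fun x : E d => (x, x)) '' annulus d δ)
  /-- `gc i` is `⌊2/β⌋ + 1 - i` times continuously differentiable near `(1, 1)` -/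
  contDiff : ∀ i ≤ ⌊2 / β⌋₊ + 1,
    ContDiffAt ℝ ((⌊2 / β⌋₊ + 1 - i : ℕ) : ℕ∞) (fun p : ℝ × ℝ => gc i p.1 p.2) (1, 1)
  /-- a coefficient of order larger than `⌊2/β⌋` is positive at `(1, 1)` -/
  exists_pos : ∃ j, ⌊2 / β⌋₊ < j ∧ 0 < gc j 1 1

/-- The kernel with input scaling `τ`, that is `g (‖x‖²/τ) (‖x'‖²/τ) (⟪x, x'⟫/τ)` for the
kernel with profile `g`; see `scaledKernel_eq`. -/
def scaledKernel {d : ℕ} (k : E d → E d → ℝ) (τ : ℝ) (x x' : E d) : ℝ :=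
  k ((Real.sqrt τ)⁻¹ • x) ((Real.sqrt τ)⁻¹ • x')

theorem scaledKernel_eq {d : ℕ} {k : E d → E d → ℝ} {g : ℝ → ℝ → ℝ → ℝ}
    (h : ∀ x x' : E d, k x x' = g (‖x‖ ^ 2) (‖x'‖ ^ 2) ⟪x, x'⟫) {τ : ℝ} (hτ : 0 < τ)
    (x x' : E d) :
    scaledKernel k τ x x' = g (‖x‖ ^ 2 / τ) (‖x'‖ ^ 2 / τ) (⟪x, x'⟫ / τ) := by
  have hs : Real.sqrt τ ^ 2 = τ := Real.sq_sqrt hτ.le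
  have h1 : ∀ y : E d, ‖(Real.sqrt τ)⁻¹ • y‖ ^ 2 = ‖y‖ ^ 2 / τ := by
    intro y
    rw [norm_smul, mul_pow, Real.norm_eq_abs, sq_abs, inv_pow, hs, div_eq_inv_mul]
  rw [scaledKernel, h, h1, h1, real_inner_smul_left, real_inner_smul_right, ← mul_assoc,
    ← mul_inv, ← sq, hs, div_eq_inv_mul ⟪x, x'⟫]

/-! ### Kernel ridge regression and minimum norm interpolation -/

/-- `f` is the kernel ridge regression estimate with penalty `lam > 0`, respectively the
minimum norm interpolator for `lam = 0`, in the reproducing kernel Hilbert space of `k`,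
for the inputs `x` and the responses `y`. -/
def IsKernelEstimate {X : Type} (k : X → X → ℝ) (lam : ℝ) {n : ℕ} (x : Fin n → X)
    (y : Fin n → ℝ) (f : X → ℝ) : Prop :=
  ∃ (H : Type) (_ : NormedAddCommGroup H) (_ : InnerProductSpace ℝ H) (_ : CompleteSpace H)
    (_ : RKHS ℝ H X ℝ), (∀ a b : X, RKHS.kernel H a b 1 = k a b) ∧
    ∃ h : H, (∀ t, h t = f t) ∧
      ((0 < lam ∧ ∀ h' : H, (∑ i, (y i - h (x i)) ^ 2) + lam * ‖h‖ ^ 2 ≤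
          (∑ i, (y i - h' (x i)) ^ 2) + lam * ‖h'‖ ^ 2) ∨
        (lam = 0 ∧ (∀ i, h (x i) = y i) ∧
          ∀ h' : H, (∀ i, h' (x i) = y i) → ‖h‖ ≤ ‖h'‖))

open Classical in
/-- The kernel estimator; it is `0` if there is no estimate (which for a positive
semi-definite kernel can only happen if `lam = 0` and the data cannot be interpolated). -/
def kernelEstimator {X : Type} (k : X → X → ℝ) (lam : ℝ) {n : ℕ} (x : Fin n → X)
    (y : Fin n → ℝ) : X → ℝ :=
  if h : ∃ f, IsKernelEstimate k lam x y f then h.choose else 0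

/-- The averaged estimator: the conditional expectation of the kernel estimator given the
inputs, where the responses are independent, `y i` with the conditional law `ρ (x i)`. -/
def averagedEstimator {X : Type} [MeasurableSpace X] (k : X → X → ℝ) (lam : ℝ)
    (ρ : Kernel X ℝ) {n : ℕ} (x : Fin n → X) (t : X) : ℝ :=
  ∫ y, kernelEstimator k lam x y t ∂(Measure.pi fun i => ρ (x i))

/-- The ground truth: the conditional mean of the response given the input. -/
def groundTruth {X : Type} [MeasurableSpace X] (ρ : Kernel X ℝ) (x : X) : ℝ :=
  ∫ y, y ∂(ρ x)

/-- The squared `L²` norm, with value `∞` for functions that are not in `L²`. -/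
def sqL2 {X : Type} [MeasurableSpace X] (Q : Measure X) (f : X → ℝ) : ℝ≥0∞ :=
  ∫⁻ t, ENNReal.ofReal (f t ^ 2) ∂Q

/-- The bias of the kernel estimator under the input law `Q`. -/
def bias {X : Type} [MeasurableSpace X] (Q : Measure X) (k : X → X → ℝ) (lam : ℝ)
    (ρ : Kernel X ℝ) {n : ℕ} (x : Fin n → X) : ℝ≥0∞ :=
  sqL2 Q fun t => averagedEstimator k lam ρ x t - groundTruth ρ t

/-! ### Input distributions -/

/-- The laws of the entries: the standard normal law and all laws with bounded support, zero
mean and unit variance. -/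
def IsEntryLaw (P : Measure ℝ) : Prop :=
  P = gaussianReal 0 1 ∨
    (IsProbabilityMeasure P ∧ (∃ B : ℝ, ∀ᵐ w ∂P, |w| ≤ B) ∧
      ∫ w, w ∂P = 0 ∧ ∫ w, w ^ 2 ∂P = 1)

/-- The Euclidean operator norm of a matrix. -/
def opNorm {d : ℕ} (S : Matrix (Fin d) (Fin d) ℝ) : ℝ :=
  ‖Matrix.toEuclideanCLM (n := Fin d) (𝕜 := ℝ) S‖

/-- The effective dimension of a covariance matrix. -/
def effDim {d : ℕ} (S : Matrix (Fin d) (Fin d) ℝ) : ℝ := S.trace / opNorm S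

/-- The law of `S^{1/2} W` where `W` has i.i.d. entries of law `P`. -/
def covLaw {d : ℕ} (S : Matrix (Fin d) (Fin d) ℝ) (P : Measure ℝ) : Measure (E d) :=
  (Measure.pi fun _ : Fin d => P).map fun w =>
    Matrix.toEuclideanCLM (n := Fin d) (𝕜 := ℝ) (CFC.sqrt S) (WithLp.toLp 2 w)

/-- The law of `√(effDim S) • Z / ‖Z‖` where `Z` has the law `covLaw S P`. -/
def sphereLaw {d : ℕ} (S : Matrix (Fin d) (Fin d) ℝ) (P : Measure ℝ) : Measure (E d) :=
  (covLaw S P).map fun z => (Real.sqrt (effDim S) / ‖z‖) • z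

/-! ### The polynomial approximation barrier -/

/-- The real polynomials in `d` variables of degree at most `m`. -/
def polySpace (d m : ℕ) : Set (MvPolynomial (Fin d) ℝ) := {p | p.totalDegree ≤ m}

/-- The conclusions for one sequence of input laws `Q n`, scalings `τ n`, conditional
response laws `ρ n`, penalties `lam n` and data sets `x n 0, …, x n (n - 1)`, with the
degree `m`. -/
def BarrierConclusion (k : ∀ d : ℕ, E d → E d → ℝ) (m : ℕ) (d : ℕ → ℕ)
    (Q : ∀ n, Measure (E (d n))) (τ : ℕ → ℝ) (ρ : ∀ n, Kernel (E (d n)) ℝ) (lam : ℕ → ℝ)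
    {Ω : Type u} [MeasurableSpace Ω] (μ : Measure Ω) (x : ∀ n, Fin n → Ω → E (d n)) : Prop :=
  (∀ ε : ℝ, 0 < ε → ∀ᵐ ω ∂μ, ∀ᶠ n in atTop,
    (⨅ p ∈ polySpace (d n) m, sqL2 (Q n) fun t => groundTruth (ρ n) t - p.eval t)
      ≤ bias (Q n) (scaledKernel (k (d n)) (τ n)) (lam n) (ρ n) (fun i => x n i ω)
        + ENNReal.ofReal ε) ∧
  ((∀ n, ∃ B : ℝ, ∀ t ∈ (Q n).support, ∀ t' ∈ (Q n).support,
      |scaledKernel (k (d n)) (τ n) t t'| ≤ B) →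
    ∀ᵐ ω ∂μ, ∃ p : ∀ n, MvPolynomial (Fin (d n)) ℝ, (∀ n, p n ∈ polySpace (d n) m) ∧
      Tendsto (fun n => sqL2 (Q n) fun t =>
        averagedEstimator (scaledKernel (k (d n)) (τ n)) (lam n) (ρ n) (fun i => x n i ω) t
          - (p n).eval t) atTop (𝓝 0))

/-- The polynomial approximation barrier for the kernel family `k` in the regime
`effDim / n ^ β → c`, with `τ = effDim`. -/
def PolynomialApproximationBarrier (k : ∀ d : ℕ, E d → E d → ℝ) (β : ℝ) : Prop :=
  -- the covariance model, normalised to `opNorm = 1`, in the high dimensional regime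
  ∀ (c : ℝ), 0 < c → ∀ (d : ℕ → ℕ) (S : ∀ n, Matrix (Fin (d n)) (Fin (d n)) ℝ),
    (∀ n, (S n).PosSemidef) → (∀ n, opNorm (S n) = 1) →
    Tendsto (fun n : ℕ => effDim (S n) / (n : ℝ) ^ β) atTop (𝓝 c) →
  ∀ P : Measure ℝ, IsEntryLaw P →
  -- the input laws and the degree
  ∀ (Q : ∀ n, Measure (E (d n))) (m : ℕ),
    ((∀ n, Q n = covLaw (S n) P) ∧ m = 2 * ⌊2 / β⌋₊ ∨
      (∀ n, Q n = sphereLaw (S n) P) ∧ m = ⌊2 / β⌋₊) →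
  -- the conditional laws of the responses, with a bounded ground truth
  ∀ ρ : ∀ n, Kernel (E (d n)) ℝ, (∀ n, IsMarkovKernel (ρ n)) →
    (∀ n t, Integrable (fun y => y) (ρ n t)) →
    (∃ M : ℝ, ∀ n t, |groundTruth (ρ n) t| ≤ M) →
  -- the penalties
  ∀ lam : ℕ → ℝ, (∀ n, 0 ≤ lam n) →
  -- the data sets: for each `n`, there are `n` i.i.d. inputs of law `Q n`
  ∀ (Ω : Type u) [MeasurableSpace Ω] (μ : Measure Ω) [IsProbabilityMeasure μ]
    (x : ∀ n, Fin n → Ω → E (d n)), (∀ n i, Measurable (x n i)) →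
    (∀ n, iIndepFun (x n) μ) → (∀ n i, μ.map (x n i) = Q n) →
  BarrierConclusion k m d Q (fun n => effDim (S n)) ρ lam μ x

/-! ### The kernels -/

/-- The exponential inner product kernel. -/
def expKernel (d : ℕ) (x x' : E d) : ℝ := Real.exp ⟪x, x'⟫

/-- The `α`-exponential kernel; `α = 1` is the Laplace and `α = 2` the Gaussian kernel. -/
def alphaExpKernel (α : ℝ) (d : ℕ) (x x' : E d) : ℝ := Real.exp (-(‖x - x'‖ ^ α))

/-- `1 / E[φ(v)²]` for a standard normal `v`. -/
def normConst (φ : ℝ → ℝ) : ℝ := (∫ v, φ v ^ 2 ∂(gaussianReal 0 1))⁻¹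

/-- `E[φ(u) φ(v)] / E[φ(w)²]` for `(u, v)` centred normal with covariance matrix
`!![a, b; b, c]` and a standard normal `w`. -/
def dualActivation (φ : ℝ → ℝ) (a b c : ℝ) : ℝ :=
  normConst φ * ∫ z, φ (z 0) * φ (z 1) ∂(multivariateGaussian 0 !![a, b; b, c])

/-- The recursion `Σ^(i)` for the activation function `σ`. -/
def nngp (σ : ℝ → ℝ) (d : ℕ) : ℕ → E d → E d → ℝ
  | 0 => fun x x' => ⟪x, x'⟫
  | i + 1 => fun x x' =>
      dualActivation σ (nngp σ d i x x) (nngp σ d i x x') (nngp σ d i x' x')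

/-- The derivative kernel of level `i + 1`, which is built on `Σ^(i)`. -/
def nngpDeriv (σ : ℝ → ℝ) (d : ℕ) (i : ℕ) (x x' : E d) : ℝ :=
  dualActivation (deriv σ) (nngp σ d i x x) (nngp σ d i x x') (nngp σ d i x' x')

/-- The neural tangent kernel of depth `L`. The products run up to the level `top`: with
`top = L + 1` all derivative kernels up to level `L + 1` are used, and `top = L` is the
convention in which the one of level `L + 1` is replaced by `1`. -/
def ntk (σ : ℝ → ℝ) (L top : ℕ) (d : ℕ) (x x' : E d) : ℝ :=
  ∑ i ∈ Finset.Icc 1 (L + 1),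
    nngp σ d (i - 1) x x' * ∏ j ∈ Finset.Icc i top, nngpDeriv σ d (j - 1) x x'

/-- The normalised (probabilists') Hermite polynomials, orthonormal in `L²(N(0, 1))`. -/
def hermiteFun (j : ℕ) (v : ℝ) : ℝ :=
  Polynomial.aeval v (Polynomial.hermite j) / Real.sqrt (j.factorial : ℝ)

/-- `φ ∈ L²(N(0, 1))` has the Hermite expansion `∑ j, a j * hermiteFun j`, with convergence
in `L²(N(0, 1))`. -/
def HasHermiteExpansion (φ : ℝ → ℝ) (a : ℕ → ℝ) : Prop :=
  MemLp φ 2 (gaussianReal 0 1) ∧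
    Tendsto (fun N : ℕ => eLpNorm (fun v => φ v - ∑ j ∈ Finset.range N, a j * hermiteFun j v) 2
      (gaussianReal 0 1)) atTop (𝓝 0)

/-- `κ`-homogeneous activation functions such that they and their derivatives (which do not
vanish almost everywhere) have Hermite expansions, with a nonzero coefficient of order larger
than `⌊2/β⌋`. -/
structure IsRegularActivation (σ : ℝ → ℝ) (κ β : ℝ) : Prop where
  homogeneous : ∀ v a : ℝ, 0 < a → σ (a * v) = a ^ κ * σ v
  deriv_ne_zero : ∫ v, deriv σ v ^ 2 ∂(gaussianReal 0 1) ≠ 0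
  expansion : ∃ a b : ℕ → ℝ, HasHermiteExpansion σ a ∧ HasHermiteExpansion (deriv σ) b ∧
    ∃ j, ⌊2 / β⌋₊ < j ∧ a j ≠ 0

/-- The expansion of `k` in powers of `⟪x, x'⟫` with coefficients `gc j` holds for all nonzero
inputs. -/
def HasGlobalExpansion (k : ∀ d : ℕ, E d → E d → ℝ) (gc : ℕ → ℝ → ℝ → ℝ) : Prop :=
  ∀ (d : ℕ) (x x' : E d), x ≠ 0 → x' ≠ 0 →
    HasSum (fun j : ℕ => gc j (‖x‖ ^ 2) (‖x'‖ ^ 2) * ⟪x, x'⟫ ^ j) (k d x x')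

/-- Each coefficient is a series `∑ l ∈ ℤ, η l * (u v)^(l/2)` with nonnegative `η l`. -/
def HasPuiseuxCoefficients (gc : ℕ → ℝ → ℝ → ℝ) : Prop :=
  ∀ j, ∃ η : ℤ → ℝ, (∀ l, 0 ≤ η l) ∧ ∀ u v : ℝ, 0 < u → 0 < v →
    HasSum (fun l : ℤ => η l * (u * v) ^ ((l : ℝ) / 2)) (gc j u v)

/-- The activation function `v ↦ max v 0`. -/
def relu (v : ℝ) : ℝ := max v 0

end

end PolyBarrier

open PolyBarrier

/-! Put m = ⌊2/β⌋. The kernel estimator is linear in the responses, so the averaged estimator is t ↦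
∑ αᵢ k(t/√τ, xᵢ/√τ), where α solves (K + λ)α = (f*(xᵢ)) for the kernel matrix K. This function is
close to a polynomial because each of its n terms is, and because the weights are not too large.

In high dimension the scaled inputs are almost orthonormal: squared norms and inner products deviate
from 1 and 0 by at most δ = n^(-θ), for θ < β/2. Since m + 1 > 2/β, one can also take θ > 1/(m+1),
so that n δ^(m+1) → 0 (`exists_rates`). Two facts follow. First, removing one term of order j₀ > m
from the expansion of k leaves a positive semi-definite kernel, while the matrix of the removed term
is nearly diagonal, with off-diagonal entries O(δ^(m+1)). Hence K ≥ γ > 0 with γ independent of n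
(`eigenvalue_bound_of_sub`), and ∑ |αᵢ| ≤ nF/γ if |f*| ≤ F (`exists_averagedEstimator_eq`). Second,
the Taylor expansion of order m of each term, in ‖t‖²/τ - 1 and the scaled inner product, has an
error O(δ^(m+1)). The total error O(n δ^(m+1)) vanishes. The degree is 2m, because ‖t‖² is quadratic
in t, and only m where ‖t‖² = τ (`HasTaylorApproximation.exists_approximableOn`). Exceptional test
points are so rare that fourth moments control them (`exists_polynomial_sqL2_le`). Borel-Cantelli
makes this almost sure (`ae_exists_polynomial`), and the triangle inequality gives the bound for the
bias (`barrierConclusion_of_ae`). All of this is collected in `polynomialApproximationBarrier`,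
which asks three things of a kernel: `HasEigenvalueBound`, `HasTaylorApproximation` and
`HasKernelMoments`.

The concentration comes from moments of every order: sub-Gaussian linear forms, and quadratic forms
by symmetrisation and Khintchine's inequality (`IsSubgaussianLaw.lintegral_quadForm_pow_le`).

The exponential and the Gaussian kernel have explicit expansions. For α < 2, the α-exponential
kernel is treated by writing s^(α/2) as an integral of 1 - exp(-ws) over w > 0. The part over w ∈
[1, 2] yields the eigenvalue bound, and by Schur's product theorem the rest does no harm
(`alphaExpKernel_hasEigenvalueBound`). For homogeneous activations the tangent kernel is a power of
‖x‖‖x'‖ times a function of the cosine of the angle. Since E[φ(u)φ(v)] = ∑ aⱼ² ρʲ for Hermite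
coefficients aⱼ and correlation ρ, that function is a power series with nonnegative coefficients
(`IsRegularActivation.exists_hasAngularSeries`), from which the three properties follow. For ReLU,
completeness of the Hermite polynomials provides the expansions, and since ReLU is not a polynomial
they do not terminate. -/

namespace PolyBarrier

/-! ### Positive semi-definite kernels -/

section PSD

variable {X Y : Type*} {s : Set X} {k k₁ k₂ : X → X → ℝ}

theorem isPSDKernelOn_iff : IsPSDKernelOn s k ↔ (∀ x ∈ s, ∀ y ∈ s, k x y = k y x) ∧
    ∀ (n : ℕ) (x : Fin n → X), (∀ i, x i ∈ s) → ∀ c : Fin n → ℝ,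
      0 ≤ ∑ i, ∑ j, c i * c j * k (x i) (x j) := by
  constructor
  · intro h
    refine ⟨fun x hx y hy => ?_, fun n x hx c => ?_⟩
    · have := (h 2 ![x, y] (by intro i; fin_cases i <;> simpa)).isHermitian.apply 1 0
      simpa using this
    · have := (Matrix.posSemidef_iff_dotProduct_mulVec.mp (h n x hx)).2 c
      simpa [dotProduct, Matrix.mulVec, Finset.mul_sum, mul_assoc, mul_left_comm, mul_comm]
        using this
  · rintro ⟨hs, h⟩ n x hx
    refine Matrix.PosSemidef.of_dotProduct_mulVec_nonneg ?_ fun c => ?_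
    · ext i j
      simpa using hs _ (hx j) _ (hx i)
    · have := h n x hx c
      simpa [dotProduct, Matrix.mulVec, Finset.mul_sum, mul_assoc, mul_left_comm, mul_comm]
        using this

theorem IsPSDKernelOn.sum_nonneg (h : IsPSDKernelOn s k) {n : ℕ} {x : Fin n → X}
    (hx : ∀ i, x i ∈ s) (c : Fin n → ℝ) : 0 ≤ ∑ i, ∑ j, c i * c j * k (x i) (x j) :=
  (isPSDKernelOn_iff.1 h).2 n x hx c

theorem IsPSDKernelOn.symm (h : IsPSDKernelOn s k) {x y : X} (hx : x ∈ s) (hy : y ∈ s) :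
    k x y = k y x :=
  (isPSDKernelOn_iff.1 h).1 x hx y hy

theorem IsPSDKernelOn.congr (h : IsPSDKernelOn s k₁)
    (he : ∀ x ∈ s, ∀ y ∈ s, k₁ x y = k₂ x y) : IsPSDKernelOn s k₂ := by
  intro n x hx
  convert h n x hx using 1
  ext i j
  exact (he _ (hx i) _ (hx j)).symm

theorem IsPSDKernelOn.comp {t : Set Y} (h : IsPSDKernelOn s k) {f : Y → X}
    (hf : Set.MapsTo f t s) : IsPSDKernelOn t fun x y => k (f x) (f y) :=
  fun n x hx => h n (fun i => f (x i)) fun i => hf (hx i)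

theorem IsPSDKernelOn.add (h₁ : IsPSDKernelOn s k₁) (h₂ : IsPSDKernelOn s k₂) :
    IsPSDKernelOn s fun x y => k₁ x y + k₂ x y :=
  fun n x hx => (h₁ n x hx).add (h₂ n x hx)

theorem IsPSDKernelOn.mul (h₁ : IsPSDKernelOn s k₁) (h₂ : IsPSDKernelOn s k₂) :
    IsPSDKernelOn s fun x y => k₁ x y * k₂ x y :=
  fun n x hx => (h₁ n x hx).hadamard (h₂ n x hx)

theorem isPSDKernelOn_rankOne (φ : X → ℝ) : IsPSDKernelOn s fun x y => φ x * φ y := by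
  refine isPSDKernelOn_iff.2 ⟨fun x _ y _ => mul_comm _ _, fun n x _ c => ?_⟩
  have : ∑ i, ∑ j, c i * c j * (φ (x i) * φ (x j)) = (∑ i, c i * φ (x i)) ^ 2 := by
    rw [sq, Finset.sum_mul_sum]
    exact Finset.sum_congr rfl fun i _ => Finset.sum_congr rfl fun j _ => by ring
  rw [this]
  positivity

theorem isPSDKernelOn_const {a : ℝ} (ha : 0 ≤ a) : IsPSDKernelOn s fun _ _ => a := by
  refine (isPSDKernelOn_rankOne (s := s) fun _ => Real.sqrt a).congr fun x _ y _ => ?_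
  exact Real.mul_self_sqrt ha

theorem IsPSDKernelOn.const_mul (h : IsPSDKernelOn s k) {a : ℝ} (ha : 0 ≤ a) :
    IsPSDKernelOn s fun x y => a * k x y :=
  (isPSDKernelOn_const ha).mul h

theorem IsPSDKernelOn.pow (h : IsPSDKernelOn s k) (j : ℕ) :
    IsPSDKernelOn s fun x y => k x y ^ j := by
  induction j with
  | zero => simpa using isPSDKernelOn_const (s := s) zero_le_one
  | succ j ih => simpa only [pow_succ] using ih.mul h

theorem isPSDKernelOn_finsetSum {ι : Type*} {f : ι → X → X → ℝ} (t : Finset ι)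
    (h : ∀ i ∈ t, IsPSDKernelOn s (f i)) : IsPSDKernelOn s fun x y => ∑ i ∈ t, f i x y := by
  classical
  induction t using Finset.induction_on with
  | empty => simpa using isPSDKernelOn_const (s := s) le_rfl
  | insert a t ha ih =>
    simp only [Finset.sum_insert ha]
    exact (h a (by simp)).add (ih fun i hi => h i (by simp [hi]))

theorem isPSDKernelOn_of_tendsto {ι : Type*} {l : Filter ι} [l.NeBot] {f : ι → X → X → ℝ}
    (h : ∀ i, IsPSDKernelOn s (f i))
    (hf : ∀ x ∈ s, ∀ y ∈ s, Tendsto (fun i => f i x y) l (𝓝 (k x y))) :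
    IsPSDKernelOn s k := by
  refine isPSDKernelOn_iff.2 ⟨fun x hx y hy => ?_, fun n x hx c => ?_⟩
  · refine tendsto_nhds_unique (hf x hx y hy) ((hf y hy x hx).congr fun i => ?_)
    exact (h i).symm hy hx
  · refine ge_of_tendsto' (x := l) (f := fun i => ∑ a, ∑ b, c a * c b * f i (x a) (x b)) ?_
      fun i => (h i).sum_nonneg hx c
    refine tendsto_finsetSum _ fun a _ => tendsto_finsetSum _ fun b _ => ?_
    exact (hf _ (hx a) _ (hx b)).const_mul _

theorem isPSDKernelOn_of_hasSum {ι : Type*} {f : ι → X → X → ℝ}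
    (h : ∀ i, IsPSDKernelOn s (f i))
    (hf : ∀ x ∈ s, ∀ y ∈ s, HasSum (fun i => f i x y) (k x y)) : IsPSDKernelOn s k :=
  isPSDKernelOn_of_tendsto (l := atTop) (f := fun (t : Finset ι) x y => ∑ i ∈ t, f i x y)
    (fun t => isPSDKernelOn_finsetSum t fun i _ => h i) hf

theorem hasSum_real_exp (x : ℝ) : HasSum (fun j : ℕ => x ^ j / j.factorial) (Real.exp x) := by
  rw [Real.exp_eq_exp_ℝ]
  exact NormedSpace.expSeries_div_hasSum_exp x

theorem IsPSDKernelOn.exp (h : IsPSDKernelOn s k) :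
    IsPSDKernelOn s fun x y => Real.exp (k x y) := by
  refine isPSDKernelOn_of_hasSum (f := fun (j : ℕ) x y => (j.factorial : ℝ)⁻¹ * k x y ^ j)
    (fun j => (h.pow j).const_mul (by positivity)) fun x _ y _ => ?_
  simpa only [div_eq_inv_mul] using hasSum_real_exp (k x y)

theorem isPSDKernelOn_inner {F : Type*} [NormedAddCommGroup F] [InnerProductSpace ℝ F]
    (s : Set F) : IsPSDKernelOn s fun x y : F => ⟪x, y⟫ := by
  refine isPSDKernelOn_iff.2 ⟨fun x _ y _ => real_inner_comm _ _, fun n x _ c => ?_⟩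
  have : ∑ i, ∑ j, c i * c j * ⟪x i, x j⟫ = ⟪∑ i, c i • x i, ∑ i, c i • x i⟫ := by
    simp only [sum_inner, inner_sum, real_inner_smul_left, real_inner_smul_right]
    exact Finset.sum_congr rfl fun i _ => Finset.sum_congr rfl fun j _ => by
      rw [real_inner_comm]; ring
  rw [this]
  exact real_inner_self_nonneg

/-- A power series in a positive semi-definite kernel whose coefficients are positive
semi-definite kernels is positive semi-definite, even after one of the terms is removed. -/
theorem isPSDKernelOn_sub_of_hasSum {f : ℕ → X → X → ℝ} (h : ∀ j, IsPSDKernelOn s (f j))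
    (hf : ∀ x ∈ s, ∀ y ∈ s, HasSum (fun i => f i x y) (k x y)) (j₀ : ℕ) :
    IsPSDKernelOn s fun x y => k x y - f j₀ x y := by
  refine isPSDKernelOn_of_hasSum (f := fun j x y => if j = j₀ then 0 else f j x y)
    (fun j => ?_) fun x hx y hy => ?_
  · by_cases hj : j = j₀
    · simpa [hj] using isPSDKernelOn_const (s := s) le_rfl
    · simpa [hj] using h j
  · have h1 := (hf x hx y hy).update j₀ 0
    have h2 : (fun j => if j = j₀ then 0 else f j x y)
        = Function.update (fun i => f i x y) j₀ 0 := by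
      ext j
      by_cases hj : j = j₀
      · subst hj; simp
      · simp [hj]
    rw [h2, show k x y - f j₀ x y = 0 - f j₀ x y + k x y by ring]
    exact h1

end PSD

/-! ### Lower bounds for the eigenvalues of kernel matrices -/

/-- Nodes with almost unit norms which are almost orthogonal to each other. -/
structure AlmostOrthonormal {d n : ℕ} (δ : ℝ) (z : Fin n → E d) : Prop where
  norm_sq : ∀ i, |‖z i‖ ^ 2 - 1| ≤ δ
  inner : ∀ i j, i ≠ j → |⟪z i, z j⟫| ≤ δ

theorem AlmostOrthonormal.mem_annulus {d n : ℕ} {δ ε : ℝ} {z : Fin n → E d}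
    (h : AlmostOrthonormal δ z) (hδ : δ ≤ ε) (i : Fin n) : z i ∈ annulus d ε := by
  have := abs_le.1 (h.norm_sq i)
  exact ⟨by linarith, by linarith⟩

theorem AlmostOrthonormal.nonneg {d n : ℕ} {δ : ℝ} {z : Fin n → E d}
    (h : AlmostOrthonormal δ z) (i : Fin n) : 0 ≤ δ :=
  (abs_nonneg _).trans (h.norm_sq i)

/-- The eigenvalues of the kernel matrices for almost orthonormal nodes are bounded away from
zero as long as the number of nodes is small compared to `δ ^ (-(m + 1))`. -/
def HasEigenvalueBound (k : ∀ d : ℕ, E d → E d → ℝ) (m : ℕ) : Prop :=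
  ∃ γ : ℝ, 0 < γ ∧ ∃ ε : ℝ, 0 < ε ∧ ∀ (d n : ℕ) (δ : ℝ) (z : Fin n → E d), δ ≤ ε →
    n * δ ^ (m + 1) ≤ ε → AlmostOrthonormal δ z → ∀ c : Fin n → ℝ,
      γ * ∑ i, c i ^ 2 ≤ ∑ i, ∑ j, c i * c j * k d (z i) (z j)

/-- A crude Gershgorin bound. The penalty `B` is charged on the diagonal too, so that the penalties
add up to B (∑ |cᵢ|)² ≤ n B ∑ cᵢ². -/
theorem sum_mul_sum_ge_of_le {n : ℕ} (M : Fin n → Fin n → ℝ) (A B : ℝ) (hB : 0 ≤ B)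
    (hd : ∀ i, A ≤ M i i) (ho : ∀ i j, i ≠ j → |M i j| ≤ B) (c : Fin n → ℝ) :
    (A - n * B) * ∑ i, c i ^ 2 ≤ ∑ i, ∑ j, c i * c j * M i j := by
  have h1 : ∀ i j, (if i = j then A * c i ^ 2 else 0) - B * (|c i| * |c j|)
      ≤ c i * c j * M i j := by
    intro i j
    have h0 := mul_nonneg hB (mul_nonneg (abs_nonneg (c i)) (abs_nonneg (c j)))
    by_cases hij : i = j
    · subst hij
      have := mul_le_mul_of_nonneg_left (hd i) (sq_nonneg (c i))
      simp only [if_true]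
      nlinarith
    · simp only [hij, if_false]
      have h2 : |c i * c j * M i j| ≤ B * (|c i| * |c j|) := by
        rw [abs_mul, abs_mul, mul_comm]
        exact mul_le_mul_of_nonneg_right (ho i j hij) (by positivity)
      linarith [neg_abs_le (c i * c j * M i j)]
  refine le_trans ?_ (Finset.sum_le_sum fun i _ => Finset.sum_le_sum fun j _ => h1 i j)
  simp only [Finset.sum_sub_distrib, Finset.sum_ite_eq, Finset.mem_univ, if_true,
    ← Finset.mul_sum]
  have h3 : (∑ i, |c i|) * ∑ i, |c i| ≤ n * ∑ i, c i ^ 2 := by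
    have := sq_sum_le_card_mul_sum_sq (s := Finset.univ) (f := fun i => |c i|)
    simpa [sq] using this
  have h4 : ∑ i, |c i| * ∑ j, |c j| = (∑ i, |c i|) * ∑ i, |c i| := (Finset.sum_mul ..).symm
  rw [h4]
  nlinarith [mul_le_mul_of_nonneg_left h3 hB]

/-- It suffices to bound the form of the subtracted term. Its diagonal is at least lo² (1/2)^j₀, as
‖zᵢ‖² ≥ 1/2, and its off-diagonal entries are at most hi² δ^(m+1), as j₀ ≥ m + 1. The condition on
`n` lets the latter consume at most half of the former. -/
theorem eigenvalue_bound_of_sub {m j₀ : ℕ} (hj : m < j₀) {lo hi : ℝ} (hlo : 0 < lo)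
    (hlohi : lo ≤ hi) {d n : ℕ} {δ : ℝ} {k : E d → E d → ℝ} {φ : E d → ℝ}
    (hφ : ∀ x ∈ annulus d (1 / 2), lo ≤ φ x ∧ φ x ≤ hi)
    (hk : IsPSDKernelOn (annulus d (1 / 2)) fun x y => k x y - φ x * φ y * ⟪x, y⟫ ^ j₀)
    (z : Fin n → E d) (hδ : δ ≤ 1 / 2)
    (hn : n * δ ^ (m + 1) ≤ lo ^ 2 * (1 / 2) ^ j₀ / (2 * hi ^ 2))
    (hz : AlmostOrthonormal δ z) (c : Fin n → ℝ) :
    lo ^ 2 * (1 / 2) ^ j₀ / 2 * ∑ i, c i ^ 2 ≤ ∑ i, ∑ j, c i * c j * k (z i) (z j) := by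
  rcases Nat.eq_zero_or_pos n with rfl | hn0
  · simp
  have hδ0 : 0 ≤ δ := hz.nonneg ⟨0, hn0⟩
  have hmem := hz.mem_annulus hδ
  have hhi : 0 < hi := hlo.trans_le hlohi
  have h1 := hk.sum_nonneg hmem c
  have h2 : ∑ i, ∑ j, c i * c j * (k (z i) (z j) - φ (z i) * φ (z j) * ⟪z i, z j⟫ ^ j₀)
      = ∑ i, ∑ j, c i * c j * k (z i) (z j)
        - ∑ i, ∑ j, c i * c j * (φ (z i) * φ (z j) * ⟪z i, z j⟫ ^ j₀) := by
    simp only [mul_sub, Finset.sum_sub_distrib]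
  have h3 := sum_mul_sum_ge_of_le (fun i j => φ (z i) * φ (z j) * ⟪z i, z j⟫ ^ j₀)
    (lo ^ 2 * (1 / 2) ^ j₀) (hi ^ 2 * δ ^ (m + 1)) (by positivity) (fun i => ?_)
    (fun i j hij => ?_) c
  · have h4 : (n : ℝ) * (hi ^ 2 * δ ^ (m + 1)) ≤ lo ^ 2 * (1 / 2) ^ j₀ / 2 := by
      calc (n : ℝ) * (hi ^ 2 * δ ^ (m + 1)) = hi ^ 2 * (n * δ ^ (m + 1)) := by ring
        _ ≤ hi ^ 2 * (lo ^ 2 * (1 / 2) ^ j₀ / (2 * hi ^ 2)) := by gcongr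
        _ = lo ^ 2 * (1 / 2) ^ j₀ / 2 := by field_simp
    have h5 : 0 ≤ ∑ i, c i ^ 2 := Finset.sum_nonneg fun i _ => sq_nonneg _
    nlinarith
  · have h4 := hφ _ (hmem i)
    have h5 : 1 / 2 ≤ ⟪z i, z i⟫ := by
      rw [real_inner_self_eq_norm_sq]
      have := (hmem i).1
      linarith
    calc lo ^ 2 * (1 / 2) ^ j₀ = lo * lo * (1 / 2) ^ j₀ := by ring
      _ ≤ φ (z i) * φ (z i) * ⟪z i, z i⟫ ^ j₀ := by
        have h6 := h4.1
        have h7 : 0 ≤ φ (z i) := hlo.le.trans h6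
        gcongr
  · have h4 := hφ _ (hmem i)
    have h5 := hφ _ (hmem j)
    rw [abs_mul, abs_mul, abs_pow, abs_of_pos (hlo.trans_le h4.1),
      abs_of_pos (hlo.trans_le h5.1), sq hi]
    have h6 : |⟪z i, z j⟫| ^ j₀ ≤ δ ^ (m + 1) :=
      (pow_le_pow_left₀ (abs_nonneg _) (hz.inner i j hij) _).trans
        (pow_le_pow_of_le_one hδ0 (hδ.trans (by norm_num)) hj)
    have h7 : φ (z i) * φ (z j) ≤ hi * hi :=
      mul_le_mul h4.2 h5.2 (hlo.le.trans h5.1) hhi.le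
    exact mul_le_mul h7 h6 (by positivity) (by positivity)

theorem HasEigenvalueBound.of_sub {k : ∀ d : ℕ, E d → E d → ℝ} {m j₀ : ℕ} (hj : m < j₀)
    {lo hi : ℝ} (hlo : 0 < lo) (hlohi : lo ≤ hi) (φ : ∀ d, E d → ℝ)
    (hφ : ∀ d, ∀ x ∈ annulus d (1 / 2), lo ≤ φ d x ∧ φ d x ≤ hi)
    (hk : ∀ d, IsPSDKernelOn (annulus d (1 / 2))
      fun x y => k d x y - φ d x * φ d y * ⟪x, y⟫ ^ j₀) : HasEigenvalueBound k m := by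
  have hhi : 0 < hi := hlo.trans_le hlohi
  refine ⟨lo ^ 2 * (1 / 2) ^ j₀ / 2, by positivity,
    min (1 / 2) (lo ^ 2 * (1 / 2) ^ j₀ / (2 * hi ^ 2)), by positivity,
    fun d n δ z hδ hn hz c => ?_⟩
  exact eigenvalue_bound_of_sub hj hlo hlohi (hφ d) (hk d) z (hδ.trans (min_le_left _ _))
    (hn.trans (min_le_right _ _)) hz c

/-! ### The kernel estimator in terms of the kernel matrix -/

section Estimator

variable {X : Type} {k : X → X → ℝ}

/-- The form of positivity that matches the finitely supported vectors in `RKHS.posSemidef_tfae`. -/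
theorem IsPSDKernelOn.finset_sum_nonneg (hk : IsPSDKernelOn Set.univ k) (s : Finset X)
    (c : X → ℝ) : 0 ≤ ∑ a ∈ s, ∑ b ∈ s, c a * c b * k a b := by
  have h := hk.sum_nonneg (x := fun i => (s.equivFin.symm i : X)) (fun _ => Set.mem_univ _)
    fun i => c (s.equivFin.symm i)
  have h1 : ∀ f : X → ℝ, ∑ i, f (s.equivFin.symm i) = ∑ a ∈ s, f a := by
    intro f
    rw [Equiv.sum_comp s.equivFin.symm (fun a : s => f a), Finset.sum_coe_sort]
  rw [← h1]
  convert h using 2 with i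
  rw [← h1]

/-- The kernel as an operator valued matrix. -/
def kernelMatrix (k : X → X → ℝ) : Matrix X X (ℝ →L[ℝ] ℝ) :=
  Matrix.of fun x y => k x y • ContinuousLinearMap.id ℝ ℝ

theorem posSemidef_kernelMatrix (hk : IsPSDKernelOn Set.univ k) :
    (kernelMatrix k).PosSemidef := by
  have htfae := (RKHS.posSemidef_tfae (K := kernelMatrix k) (𝕜 := ℝ) (V := ℝ)).out 0 2
  refine htfae.2 ⟨?_, fun v => ?_⟩
  · ext x y
    have h1 : star (ContinuousLinearMap.id ℝ ℝ) = ContinuousLinearMap.id ℝ ℝ :=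
      star_one (ℝ →L[ℝ] ℝ)
    simp [kernelMatrix, hk.symm (Set.mem_univ x) (Set.mem_univ y), Matrix.conjTranspose_apply, h1]
  · have := hk.finset_sum_nonneg v.support v
    simp only [Finsupp.sum, kernelMatrix]
    convert this using 1
    simp only [RCLike.re_to_real]
    refine Finset.sum_congr rfl fun a _ => Finset.sum_congr rfl fun b _ => ?_
    simp [hk.symm (Set.mem_univ a) (Set.mem_univ b)]
    ring

/-- The kernel estimate with the weights `a` is characterised by its minimality. -/
theorem minimality_iff {H : Type} [NormedAddCommGroup H] [InnerProductSpace ℝ H]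
    [CompleteSpace H] [RKHS ℝ H X ℝ] (hH : ∀ a b : X, RKHS.kernel H a b 1 = k a b)
    (hk : IsPSDKernelOn Set.univ k) {lam : ℝ} (hlam : 0 ≤ lam) {n : ℕ} (x : Fin n → X)
    (y a : Fin n → ℝ) (ha : ∀ i, ∑ j, k (x i) (x j) * a j + lam * a i = y i) (h : H) :
    ((0 < lam ∧ ∀ h' : H, (∑ i, (y i - h (x i)) ^ 2) + lam * ‖h‖ ^ 2 ≤
          (∑ i, (y i - h' (x i)) ^ 2) + lam * ‖h'‖ ^ 2) ∨
        (lam = 0 ∧ (∀ i, h (x i) = y i) ∧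
          ∀ h' : H, (∀ i, h' (x i) = y i) → ‖h‖ ≤ ‖h'‖)) ↔
      h = ∑ j, a j • RKHS.kerFun H (x j) (1 : ℝ) := by
  set s : H := ∑ j, a j • RKHS.kerFun H (x j) (1 : ℝ) with hs
  have hin : ∀ v : H, ⟪s, v⟫ = ∑ i, a i * v (x i) := by
    intro v
    rw [hs, sum_inner]
    refine Finset.sum_congr rfl fun i _ => ?_
    rw [real_inner_smul_left, RKHS.kerFun_inner]
    simp
  have hsx : ∀ t, s t = ∑ j, a j * k t (x j) := by
    intro t
    have h1 : s t = ⟪s, RKHS.kerFun H t (1 : ℝ)⟫ := by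
      rw [RKHS.inner_kerFun]; simp
    rw [h1, hin]
    refine Finset.sum_congr rfl fun i _ => ?_
    rw [RKHS.kerFun_apply, hH, hk.symm (Set.mem_univ _) (Set.mem_univ _)]
  have hres : ∀ i, y i - s (x i) = lam * a i := by
    intro i
    rw [← ha i, hsx]
    simp only [mul_comm (a _)]
    ring
  have hnorm : ∀ v : H, ‖s + v‖ ^ 2 = ‖s‖ ^ 2 + 2 * ∑ i, a i * v (x i) + ‖v‖ ^ 2 := by
    intro v
    rw [norm_add_sq_real, hin]
  -- The terms linear in `v` cancel: the residuals contribute -2λ ∑ aᵢ v(xᵢ), the squared norm the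
  -- opposite. So `s` is the minimiser, and a strict one if λ > 0.
  have hobj : ∀ v : H, (∑ i, (y i - (s + v) (x i)) ^ 2) + lam * ‖s + v‖ ^ 2 =
      (∑ i, (y i - s (x i)) ^ 2) + lam * ‖s‖ ^ 2 + (∑ i, v (x i) ^ 2 + lam * ‖v‖ ^ 2) := by
    intro v
    have h1 : ∑ i, (y i - (s + v) (x i)) ^ 2 = ∑ i, (y i - s (x i)) ^ 2
        - 2 * lam * ∑ i, a i * v (x i) + ∑ i, v (x i) ^ 2 := by
      rw [Finset.mul_sum, ← Finset.sum_sub_distrib, ← Finset.sum_add_distrib]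
      refine Finset.sum_congr rfl fun i _ => ?_
      have : (s + v) (x i) = s (x i) + v (x i) := by rw [RKHS.coe_add]; rfl
      rw [this, show y i - (s (x i) + v (x i)) = (y i - s (x i)) - v (x i) by ring, sub_sq,
        hres i]
      ring
    rw [h1, hnorm]
    ring
  have hv : ∀ v : H, 0 ≤ ∑ i, v (x i) ^ 2 := fun v => Finset.sum_nonneg fun i _ => sq_nonneg _
  constructor
  · rintro (⟨hl, hmin⟩ | ⟨hl, hint, hmin⟩)
    · have h1 := hmin s
      have h2 := hobj (h - s)
      rw [add_sub_cancel] at h2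
      have h3 := hv (h - s)
      have h4 : lam * ‖h - s‖ ^ 2 ≤ 0 := by linarith
      have h5 : ‖h - s‖ ^ 2 ≤ 0 := by
        by_contra hcon
        push Not at hcon
        nlinarith [mul_pos hl hcon]
      have h6 : ‖h - s‖ = 0 := by
        have := sq_nonneg ‖h - s‖
        exact pow_eq_zero_iff two_ne_zero |>.1 (le_antisymm h5 this)
      exact sub_eq_zero.1 (norm_eq_zero.1 h6)
    · have hsy : ∀ i, s (x i) = y i := fun i => by
        have := hres i
        rw [hl] at this
        linarith
      have h1 := hmin s hsy
      have h2 := hnorm (h - s)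
      rw [add_sub_cancel] at h2
      -- The function `s` is orthogonal to all functions vanishing at the nodes, so Pythagoras
      -- applies to any other interpolant.
      have h3 : ∑ i, a i * (h - s) (x i) = 0 := by
        refine Finset.sum_eq_zero fun i _ => ?_
        have : (h - s) (x i) = h (x i) - s (x i) := by rw [RKHS.coe_sub]; rfl
        rw [this, hint, hsy]
        ring
      have h4 : ‖h‖ ^ 2 ≤ ‖s‖ ^ 2 := by gcongr
      have h6 : ‖h - s‖ = 0 := by
        have := sq_nonneg ‖h - s‖
        rw [h3] at h2
        exact pow_eq_zero_iff two_ne_zero |>.1 (by linarith)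
      exact sub_eq_zero.1 (norm_eq_zero.1 h6)
  · rintro rfl
    rcases hlam.lt_or_eq with hl | hl
    · refine Or.inl ⟨hl, fun h' => ?_⟩
      have h2 := hobj (h' - s)
      rw [add_sub_cancel] at h2
      have := hv (h' - s)
      have : 0 ≤ lam * ‖h' - s‖ ^ 2 := by positivity
      linarith
    · have hsy : ∀ i, s (x i) = y i := fun i => by
        have := hres i
        rw [← hl] at this
        linarith
      refine Or.inr ⟨hl.symm, hsy, fun h' hh' => ?_⟩
      have h2 := hnorm (h' - s)
      rw [add_sub_cancel] at h2
      have h3 : ∑ i, a i * (h' - s) (x i) = 0 := by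
        refine Finset.sum_eq_zero fun i _ => ?_
        have : (h' - s) (x i) = h' (x i) - s (x i) := by rw [RKHS.coe_sub]; rfl
        rw [this, hh', hsy]
        ring
      rw [h3] at h2
      have : 0 ≤ ‖h' - s‖ ^ 2 := by positivity
      exact (sq_le_sq₀ (norm_nonneg _) (norm_nonneg _)).1 (by linarith)

theorem sum_smul_kerFun_apply {H : Type} [NormedAddCommGroup H] [InnerProductSpace ℝ H]
    [CompleteSpace H] [RKHS ℝ H X ℝ] (hH : ∀ a b : X, RKHS.kernel H a b 1 = k a b) {n : ℕ}
    (x : Fin n → X) (a : Fin n → ℝ) (t : X) :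
    (∑ j, a j • RKHS.kerFun H (x j) (1 : ℝ) : H) t = ∑ j, a j * k t (x j) := by
  have h1 : ∀ h : H, h t = ⟪h, RKHS.kerFun H t (1 : ℝ)⟫ := by
    intro h
    rw [RKHS.inner_kerFun]; simp
  rw [h1, sum_inner]
  refine Finset.sum_congr rfl fun i _ => ?_
  rw [real_inner_smul_left, ← h1, RKHS.kerFun_apply, hH]

/-- The estimator is chosen among the estimates in all Hilbert spaces with this kernel. The
minimality criterion identifies the estimate in each of them with the same kernel sum, so the choice
does not matter; the space built from the kernel shows existence. -/
theorem kernelEstimator_eq (hk : IsPSDKernelOn Set.univ k) {lam : ℝ} (hlam : 0 ≤ lam) {n : ℕ}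
    (x : Fin n → X) (y a : Fin n → ℝ)
    (ha : ∀ i, ∑ j, k (x i) (x j) * a j + lam * a i = y i) (t : X) :
    kernelEstimator k lam x y t = ∑ j, a j * k t (x j) := by
  have hex : ∃ f, IsKernelEstimate k lam x y f := by
    have : Fact (kernelMatrix k).PosSemidef := ⟨posSemidef_kernelMatrix hk⟩
    have hH : ∀ a b : X, RKHS.kernel (RKHS.OfKernel (kernelMatrix k)) a b 1 = k a b := by
      intro a b
      rw [RKHS.OfKernel.kernel_ofKernel]
      simp [kernelMatrix]
    refine ⟨_, RKHS.OfKernel (kernelMatrix k), inferInstance, inferInstance, inferInstance,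
      inferInstance, hH, _, fun t => rfl,
      (minimality_iff hH hk hlam x y a ha _).2 rfl⟩
  rw [kernelEstimator, dif_pos hex]
  obtain ⟨H, _, _, _, _, hH, h, hf, hmin⟩ := hex.choose_spec
  rw [← hf t, (minimality_iff hH hk hlam x y a ha h).1 hmin]
  exact sum_smul_kerFun_apply hH x a t

theorem integral_eval_pi {n : ℕ} (ν : Fin n → Measure ℝ) [∀ i, IsProbabilityMeasure (ν i)]
    (i : Fin n) : ∫ y, y i ∂(Measure.pi ν) = ∫ y, y ∂(ν i) := by
  have := (measurePreserving_eval ν i).map_eq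
  rw [← this, integral_map (measurable_pi_apply i).aemeasurable (by fun_prop)]

/-- If the kernel matrix is bounded from below, then the averaged estimator is a combination
of kernel functions with bounded weights. -/
theorem exists_averagedEstimator_eq [MeasurableSpace X] (hk : IsPSDKernelOn Set.univ k)
    {lam : ℝ} (hlam : 0 ≤ lam) (ρ : Kernel X ℝ) [IsMarkovKernel ρ]
    (hρ : ∀ t, Integrable (fun y => y) (ρ t)) {n : ℕ} (x : Fin n → X) {γ : ℝ} (hγ : 0 < γ)
    (hbound : ∀ c : Fin n → ℝ,
      γ * ∑ i, c i ^ 2 ≤ ∑ i, ∑ j, c i * c j * k (x i) (x j)) :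
    ∃ a : Fin n → ℝ, (∀ t, averagedEstimator k lam ρ x t = ∑ i, a i * k t (x i)) ∧
      γ ^ 2 * ∑ i, a i ^ 2 ≤ ∑ i, groundTruth ρ (x i) ^ 2 := by
  set M : Matrix (Fin n) (Fin n) ℝ := (Matrix.of fun i j => k (x i) (x j)) + lam • 1 with hM
  have hMv : ∀ (c : Fin n → ℝ) i, (M.mulVec c) i = ∑ j, k (x i) (x j) * c j + lam * c i := by
    intro c i
    rw [hM, Matrix.add_mulVec, Matrix.smul_mulVec, Matrix.one_mulVec]
    simp [Matrix.mulVec, dotProduct]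
  have hquad : ∀ c : Fin n → ℝ, γ * ∑ i, c i ^ 2 ≤ ∑ i, c i * (M.mulVec c) i := by
    intro c
    refine (hbound c).trans ?_
    refine Finset.sum_le_sum fun i _ => ?_
    rw [hMv, mul_add, Finset.mul_sum]
    have h0 : 0 ≤ c i * (lam * c i) := by nlinarith [mul_nonneg hlam (mul_self_nonneg (c i))]
    have : ∑ j, c i * c j * k (x i) (x j) = ∑ j, c i * (k (x i) (x j) * c j) :=
      Finset.sum_congr rfl fun j _ => by ring
    linarith
  have hunit : IsUnit M := by
    rw [← Matrix.mulVec_injective_iff_isUnit]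
    intro c c' hcc
    have h1 : M.mulVec (c - c') = 0 := by rw [Matrix.mulVec_sub, sub_eq_zero]; exact hcc
    have h2 := hquad (c - c')
    rw [h1] at h2
    simp only [Pi.zero_apply, mul_zero, Finset.sum_const_zero] at h2
    have h3 : 0 ≤ ∑ i, (c - c') i ^ 2 := Finset.sum_nonneg fun i _ => sq_nonneg _
    have h4 : ∑ i, (c - c') i ^ 2 = 0 := by
      by_contra hne
      have := lt_of_le_of_ne h3 (Ne.symm hne)
      nlinarith [mul_pos hγ this]
    rw [Finset.sum_eq_zero_iff_of_nonneg fun i _ => sq_nonneg _] at h4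
    ext i
    have := pow_eq_zero_iff two_ne_zero |>.1 (h4 i (Finset.mem_univ i))
    simpa [sub_eq_zero] using this
  have hsol : ∀ y : Fin n → ℝ, M.mulVec (M⁻¹.mulVec y) = y := by
    intro y
    rw [Matrix.mulVec_mulVec, Matrix.mul_nonsing_inv _ ((Matrix.isUnit_iff_isUnit_det _).1 hunit),
      Matrix.one_mulVec]
  set g : Fin n → ℝ := fun i => groundTruth ρ (x i) with hg
  -- The weights M⁻¹y depend linearly on the responses, so averaging replaces `y` by its conditional
  -- mean `g`.
  refine ⟨M⁻¹.mulVec g, fun t => ?_, ?_⟩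
  · have h1 : ∀ y : Fin n → ℝ, kernelEstimator k lam x y t =
        ∑ i, (∑ j, M⁻¹ i j * y j) * k t (x i) := fun y =>
      kernelEstimator_eq hk hlam x y (M⁻¹.mulVec y) (fun i => by rw [← hMv, hsol]) t
    have hint : ∀ j, Integrable (fun y : Fin n → ℝ => y j) (Measure.pi fun i => ρ (x i)) := by
      intro j
      have := (measurePreserving_eval (fun i => ρ (x i)) j).integrable_comp_of_integrable
        (hρ (x j))
      exact this
    simp only [averagedEstimator, h1]
    rw [integral_finsetSum]
    · refine Finset.sum_congr rfl fun i _ => ?_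
      rw [integral_mul_const, integral_finsetSum]
      · congr 1
        refine Finset.sum_congr rfl fun j _ => ?_
        rw [integral_const_mul, integral_eval_pi]
        rfl
      · exact fun j _ => (hint j).const_mul _
    · exact fun i _ => (integrable_finsetSum _ fun j _ => (hint j).const_mul _).mul_const _
  · set a := M⁻¹.mulVec g
    have h1 := hquad a
    rw [hsol g] at h1
    -- From γ‖a‖² ≤ ⟨a, Ma⟩ = ⟨a, g⟩ ≤ ‖a‖‖g‖ one factor ‖a‖ is cancelled.
    have h2 := Finset.sum_mul_sq_le_sq_mul_sq Finset.univ a g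
    have h3 : 0 ≤ ∑ i, a i ^ 2 := Finset.sum_nonneg fun i _ => sq_nonneg _
    have h4 : 0 ≤ ∑ i, g i ^ 2 := Finset.sum_nonneg fun i _ => sq_nonneg _
    rcases h3.eq_or_lt with h5 | h5
    · rw [← h5]
      simpa using h4
    · have h6 : (γ * ∑ i, a i ^ 2) ^ 2 ≤ (∑ i, a i * g i) ^ 2 := by gcongr
      refine le_of_mul_le_mul_left ?_ h5
      calc (∑ i, a i ^ 2) * (γ ^ 2 * ∑ i, a i ^ 2) = (γ * ∑ i, a i ^ 2) ^ 2 := by ring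
        _ ≤ _ := h6.trans h2

end Estimator

/-! ### Moment inequalities -/

section Moments

variable {Ω : Type*} [MeasurableSpace Ω] {μ : Measure Ω}

theorem sq_lintegral_mul_le {f g : Ω → ℝ≥0∞} (hf : AEMeasurable f μ) (hg : AEMeasurable g μ) :
    (∫⁻ x, f x * g x ∂μ) ^ 2 ≤ (∫⁻ x, f x ^ 2 ∂μ) * ∫⁻ x, g x ^ 2 ∂μ := by
  have h := ENNReal.lintegral_mul_le_Lp_mul_Lq μ Real.HolderConjugate.two_two hf hg
  have h2 : ∀ a : ℝ≥0∞, (a ^ (1 / 2 : ℝ)) ^ 2 = a := fun a => by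
    rw [← ENNReal.rpow_natCast, ← ENNReal.rpow_mul]; norm_num
  calc _ ≤ ((∫⁻ a, f a ^ (2 : ℝ) ∂μ) ^ (1 / 2 : ℝ) * (∫⁻ a, g a ^ (2 : ℝ) ∂μ) ^ (1 / 2 : ℝ)) ^ 2 :=
        pow_le_pow_left' h 2
    _ = _ := by
      rw [mul_pow, h2, h2]
      simp

theorem lintegral_add_pow_rpow_le {p : ℕ} (hp : p ≠ 0) {f g : Ω → ℝ≥0∞}
    (hf : AEMeasurable f μ) (hg : AEMeasurable g μ) :
    (∫⁻ x, (f x + g x) ^ p ∂μ) ^ (1 / p : ℝ) ≤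
      (∫⁻ x, f x ^ p ∂μ) ^ (1 / p : ℝ) + (∫⁻ x, g x ^ p ∂μ) ^ (1 / p : ℝ) := by
  have h := ENNReal.lintegral_Lp_add_le (μ := μ) (p := p) hf hg
    (by exact_mod_cast Nat.one_le_iff_ne_zero.2 hp)
  simpa [ENNReal.rpow_natCast] using h

theorem lintegral_finsetSum_pow_rpow_le {ι : Type*} {p : ℕ} (hp : p ≠ 0) (t : Finset ι)
    {f : ι → Ω → ℝ≥0∞} (hf : ∀ i, AEMeasurable (f i) μ) :
    (∫⁻ x, (∑ i ∈ t, f i x) ^ p ∂μ) ^ (1 / p : ℝ) ≤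
      ∑ i ∈ t, (∫⁻ x, f i x ^ p ∂μ) ^ (1 / p : ℝ) := by
  classical
  induction t using Finset.induction_on with
  | empty => simp [hp, Nat.pos_of_ne_zero hp]
  | insert a t ha ih =>
    simp only [Finset.sum_insert ha]
    exact (lintegral_add_pow_rpow_le hp (hf a) (Finset.aemeasurable_fun_sum t fun i _ => hf i)).trans
      (add_le_add le_rfl ih)

/-- If the `p`-th moments of the terms are at most `A * s i ^ p`, then the one of the sum is at
most `A * (∑ i, s i) ^ p`. -/
theorem lintegral_finsetSum_pow_le {ι : Type*} {p : ℕ} (hp : p ≠ 0) (t : Finset ι)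
    {f : ι → Ω → ℝ≥0∞} (hf : ∀ i, AEMeasurable (f i) μ) {A : ℝ≥0∞} {s : ι → ℝ≥0∞}
    (h : ∀ i ∈ t, ∫⁻ x, f i x ^ p ∂μ ≤ A * s i ^ p) :
    ∫⁻ x, (∑ i ∈ t, f i x) ^ p ∂μ ≤ A * (∑ i ∈ t, s i) ^ p := by
  have hroot : ∀ a : ℝ≥0∞, (a ^ p) ^ (1 / p : ℝ) = a := fun a => by
    rw [← ENNReal.rpow_natCast, ← ENNReal.rpow_mul]
    field_simp
    simp
  have hroot' : ∀ a : ℝ≥0∞, (a ^ (1 / p : ℝ)) ^ p = a := fun a => by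
    rw [← ENNReal.rpow_natCast, ← ENNReal.rpow_mul]
    field_simp
    simp
  have h1 : (∫⁻ x, (∑ i ∈ t, f i x) ^ p ∂μ) ^ (1 / p : ℝ) ≤ A ^ (1 / p : ℝ) * ∑ i ∈ t, s i := by
    refine (lintegral_finsetSum_pow_rpow_le hp t hf).trans ?_
    rw [Finset.mul_sum]
    refine Finset.sum_le_sum fun i hi => ?_
    refine (ENNReal.rpow_le_rpow (h i hi) (by positivity)).trans ?_
    rw [ENNReal.mul_rpow_of_nonneg _ _ (by positivity), hroot]
  have h2 := pow_le_pow_left' h1 p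
  rwa [hroot', mul_pow, hroot'] at h2

theorem lintegral_add_pow_le {p : ℕ} (hp : p ≠ 0) {f g : Ω → ℝ≥0∞}
    (hf : AEMeasurable f μ) (hg : AEMeasurable g μ) {A s : ℝ≥0∞}
    (h1 : ∫⁻ x, f x ^ p ∂μ ≤ A * s ^ p) (h2 : ∫⁻ x, g x ^ p ∂μ ≤ A * s ^ p) :
    ∫⁻ x, (f x + g x) ^ p ∂μ ≤ A * (2 * s) ^ p := by
  have := lintegral_finsetSum_pow_le (μ := μ) hp Finset.univ (f := ![f, g])
    (by intro i; fin_cases i <;> simpa) (A := A) (s := fun _ => s)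
    (by intro i _; fin_cases i <;> simpa)
  simpa [two_mul] using this

theorem pow_lintegral_le [IsProbabilityMeasure μ] {f : Ω → ℝ≥0∞} (hf : AEMeasurable f μ)
    (n : ℕ) : (∫⁻ x, f x ∂μ) ^ n ≤ ∫⁻ x, f x ^ n ∂μ := by
  rcases n with _ | _ | n
  · simp
  · simp
  have hn : (1 : ℝ) < (n + 2 : ℕ) := by exact_mod_cast (by lia : 1 < n + 2)
  have h := ENNReal.lintegral_mul_le_Lp_mul_Lq μ (Real.HolderConjugate.conjExponent hn) hf
    (aemeasurable_const (b := (1 : ℝ≥0∞)))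
  simp only [Pi.mul_apply, mul_one, ENNReal.one_rpow, lintegral_one, measure_univ] at h
  have h2 := pow_le_pow_left' h (n + 2)
  rw [← ENNReal.rpow_natCast (_ ^ _), ← ENNReal.rpow_mul] at h2
  rw [one_div_mul_cancel (by positivity), ENNReal.rpow_one] at h2
  simpa only [ENNReal.rpow_natCast] using h2

theorem pow_le_factorial_mul_exp_add_exp (x : ℝ) (q : ℕ) :
    |x| ^ q ≤ q.factorial * (Real.exp x + Real.exp (-x)) := by
  have h1 := Real.pow_div_factorial_le_exp |x| (abs_nonneg x) q
  rw [div_le_iff₀ (by positivity)] at h1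
  refine h1.trans ?_
  rw [mul_comm]
  gcongr
  rcases abs_cases x with ⟨h, _⟩ | ⟨h, _⟩ <;> rw [h]
  · linarith [Real.exp_pos (-x)]
  · linarith [Real.exp_pos x]

/-- The moments of sub-Gaussian random variables. -/
theorem lintegral_enorm_pow_le_of_hasSubgaussianMGF {X : Ω → ℝ} {c : ℝ≥0}
    (h : HasSubgaussianMGF X c μ) (q : ℕ) :
    ∫⁻ ω, ‖X ω‖ₑ ^ (2 * q) ∂μ
      ≤ ENNReal.ofReal ((2 * q).factorial * (2 * Real.exp (1 / 2))) * (c : ℝ≥0∞) ^ q := by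
  rcases eq_or_ne q 0 with rfl | hq
  · have h1 : mgf X μ 0 ≤ 1 := by simpa using h.mgf_le 0
    have : IsFiniteMeasure μ := by
      have := h.integrable_exp_mul 0
      simpa [integrable_const_iff] using this
    have h2 : μ Set.univ ≤ 1 := by
      simp only [mgf_zero', measureReal_def] at h1
      rw [← ENNReal.ofReal_toReal (measure_ne_top μ Set.univ)]
      exact ENNReal.ofReal_le_one.2 h1
    simp only [mul_zero, pow_zero, lintegral_one, Nat.factorial_zero, Nat.cast_one, one_mul,
      mul_one]
    refine h2.trans ?_
    rw [← ENNReal.ofReal_one]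
    refine ENNReal.ofReal_le_ofReal ?_
    have := Real.add_one_le_exp (1 / 2 : ℝ)
    linarith
  rcases eq_or_ne c 0 with rfl | hc
  · have h0 := h.ae_eq_zero_of_hasSubgaussianMGF_zero
    have : ∫⁻ ω, ‖X ω‖ₑ ^ (2 * q) ∂μ = ∫⁻ ω, 0 ∂μ := by
      refine lintegral_congr_ae ?_
      filter_upwards [h0] with ω hω
      simp [hω, hq]
    simp [this]
  -- The variable is rescaled by √c: at the arguments ±1/√c the bound for the moment generating
  -- function is exp(1/2).
  set r : ℝ := Real.sqrt c with hr
  have hcpos : (0 : ℝ) < c := by positivity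
  have hrpos : 0 < r := Real.sqrt_pos.2 hcpos
  have hr2 : r ^ 2 = c := Real.sq_sqrt hcpos.le
  have hpt : ∀ ω, ‖X ω‖ₑ ^ (2 * q) ≤ ENNReal.ofReal (c ^ q * ((2 * q).factorial *
      (Real.exp (r⁻¹ * X ω) + Real.exp (-r⁻¹ * X ω)))) := by
    intro ω
    rw [Real.enorm_eq_ofReal_abs, ← ENNReal.ofReal_pow (abs_nonneg _)]
    refine ENNReal.ofReal_le_ofReal ?_
    have h1 := pow_le_factorial_mul_exp_add_exp (r⁻¹ * X ω) (2 * q)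
    rw [abs_mul, mul_pow, abs_of_pos (inv_pos.2 hrpos), pow_mul, inv_pow, hr2, inv_pow,
      ← neg_mul, inv_mul_le_iff₀ (by positivity)] at h1
    exact h1
  have hint : ∀ t, ∫ ω, Real.exp (t * X ω) ∂μ ≤ Real.exp (c * t ^ 2 / 2) := h.mgf_le
  have h3 : (c : ℝ) * r⁻¹ ^ 2 / 2 = 1 / 2 := by
    rw [inv_pow, hr2]; field_simp
  refine (lintegral_mono hpt).trans ?_
  rw [← ofReal_integral_eq_lintegral_ofReal]
  · rw [integral_const_mul, integral_const_mul,
      integral_add (h.integrable_exp_mul _) (h.integrable_exp_mul _), ← ENNReal.ofReal_coe_nnreal,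
      ← ENNReal.ofReal_pow (by positivity), ← ENNReal.ofReal_mul (by positivity)]
    refine ENNReal.ofReal_le_ofReal ?_
    have h4 := hint r⁻¹
    have h5 := hint (-r⁻¹)
    rw [neg_sq] at h5
    rw [h3] at h4 h5
    rw [mul_comm]
    gcongr
    linarith
  · exact (((h.integrable_exp_mul _).add (h.integrable_exp_mul _)).const_mul _).const_mul _
  · exact ae_of_all _ fun ω => by positivity

/-- Markov's inequality for moments. -/
theorem measure_lt_abs_le {X : Ω → ℝ} (hX : AEMeasurable X μ) {q : ℕ} {s A : ℝ}
    (hs : 0 < s) (h : ∫⁻ ω, ‖X ω‖ₑ ^ q ∂μ ≤ ENNReal.ofReal A) :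
    μ {ω | s < |X ω|} ≤ ENNReal.ofReal (A / s ^ q) := by
  have h1 : {ω | s < |X ω|} ⊆ {ω | ENNReal.ofReal (s ^ q) ≤ ‖X ω‖ₑ ^ q} := by
    intro ω hω
    change _ ≤ ‖X ω‖ₑ ^ q
    rw [Real.enorm_eq_ofReal_abs, ← ENNReal.ofReal_pow (abs_nonneg _)]
    exact ENNReal.ofReal_le_ofReal (pow_le_pow_left₀ hs.le (le_of_lt hω) _)
  refine (measure_mono h1).trans ?_
  refine (meas_ge_le_lintegral_div (hX.enorm.pow_const q) ?_ ENNReal.ofReal_ne_top).trans ?_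
  · simpa using pow_pos hs q
  · rw [ENNReal.ofReal_div_of_pos (by positivity)]
    gcongr

end Moments

/-! ### Rademacher averages -/

/-- The signs `±1`. -/
def boolSign (b : Bool) : ℝ := if b then -1 else 1

/-- The sum over the signs factorises into hyperbolic cosines, and cosh a ≤ exp(a²/2). -/
theorem sum_exp_boolSign_le {d : ℕ} (a : Fin d → ℝ) :
    ∑ b : Fin d → Bool, Real.exp (∑ i, boolSign (b i) * a i)
      ≤ 2 ^ d * Real.exp ((∑ i, a i ^ 2) / 2) := by
  have h1 : ∑ b : Fin d → Bool, Real.exp (∑ i, boolSign (b i) * a i)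
      = ∏ i, (2 * Real.cosh (a i)) := by
    simp only [Real.exp_sum]
    rw [← Fintype.prod_sum (fun (i : Fin d) (b : Bool) => Real.exp (boolSign b * a i))]
    refine Finset.prod_congr rfl fun i _ => ?_
    rw [Fintype.sum_bool, Real.cosh_eq]
    simp [boolSign]
    ring
  rw [h1, Finset.prod_mul_distrib, Finset.prod_const, Finset.card_univ, Fintype.card_fin,
    Finset.sum_div, Real.exp_sum]
  gcongr with i
  exact Real.cosh_le_exp_half_sq _

/-- Khintchine's inequality for even moments. -/
theorem sum_pow_boolSign_le {d : ℕ} (a : Fin d → ℝ) (q : ℕ) :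
    ∑ b : Fin d → Bool, |∑ i, boolSign (b i) * a i| ^ (2 * q)
      ≤ 2 ^ d * ((2 * q).factorial * (2 * Real.exp (1 / 2)) * (∑ i, a i ^ 2) ^ q) := by
  have hv0 : 0 ≤ ∑ i, a i ^ 2 := Finset.sum_nonneg fun i _ => sq_nonneg _
  rcases hv0.eq_or_lt with hv | hv
  · have ha : ∀ i, a i = 0 := by
      intro i
      have := (Finset.sum_eq_zero_iff_of_nonneg fun i _ => sq_nonneg (a i)).1 hv.symm i
        (Finset.mem_univ i)
      exact pow_eq_zero_iff two_ne_zero |>.1 this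
    rcases eq_or_ne q 0 with rfl | hq
    · simp
      have := Real.add_one_le_exp (2⁻¹ : ℝ)
      have h2 : (0 : ℝ) < 2 ^ d := by positivity
      nlinarith
    · simp [ha, hq]
  set r : ℝ := Real.sqrt (∑ i, a i ^ 2) with hr
  have hrpos : 0 < r := Real.sqrt_pos.2 hv
  have hr2 : r ^ 2 = ∑ i, a i ^ 2 := Real.sq_sqrt hv0
  have h1 : ∀ b : Fin d → Bool, |∑ i, boolSign (b i) * a i| ^ (2 * q) ≤
      (∑ i, a i ^ 2) ^ q * ((2 * q).factorial *
        (Real.exp (∑ i, boolSign (b i) * (r⁻¹ * a i))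
          + Real.exp (∑ i, boolSign (b i) * (-r⁻¹ * a i)))) := by
    intro b
    have h2 := pow_le_factorial_mul_exp_add_exp (r⁻¹ * ∑ i, boolSign (b i) * a i) (2 * q)
    rw [abs_mul, mul_pow, abs_of_pos (inv_pos.2 hrpos), pow_mul, inv_pow, hr2, inv_pow,
      ← neg_mul, inv_mul_le_iff₀ (by positivity), Finset.mul_sum, Finset.mul_sum] at h2
    simpa only [mul_left_comm] using h2
  refine (Finset.sum_le_sum fun b _ => h1 b).trans ?_
  rw [← Finset.mul_sum, ← Finset.mul_sum, Finset.sum_add_distrib]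
  have h3 := sum_exp_boolSign_le fun i => r⁻¹ * a i
  have h4 := sum_exp_boolSign_le fun i => -r⁻¹ * a i
  have h5 : (∑ i, (r⁻¹ * a i) ^ 2) / 2 = 1 / 2 := by
    simp only [mul_pow]
    rw [← Finset.mul_sum, inv_pow, hr2]
    field_simp
  have h6 : (∑ i, (-r⁻¹ * a i) ^ 2) / 2 = 1 / 2 := by
    simp only [mul_pow, neg_sq]
    rw [← Finset.mul_sum, inv_pow, hr2]
    field_simp
  rw [h5] at h3
  rw [h6] at h4
  calc _ ≤ (∑ i, a i ^ 2) ^ q * ((2 * q).factorial *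
        (2 ^ d * Real.exp (1 / 2) + 2 ^ d * Real.exp (1 / 2))) := by gcongr
    _ = _ := by ring

/-! ### Concentration of quadratic forms -/

/-- Sub-Gaussian laws with mean zero and variance one. -/
structure IsSubgaussianLaw (c : ℝ≥0) (P : Measure ℝ) : Prop where
  isProbabilityMeasure : IsProbabilityMeasure P
  subgaussian : HasSubgaussianMGF (fun w => w) c P
  mean : ∫ w, w ∂P = 0
  secondMoment : ∫ w, w ^ 2 ∂P = 1

/-- For laws with bounded support this is Hoeffding's lemma. -/
theorem IsEntryLaw.exists_isSubgaussianLaw {P : Measure ℝ} (hP : IsEntryLaw P) :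
    ∃ c, IsSubgaussianLaw c P := by
  rcases hP with rfl | ⟨h1, ⟨B, hB⟩, h3, h4⟩
  · refine ⟨1, inferInstance, ⟨fun t => integrable_exp_mul_gaussianReal t, fun t => ?_⟩, ?_, ?_⟩
    · rw [mgf_fun_id_gaussianReal]; simp
    · exact integral_id_gaussianReal
    · have := variance_of_integral_eq_zero (μ := gaussianReal 0 1) (X := fun w => w)
        (by fun_prop) integral_id_gaussianReal
      rw [← this]
      simp
  · exact ⟨_, h1, hasSubgaussianMGF_of_mem_Icc_of_integral_eq_zero (a := -B) (b := B)
      aemeasurable_id (by filter_upwards [hB] with w hw using abs_le.1 hw) h3, h3, h4⟩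

/-- The constants in the moment bounds for sub-Gaussian random variables. -/
noncomputable def momentConst (c : ℝ≥0) (q : ℕ) : ℝ≥0∞ :=
  ENNReal.ofReal ((2 * q).factorial * (2 * Real.exp (1 / 2))) * (c : ℝ≥0∞) ^ q

theorem momentConst_ne_top (c : ℝ≥0) (q : ℕ) : momentConst c q ≠ ∞ :=
  ENNReal.mul_ne_top ENNReal.ofReal_ne_top (ENNReal.pow_ne_top ENNReal.coe_ne_top)

section Pi

variable {c : ℝ≥0} {P : Measure ℝ} {d : ℕ}

theorem IsSubgaussianLaw.linear (hP : IsSubgaussianLaw c P) (a : Fin d → ℝ) :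
    HasSubgaussianMGF (fun w : Fin d → ℝ => ∑ i, a i * w i)
      ((∑ i, a i ^ 2).toNNReal * c) (Measure.pi fun _ => P) := by
  have := hP.isProbabilityMeasure
  have hind : iIndepFun (fun i (w : Fin d → ℝ) => a i * w i) (Measure.pi fun _ : Fin d => P) :=
    iIndepFun_pi (X := fun i w => a i * w) fun i => by fun_prop
  have h := HasSubgaussianMGF.sum_of_iIndepFun (s := Finset.univ) hind
    (c := fun i => (a i ^ 2).toNNReal * c) fun i _ => ?_
  · convert h using 1
    rw [← Finset.sum_mul, Real.toNNReal_sum_of_nonneg fun i _ => sq_nonneg _]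
  · have h1 : HasSubgaussianMGF (fun w : Fin d → ℝ => w i) c (Measure.pi fun _ => P) := by
      have h2 : HasSubgaussianMGF (fun w => w) c
          ((Measure.pi fun _ : Fin d => P).map fun f => f i) := by
        have h3 := (measurePreserving_eval (fun _ : Fin d => P) i).map_eq
        change Measure.map (fun f : Fin d → ℝ => f i) _ = P at h3
        rw [h3]
        exact hP.subgaussian
      exact HasSubgaussianMGF.of_map (Y := fun f : Fin d → ℝ => f i) (X := fun w => w)
        (measurable_pi_apply i).aemeasurable h2
    rw [Real.toNNReal_of_nonneg (sq_nonneg (a i))]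
    exact h1.const_mul (a i)

theorem IsSubgaussianLaw.lintegral_linear_pow_le (hP : IsSubgaussianLaw c P) (a : Fin d → ℝ)
    (q : ℕ) : ∫⁻ w, ‖∑ i, a i * w i‖ₑ ^ (2 * q) ∂(Measure.pi fun _ => P)
      ≤ momentConst c q * ENNReal.ofReal (∑ i, a i ^ 2) ^ q := by
  refine (lintegral_enorm_pow_le_of_hasSubgaussianMGF (hP.linear a) q).trans_eq ?_
  rw [momentConst, ENNReal.coe_mul, mul_pow, mul_assoc, mul_comm ((c : ℝ≥0∞) ^ q)]
  rfl

theorem IsSubgaussianLaw.memLp_eval (hP : IsSubgaussianLaw c P) (i : Fin d) :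
    MemLp (fun w : Fin d → ℝ => w i) 2 (Measure.pi fun _ => P) := by
  have := hP.isProbabilityMeasure
  have h := hP.subgaussian.memLp 2
  exact h.comp_measurePreserving (measurePreserving_eval (fun _ : Fin d => P) i)

theorem IsSubgaussianLaw.integrable_mul (hP : IsSubgaussianLaw c P) (i j : Fin d) :
    Integrable (fun w : Fin d → ℝ => w i * w j) (Measure.pi fun _ => P) :=
  (hP.memLp_eval i).integrable_mul (hP.memLp_eval j)

theorem IsSubgaussianLaw.integral_mul (hP : IsSubgaussianLaw c P) (i j : Fin d) :
    ∫ w : Fin d → ℝ, w i * w j ∂(Measure.pi fun _ => P) = if i = j then 1 else 0 := by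
  have := hP.isProbabilityMeasure
  split_ifs with hij
  · subst hij
    have h := (measurePreserving_eval (fun _ : Fin d => P) i).map_eq
    have h1 := hP.secondMoment
    rw [← h, integral_map (measurable_pi_apply i).aemeasurable (by fun_prop)] at h1
    rw [← h1]
    exact integral_congr_ae (ae_of_all _ fun w => (sq _).symm)
  · have hind : iIndepFun (fun i (w : Fin d → ℝ) => w i) (Measure.pi fun _ : Fin d => P) :=
      iIndepFun_pi (X := fun i w => w) fun i => by fun_prop
    have h2 := (hind.indepFun hij).integral_fun_mul_eq_mul_integral
      (measurable_pi_apply i).aestronglyMeasurable (measurable_pi_apply j).aestronglyMeasurable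
    rw [h2, integral_eval_pi, hP.mean, zero_mul]

/-- The quadratic form of a matrix. -/
def quadForm (S : Fin d → Fin d → ℝ) (w : Fin d → ℝ) : ℝ := ∑ i, ∑ j, S i j * (w i * w j)

theorem measurable_quadForm (S : Fin d → Fin d → ℝ) : Measurable (quadForm S) := by
  unfold quadForm
  fun_prop

theorem IsSubgaussianLaw.integrable_quadForm (hP : IsSubgaussianLaw c P)
    (S : Fin d → Fin d → ℝ) : Integrable (quadForm S) (Measure.pi fun _ => P) :=
  integrable_finsetSum _ fun i _ => integrable_finsetSum _ fun j _ =>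
    (hP.integrable_mul i j).const_mul _

theorem IsSubgaussianLaw.integral_quadForm (hP : IsSubgaussianLaw c P)
    (S : Fin d → Fin d → ℝ) : ∫ w, quadForm S w ∂(Measure.pi fun _ => P) = ∑ i, S i i := by
  unfold quadForm
  rw [integral_finsetSum _ fun i _ => integrable_finsetSum _ fun j _ =>
    (hP.integrable_mul i j).const_mul _]
  refine Finset.sum_congr rfl fun i _ => ?_
  rw [integral_finsetSum _ fun j _ => (hP.integrable_mul i j).const_mul _]
  simp [integral_const_mul, hP.integral_mul]

/-- Polarisation. The point of this form is that exchanging `w i` and `w' i` changes the sign of the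
i-th outer factor and leaves the inner sums alone. -/
theorem quadForm_sub_quadForm {S : Fin d → Fin d → ℝ} (hS : ∀ i j, S i j = S j i)
    (w w' : Fin d → ℝ) : quadForm S w - quadForm S w' =
      ∑ i, (w i - w' i) * ∑ j, S i j * (w j + w' j) := by
  have h1 : ∑ i, (w i - w' i) * ∑ j, S i j * (w j + w' j) =
      quadForm S w - quadForm S w' + (∑ i, ∑ j, S i j * (w i * w' j)
        - ∑ i, ∑ j, S i j * (w' i * w j)) := by
    simp only [quadForm, ← Finset.sum_sub_distrib, ← Finset.sum_add_distrib, Finset.mul_sum]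
    exact Finset.sum_congr rfl fun i _ => Finset.sum_congr rfl fun j _ => by ring
  have h2 : ∑ i, ∑ j, S i j * (w' i * w j) = ∑ i, ∑ j, S i j * (w i * w' j) := by
    rw [Finset.sum_comm]
    exact Finset.sum_congr rfl fun i _ => Finset.sum_congr rfl fun j _ => by rw [hS]; ring
  rw [h1, h2]
  ring

/-- Comparison of the moments of a centred quadratic form with those of a symmetrised one. -/
theorem IsSubgaussianLaw.lintegral_quadForm_le (hP : IsSubgaussianLaw c P)
    {S : Fin d → Fin d → ℝ} (hS : ∀ i j, S i j = S j i) (p : ℕ) :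
    ∫⁻ w, ‖quadForm S w - (∑ i, S i i)‖ₑ ^ p ∂(Measure.pi fun _ => P) ≤
      ∫⁻ v : Fin d → ℝ × ℝ, ‖∑ i, ((v i).1 - (v i).2) * ∑ j, S i j * ((v j).1 + (v j).2)‖ₑ ^ p
        ∂(Measure.pi fun _ => P.prod P) := by
  have := hP.isProbabilityMeasure
  have hmeas := measurable_quadForm S
  have h1 : ∀ w, ‖quadForm S w - (∑ i, S i i)‖ₑ ^ p ≤
      ∫⁻ w', ‖quadForm S w - quadForm S w'‖ₑ ^ p ∂(Measure.pi fun _ => P) := by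
    intro w
    refine le_trans (pow_le_pow_left' ?_ p) (pow_lintegral_le (by fun_prop) p)
    refine le_trans (le_of_eq ?_) (enorm_integral_le_lintegral_enorm _)
    rw [integral_sub (integrable_const _) (hP.integrable_quadForm S), hP.integral_quadForm]
    simp
  refine (lintegral_mono h1).trans ?_
  have h2 := (measurePreserving_arrowProdEquivProdArrow ℝ ℝ (Fin d) (fun _ => P)
    (fun _ => P)).lintegral_comp (f := fun v : (Fin d → ℝ) × (Fin d → ℝ) =>
      ‖quadForm S v.1 - quadForm S v.2‖ₑ ^ p) (by fun_prop)
  rw [lintegral_prod _ (by fun_prop)] at h2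
  rw [← h2]
  refine le_of_eq (lintegral_congr fun v => ?_)
  rw [quadForm_sub_quadForm hS]
  rfl

theorem measurePreserving_swap_of_bool [IsProbabilityMeasure P] (b : Fin d → Bool) :
    MeasurePreserving (fun (v : Fin d → ℝ × ℝ) i => if b i then (v i).swap else v i)
      (Measure.pi fun _ => P.prod P) (Measure.pi fun _ => P.prod P) := by
  refine measurePreserving_pi (fun _ : Fin d => P.prod P) (fun _ => P.prod P)
    (f := fun i (v : ℝ × ℝ) => if b i then v.swap else v) fun i => ?_
  cases b i
  · exact MeasurePreserving.id (P.prod P)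
  · simpa using Measure.measurePreserving_swap

/-- The law of the pairs is invariant under swapping the two copies in any set of coordinates, which
multiplies the i-th term by an arbitrary sign. The integral thus equals its average over all signs,
and Khintchine's inequality bounds that average for each fixed `v`. -/
theorem IsSubgaussianLaw.lintegral_symmetrized_le (hP : IsSubgaussianLaw c P)
    (S : Fin d → Fin d → ℝ) (q : ℕ) :
    ∫⁻ v : Fin d → ℝ × ℝ, ‖∑ i, ((v i).1 - (v i).2) * ∑ j, S i j * ((v j).1 + (v j).2)‖ₑ ^ (2 * q)
        ∂(Measure.pi fun _ => P.prod P) ≤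
      momentConst 1 q * ∫⁻ v : Fin d → ℝ × ℝ, (∑ i, ‖(v i).1 - (v i).2‖ₑ ^ 2 *
        ‖∑ j, S i j * ((v j).1 + (v j).2)‖ₑ ^ 2) ^ q ∂(Measure.pi fun _ => P.prod P) := by
  have := hP.isProbabilityMeasure
  set F : (Fin d → Bool) → (Fin d → ℝ × ℝ) → ℝ≥0∞ := fun b v =>
    ‖∑ i, boolSign (b i) * (((v i).1 - (v i).2) * ∑ j, S i j * ((v j).1 + (v j).2))‖ₑ ^ (2 * q)
    with hF
  have hFm : ∀ b, Measurable (F b) := fun b => by fun_prop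
  have h1 : ∀ b, ∫⁻ v, F b v ∂(Measure.pi fun _ => P.prod P) =
      ∫⁻ v : Fin d → ℝ × ℝ, ‖∑ i, ((v i).1 - (v i).2) * ∑ j, S i j * ((v j).1 + (v j).2)‖ₑ
        ^ (2 * q) ∂(Measure.pi fun _ => P.prod P) := by
    intro b
    rw [← (measurePreserving_swap_of_bool b).lintegral_comp (f := fun v : Fin d → ℝ × ℝ =>
      ‖∑ i, ((v i).1 - (v i).2) * ∑ j, S i j * ((v j).1 + (v j).2)‖ₑ ^ (2 * q)) (by fun_prop)]
    refine lintegral_congr fun v => ?_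
    simp only [hF]
    refine congrArg (fun x : ℝ => ‖x‖ₑ ^ (2 * q)) (Finset.sum_congr rfl fun i _ => ?_)
    have h3 : ∀ j, (if b j then (v j).swap else v j).1 + (if b j then (v j).swap else v j).2
        = (v j).1 + (v j).2 := by
      intro j
      cases b j <;> simp [add_comm]
    have h4 : (if b i then (v i).swap else v i).1 - (if b i then (v i).swap else v i).2
        = boolSign (b i) * ((v i).1 - (v i).2) := by
      cases b i <;> simp [boolSign]
    simp only [h3, h4]
    ring
  have h2 : (2 ^ d : ℝ≥0∞) * ∫⁻ v : Fin d → ℝ × ℝ, ‖∑ i, ((v i).1 - (v i).2) *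
      ∑ j, S i j * ((v j).1 + (v j).2)‖ₑ ^ (2 * q) ∂(Measure.pi fun _ => P.prod P) =
      ∫⁻ v, ∑ b, F b v ∂(Measure.pi fun _ => P.prod P) := by
    rw [lintegral_finsetSum _ fun b _ => hFm b]
    simp [h1]
  have h3 : ∀ v, ∑ b, F b v ≤ 2 ^ d * (momentConst 1 q * (∑ i, ‖(v i).1 - (v i).2‖ₑ ^ 2 *
        ‖∑ j, S i j * ((v j).1 + (v j).2)‖ₑ ^ 2) ^ q) := by
    intro v
    set a : Fin d → ℝ := fun i => ((v i).1 - (v i).2) * ∑ j, S i j * ((v j).1 + (v j).2) with ha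
    have h4 := ENNReal.ofReal_le_ofReal (sum_pow_boolSign_le a q)
    rw [ENNReal.ofReal_sum_of_nonneg fun _ _ => by positivity] at h4
    have h5 : ∀ b : Fin d → Bool, ENNReal.ofReal (|∑ i, boolSign (b i) * a i| ^ (2 * q))
        = F b v := fun b => by
      rw [ENNReal.ofReal_pow (abs_nonneg _), ← Real.enorm_eq_ofReal_abs]
    simp only [h5] at h4
    refine h4.trans_eq ?_
    have h0 : 0 ≤ ∑ i, a i ^ 2 := Finset.sum_nonneg fun _ _ => sq_nonneg _
    rw [ENNReal.ofReal_mul (by positivity), ENNReal.ofReal_mul (by positivity),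
      ENNReal.ofReal_pow h0, ENNReal.ofReal_sum_of_nonneg fun _ _ => sq_nonneg _, momentConst]
    have h6 : ∀ i, ENNReal.ofReal (a i ^ 2) = ‖(v i).1 - (v i).2‖ₑ ^ 2 *
        ‖∑ j, S i j * ((v j).1 + (v j).2)‖ₑ ^ 2 := fun i => by
      rw [← mul_pow, ← enorm_mul, Real.enorm_eq_ofReal_abs, ← ENNReal.ofReal_pow (abs_nonneg _),
        sq_abs]
    simp only [h6]
    simp
  have h4 := h2.trans_le (lintegral_mono h3)
  rw [lintegral_const_mul _ (by fun_prop), lintegral_const_mul _ (by fun_prop)] at h4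
  exact (ENNReal.mul_le_mul_iff_right (by simp) (by simp)).1 h4

theorem IsSubgaussianLaw.lintegral_fst_pow_le (hP : IsSubgaussianLaw c P) (a : Fin d → ℝ)
    (q : ℕ) : ∫⁻ v : Fin d → ℝ × ℝ, ‖∑ i, a i * (v i).1‖ₑ ^ (2 * q)
        ∂(Measure.pi fun _ => P.prod P)
      ≤ momentConst c q * ENNReal.ofReal (∑ i, a i ^ 2) ^ q := by
  have := hP.isProbabilityMeasure
  have h := measurePreserving_pi (fun _ : Fin d => P.prod P) (fun _ => P)
    (f := fun _ => Prod.fst) fun _ => measurePreserving_fst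
  exact (h.lintegral_comp (f := fun w => ‖∑ i, a i * w i‖ₑ ^ (2 * q)) (by fun_prop)).trans_le
    (hP.lintegral_linear_pow_le a q)

theorem IsSubgaussianLaw.lintegral_snd_pow_le (hP : IsSubgaussianLaw c P) (a : Fin d → ℝ)
    (q : ℕ) : ∫⁻ v : Fin d → ℝ × ℝ, ‖∑ i, a i * (v i).2‖ₑ ^ (2 * q)
        ∂(Measure.pi fun _ => P.prod P)
      ≤ momentConst c q * ENNReal.ofReal (∑ i, a i ^ 2) ^ q := by
  have := hP.isProbabilityMeasure
  have h := measurePreserving_pi (fun _ : Fin d => P.prod P) (fun _ => P)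
    (f := fun _ => Prod.snd) fun _ => measurePreserving_snd
  exact (h.lintegral_comp (f := fun w => ‖∑ i, a i * w i‖ₑ ^ (2 * q)) (by fun_prop)).trans_le
    (hP.lintegral_linear_pow_le a q)

/-- Minkowski's inequality for the two copies. It is needed for s = 1 (the row sums) and s = -1 (the
differences). -/
theorem IsSubgaussianLaw.lintegral_add_sub_pow_le (hP : IsSubgaussianLaw c P) (a : Fin d → ℝ)
    {q : ℕ} (hq : q ≠ 0) (s : ℝ) :
    ∫⁻ v : Fin d → ℝ × ℝ, ‖∑ i, a i * ((v i).1 + s * (v i).2)‖ₑ ^ (2 * q)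
        ∂(Measure.pi fun _ => P.prod P)
      ≤ momentConst c q * ENNReal.ofReal (∑ i, a i ^ 2) ^ q * ((1 + ‖s‖ₑ) ^ (2 * q)) := by
  have hroot : ∀ x : ℝ≥0∞, (x ^ (1 / 2 : ℝ)) ^ (2 * q) = x ^ q := fun x => by
    rw [pow_mul]
    congr 1
    rw [← ENNReal.rpow_natCast, ← ENNReal.rpow_mul]
    norm_num
  set σ : ℝ≥0∞ := ENNReal.ofReal (∑ i, a i ^ 2) ^ (1 / 2 : ℝ) with hσ
  have h := lintegral_finsetSum_pow_le (μ := Measure.pi fun _ : Fin d => P.prod P)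
    (p := 2 * q) (by lia) Finset.univ
    (f := ![fun v => ‖∑ i, a i * (v i).1‖ₑ, fun v => ‖s‖ₑ * ‖∑ i, a i * (v i).2‖ₑ])
    (by
      intro i
      fin_cases i
      · exact (Measurable.enorm (by fun_prop)).aemeasurable
      · exact ((Measurable.enorm (by fun_prop)).const_mul _).aemeasurable) (A := momentConst c q) (s := ![σ, ‖s‖ₑ * σ])
    (by
      intro i _
      fin_cases i
      · simp only [Fin.zero_eta, Matrix.cons_val_zero]
        rw [hσ, hroot]
        exact hP.lintegral_fst_pow_le a q
      · simp only [Fin.mk_one, Matrix.cons_val_one, Matrix.cons_val_fin_one, mul_pow]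
        rw [lintegral_const_mul _ (by fun_prop), hσ, hroot, mul_left_comm]
        gcongr
        exact hP.lintegral_snd_pow_le a q)
  rw [Fin.sum_univ_two] at h
  simp only [Matrix.cons_val_zero, Matrix.cons_val_one] at h
  rw [show σ + ‖s‖ₑ * σ = σ * (1 + ‖s‖ₑ) by ring, mul_pow, hσ, hroot, ← mul_assoc] at h
  refine le_trans (lintegral_mono fun v => ?_) h
  refine pow_le_pow_left' ?_ _
  rw [Fin.sum_univ_two]
  simp only [Matrix.cons_val_zero, Matrix.cons_val_one]
  rw [← enorm_mul]
  refine le_trans (le_of_eq ?_) (enorm_add_le _ _)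
  congr 1
  rw [Finset.mul_sum, ← Finset.sum_add_distrib]
  exact Finset.sum_congr rfl fun i _ => by ring

/-- The constants in the moment bounds for quadratic forms. -/
noncomputable def quadConst (c : ℝ≥0) (q : ℕ) : ℝ≥0∞ :=
  momentConst 1 q * (momentConst c (2 * q) * 16 ^ q)

theorem quadConst_ne_top (c : ℝ≥0) (q : ℕ) : quadConst c q ≠ ∞ :=
  ENNReal.mul_ne_top (momentConst_ne_top _ _)
    (ENNReal.mul_ne_top (momentConst_ne_top _ _) (ENNReal.pow_ne_top (by simp)))

/-- A moment version of the Hanson-Wright inequality. -/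
theorem IsSubgaussianLaw.lintegral_quadForm_pow_le (hP : IsSubgaussianLaw c P)
    {S : Fin d → Fin d → ℝ} (hS : ∀ i j, S i j = S j i) {q : ℕ} (hq : q ≠ 0) :
    ∫⁻ w, ‖quadForm S w - (∑ i, S i i)‖ₑ ^ (2 * q) ∂(Measure.pi fun _ => P) ≤
      quadConst c q * ENNReal.ofReal (∑ i, ∑ j, S i j ^ 2) ^ q := by
  have := hP.isProbabilityMeasure
  refine ((hP.lintegral_quadForm_le hS _).trans (hP.lintegral_symmetrized_le S q)).trans ?_
  rw [quadConst, mul_assoc]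
  gcongr
  rw [ENNReal.ofReal_sum_of_nonneg fun i _ => Finset.sum_nonneg fun j _ => sq_nonneg _]
  -- Minkowski's inequality in L^q reduces to a single `i`, and Cauchy-Schwarz then separates the
  -- difference from the row sum. The difference is the linear form with coefficient vector eᵢ. Each
  -- of the two factors contributes 2^(4q) = 16^q.
  refine lintegral_finsetSum_pow_le hq _ (fun i => by fun_prop) fun i _ => ?_
  simp only [mul_pow, ← pow_mul]
  rw [← ENNReal.pow_le_pow_left_iff two_ne_zero]
  refine (sq_lintegral_mul_le (by fun_prop) (by fun_prop)).trans ?_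
  have h1 := hP.lintegral_add_sub_pow_le (S i) (q := 2 * q) (by lia) 1
  have h2 := hP.lintegral_add_sub_pow_le (Pi.single i 1) (q := 2 * q) (by lia) (-1)
  have e1 : ∀ v : Fin d → ℝ × ℝ, ∑ j, (Pi.single i 1 : Fin d → ℝ) j * ((v j).1 + -1 * (v j).2) =
      (v i).1 - (v i).2 := fun v => by simp [Pi.single_apply]; ring
  have e2 : ∑ j, (Pi.single i 1 : Fin d → ℝ) j ^ 2 = 1 := by simp [Pi.single_apply]
  simp only [e1, e2, one_mul] at h1 h2
  simp only [← pow_mul]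
  have e3 : 2 * q * 2 = 2 * (2 * q) := by ring
  rw [e3]
  refine (mul_le_mul' h2 h1).trans_eq ?_
  have e4 : (1 + ‖(-1 : ℝ)‖ₑ) = 2 := by simp; norm_num
  have e5 : (1 + ‖(1 : ℝ)‖ₑ) = 2 := by simp; norm_num
  rw [e4, e5]
  simp only [ENNReal.ofReal_one, one_pow, mul_one, mul_pow]
  rw [show (16 : ℝ≥0∞) = 2 ^ 4 by norm_num]
  simp only [← pow_mul]
  ring

end Pi

/-! ### The square root of a covariance matrix -/

section Sqrt

variable {d : ℕ} {S : Matrix (Fin d) (Fin d) ℝ}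

/-- The operator `S^{1/2}`. -/
noncomputable def sqrtCLM (S : Matrix (Fin d) (Fin d) ℝ) : E d →L[ℝ] E d :=
  Matrix.toEuclideanCLM (n := Fin d) (𝕜 := ℝ) (CFC.sqrt S)

theorem inner_sqrtCLM_left (S : Matrix (Fin d) (Fin d) ℝ) (x y : E d) :
    ⟪sqrtCLM S x, y⟫ = ⟪x, sqrtCLM S y⟫ := by
  have h : IsSelfAdjoint (sqrtCLM S) := (CFC.sqrt_nonneg S).isSelfAdjoint.map _
  rw [← ContinuousLinearMap.adjoint_inner_right, h.adjoint_eq]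

theorem sqrtCLM_sqrtCLM (hS : S.PosSemidef) (x : E d) :
    sqrtCLM S (sqrtCLM S x) = Matrix.toEuclideanCLM (n := Fin d) (𝕜 := ℝ) S x := by
  rw [sqrtCLM, ← ContinuousLinearMap.comp_apply, ← ContinuousLinearMap.mul_def, ← map_mul,
    CFC.sqrt_mul_sqrt_self _ hS.nonneg]

theorem norm_sqrtCLM_sq (hS : S.PosSemidef) (x : E d) :
    ‖sqrtCLM S x‖ ^ 2 = quadForm (fun i j => S i j) x := by
  rw [← real_inner_self_eq_norm_sq, inner_sqrtCLM_left, sqrtCLM_sqrtCLM hS,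
    Matrix.inner_toEuclideanCLM]
  simp only [dotProduct, Matrix.mulVec, quadForm, Finset.mul_sum]
  exact Finset.sum_congr rfl fun i _ => Finset.sum_congr rfl fun j _ => by ring

theorem norm_sqrtCLM_le (hS : S.PosSemidef) (h1 : opNorm S = 1) (x : E d) :
    ‖sqrtCLM S x‖ ≤ ‖x‖ := by
  have h : ‖sqrtCLM S x‖ ^ 2 ≤ ‖x‖ ^ 2 := by
    rw [← real_inner_self_eq_norm_sq, inner_sqrtCLM_left, sqrtCLM_sqrtCLM hS]
    refine (real_inner_le_norm _ _).trans ?_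
    have := (Matrix.toEuclideanCLM (n := Fin d) (𝕜 := ℝ) S).le_opNorm x
    change _ ≤ opNorm S * _ at this
    rw [h1, one_mul] at this
    rw [sq]
    gcongr
  exact (sq_le_sq₀ (norm_nonneg _) (norm_nonneg _)).1 h

theorem norm_sqrtCLM_single (hS : S.PosSemidef) (i : Fin d) :
    ‖sqrtCLM S (EuclideanSpace.single i 1)‖ ^ 2 = S i i := by
  rw [norm_sqrtCLM_sq hS]
  simp [quadForm]

/-- The i-th row has the squared norm ‖S eᵢ‖² ≤ ‖S^{1/2} eᵢ‖² = Sᵢᵢ, since S^{1/2} is a contraction.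
This puts the effective dimension in place of the Frobenius norm in the moments of the quadratic
form. -/
theorem sum_sq_le_trace (hS : S.PosSemidef) (h1 : opNorm S = 1) :
    ∑ i, ∑ j, S i j ^ 2 ≤ S.trace := by
  have hsymm : ∀ i j, S i j = S j i := fun i j => by simpa using hS.isHermitian.apply j i
  refine Finset.sum_le_sum fun i _ => ?_
  have h2 : ∑ j, S i j ^ 2 = ‖sqrtCLM S (sqrtCLM S (EuclideanSpace.single i 1))‖ ^ 2 := by
    rw [sqrtCLM_sqrtCLM hS, EuclideanSpace.real_norm_sq_eq]
    refine Finset.sum_congr rfl fun j _ => ?_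
    have : (Matrix.toEuclideanCLM (n := Fin d) (𝕜 := ℝ) S (EuclideanSpace.single i 1)) j
        = S j i := by
      simp
    rw [this, hsymm]
  rw [h2]
  refine (pow_le_pow_left₀ (norm_nonneg _) (norm_sqrtCLM_le hS h1 _) 2).trans_eq ?_
  rw [norm_sqrtCLM_single hS]
  rfl

theorem effDim_eq (h1 : opNorm S = 1) : effDim S = S.trace := by rw [effDim, h1, div_one]

end Sqrt

/-! ### Concentration of the input laws -/

/-- Concentration of the inner products and of the norm, and moment bounds, for a law on `ℝ^d`
with effective dimension `τ`. -/
structure IsConcentrated (A : ℕ → ℝ) (B : ℝ) {d : ℕ} (Q : Measure (E d)) (τ : ℝ) : Prop where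
  isProbabilityMeasure : IsProbabilityMeasure Q
  inner_tail : ∀ q, q ≠ 0 → ∀ z : E d, ‖z‖ ^ 2 ≤ 2 → ∀ δ : ℝ, 0 < δ → δ ≤ 1 →
    Q {t | δ * Real.sqrt τ < |⟪t, z⟫|} ≤ ENNReal.ofReal (A q / (δ ^ 2 * τ) ^ q)
  norm_tail : ∀ q, q ≠ 0 → ∀ δ : ℝ, 0 < δ → δ ≤ 1 →
    Q {t | δ * τ < |‖t‖ ^ 2 - τ|} ≤ ENNReal.ofReal (A q / (δ ^ 2 * τ) ^ q)
  moment : ∀ q, q ≠ 0 → ∫⁻ t, ‖t‖ₑ ^ (2 * q) ∂Q ≤ ENNReal.ofReal (A q * τ ^ q)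
  exp_moment : ∀ z : E d, ‖z‖ ^ 2 ≤ 2 →
    ∫⁻ t, ENNReal.ofReal (Real.exp (4 * (⟪t, z⟫ / Real.sqrt τ))) ∂Q ≤ ENNReal.ofReal B

theorem IsConcentrated.mono {A A' : ℕ → ℝ} {B B' : ℝ} {d : ℕ} {Q : Measure (E d)} {τ : ℝ}
    (h : IsConcentrated A B Q τ) (hτ : 0 < τ) (hA : ∀ q, A q ≤ A' q) (hB : B ≤ B') :
    IsConcentrated A' B' Q τ := by
  have h1 : ∀ q (δ : ℝ), 0 < δ → ENNReal.ofReal (A q / (δ ^ 2 * τ) ^ q) ≤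
      ENNReal.ofReal (A' q / (δ ^ 2 * τ) ^ q) := fun q δ hδ =>
    ENNReal.ofReal_le_ofReal (by have := hA q; gcongr)
  exact ⟨h.1, fun q hq z hz δ hδ hδ1 => (h.inner_tail q hq z hz δ hδ hδ1).trans (h1 q δ hδ),
    fun q hq δ hδ hδ1 => (h.norm_tail q hq δ hδ hδ1).trans (h1 q δ hδ),
    fun q hq => (h.moment q hq).trans (ENNReal.ofReal_le_ofReal (by have := hA q; gcongr)),
    fun z hz => (h.exp_moment z hz).trans (ENNReal.ofReal_le_ofReal hB)⟩

section CovLaw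

variable {d : ℕ} {S : Matrix (Fin d) (Fin d) ℝ} {c : ℝ≥0} {P : Measure ℝ}

theorem measurable_sqrtCLM_toLp (S : Matrix (Fin d) (Fin d) ℝ) :
    Measurable fun w : Fin d → ℝ => sqrtCLM S (WithLp.toLp 2 w) := by
  fun_prop

theorem lintegral_covLaw (S : Matrix (Fin d) (Fin d) ℝ) (P : Measure ℝ) {f : E d → ℝ≥0∞}
    (hf : Measurable f) : ∫⁻ t, f t ∂(covLaw S P) =
      ∫⁻ w, f (sqrtCLM S (WithLp.toLp 2 w)) ∂(Measure.pi fun _ => P) :=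
  lintegral_map hf (measurable_sqrtCLM_toLp S)

theorem inner_sqrtCLM_toLp (S : Matrix (Fin d) (Fin d) ℝ) (w : Fin d → ℝ) (z : E d) :
    ⟪sqrtCLM S (WithLp.toLp 2 w), z⟫ = ∑ i, sqrtCLM S z i * w i := by
  rw [inner_sqrtCLM_left, PiLp.inner_apply]
  exact Finset.sum_congr rfl fun i _ => by simp

theorem IsSubgaussianLaw.lintegral_inner_covLaw_le (hP : IsSubgaussianLaw c P)
    (z : E d) (q : ℕ) : ∫⁻ t, ‖⟪t, z⟫‖ₑ ^ (2 * q) ∂(covLaw S P) ≤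
      momentConst c q * ENNReal.ofReal (‖sqrtCLM S z‖ ^ 2) ^ q := by
  rw [lintegral_covLaw _ _ (by fun_prop), EuclideanSpace.real_norm_sq_eq]
  simp only [inner_sqrtCLM_toLp]
  exact hP.lintegral_linear_pow_le _ q

theorem IsSubgaussianLaw.lintegral_norm_sq_sub_covLaw_le (hP : IsSubgaussianLaw c P)
    (hS : S.PosSemidef) (h1 : opNorm S = 1) {q : ℕ} (hq : q ≠ 0) :
    ∫⁻ t, ‖‖t‖ ^ 2 - S.trace‖ₑ ^ (2 * q) ∂(covLaw S P) ≤
      quadConst c q * ENNReal.ofReal S.trace ^ q := by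
  rw [lintegral_covLaw _ _ (by fun_prop)]
  simp only [norm_sqrtCLM_sq hS]
  refine (hP.lintegral_quadForm_pow_le (S := fun i j => S i j)
    (fun i j => by simpa using hS.isHermitian.apply j i) hq).trans ?_
  gcongr
  exact sum_sq_le_trace hS h1

/-- The squared norm is the sum of the squared coordinates; by Minkowski's inequality in L^q each
contributes its variance Sᵢᵢ. -/
theorem IsSubgaussianLaw.lintegral_norm_covLaw_le (hP : IsSubgaussianLaw c P)
    (hS : S.PosSemidef) {q : ℕ} (hq : q ≠ 0) :
    ∫⁻ t, ‖t‖ₑ ^ (2 * q) ∂(covLaw S P) ≤ momentConst c q * ENNReal.ofReal S.trace ^ q := by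
  have hdiag : ∀ i, 0 ≤ S i i := fun i => by
    rw [← norm_sqrtCLM_single hS]; positivity
  have h1 : ∀ t : E d, ‖t‖ₑ ^ (2 * q) =
      (∑ i, ‖⟪t, EuclideanSpace.single i (1 : ℝ)⟫‖ₑ ^ 2) ^ q := by
    intro t
    rw [pow_mul]
    congr 1
    have h2 : ‖t‖ₑ ^ 2 = ENNReal.ofReal (‖t‖ ^ 2) := by
      rw [ENNReal.ofReal_pow (norm_nonneg _), ofReal_norm]
    rw [h2, EuclideanSpace.real_norm_sq_eq, ENNReal.ofReal_sum_of_nonneg fun _ _ => sq_nonneg _]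
    refine Finset.sum_congr rfl fun i _ => ?_
    rw [Real.enorm_eq_ofReal_abs, ← ENNReal.ofReal_pow (abs_nonneg _), sq_abs,
      EuclideanSpace.inner_single_right]
    simp
  simp only [h1]
  rw [Matrix.trace, ENNReal.ofReal_sum_of_nonneg (f := S.diag) fun i _ => hdiag i]
  refine lintegral_finsetSum_pow_le hq _ (fun i => by fun_prop) fun i _ => ?_
  simp only [← pow_mul]
  refine (hP.lintegral_inner_covLaw_le _ q).trans_eq ?_
  rw [norm_sqrtCLM_single hS]
  rfl

/-- The constants in the concentration inequalities for `covLaw`. -/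
noncomputable def covConst (c : ℝ≥0) (q : ℕ) : ℝ :=
  (momentConst c q).toReal * 2 ^ q + (quadConst c q).toReal

theorem covConst_nonneg (c : ℝ≥0) (q : ℕ) : 0 ≤ covConst c q := by
  unfold covConst
  positivity

/-- Markov's inequality for moments of order 2q. For the inner product they are bounded
independently of τ and the threshold is δ√τ; for ‖t‖² - τ they are of order τ^q and the threshold is
δτ. Both quotients are of order (δ²τ)^(-q). -/
theorem IsSubgaussianLaw.isConcentrated_covLaw (hP : IsSubgaussianLaw c P) (hS : S.PosSemidef)
    (h1 : opNorm S = 1) (hτ : 1 ≤ S.trace) :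
    IsConcentrated (covConst c) (Real.exp (16 * c)) (covLaw S P) S.trace := by
  have hτ0 : 0 < S.trace := by linarith
  have hPp := hP.isProbabilityMeasure
  have hm : ∀ q, momentConst c q = ENNReal.ofReal (momentConst c q).toReal := fun q =>
    (ENNReal.ofReal_toReal (momentConst_ne_top c q)).symm
  have hh : ∀ q, quadConst c q = ENNReal.ofReal (quadConst c q).toReal := fun q =>
    (ENNReal.ofReal_toReal (quadConst_ne_top c q)).symm
  have hR : ∀ z : E d, ‖z‖ ^ 2 ≤ 2 → ‖sqrtCLM S z‖ ^ 2 ≤ 2 := fun z hz =>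
    (pow_le_pow_left₀ (norm_nonneg _) (norm_sqrtCLM_le hS h1 z) 2).trans hz
  refine ⟨Measure.isProbabilityMeasure_map (measurable_sqrtCLM_toLp S).aemeasurable,
    fun q hq z hz δ hδ _ => ?_, fun q hq δ hδ _ => ?_, fun q hq => ?_, fun z hz => ?_⟩
  · have h2 : ∫⁻ t, ‖⟪t, z⟫‖ₑ ^ (2 * q) ∂(covLaw S P) ≤ ENNReal.ofReal (covConst c q) := by
      refine (hP.lintegral_inner_covLaw_le z q).trans ?_
      rw [hm, ← ENNReal.ofReal_pow (by positivity), ← ENNReal.ofReal_mul (by positivity)]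
      refine ENNReal.ofReal_le_ofReal ?_
      rw [covConst]
      have := hR z hz
      refine le_add_of_le_of_nonneg ?_ (by positivity)
      gcongr
    refine (measure_lt_abs_le (by fun_prop) (by positivity) h2).trans_eq ?_
    rw [pow_mul, mul_pow, Real.sq_sqrt hτ0.le]
  · have h2 : ∫⁻ t, ‖‖t‖ ^ 2 - S.trace‖ₑ ^ (2 * q) ∂(covLaw S P) ≤
        ENNReal.ofReal (covConst c q * S.trace ^ q) := by
      refine (hP.lintegral_norm_sq_sub_covLaw_le hS h1 hq).trans ?_
      rw [hh, ← ENNReal.ofReal_pow (by positivity), ← ENNReal.ofReal_mul (by positivity)]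
      refine ENNReal.ofReal_le_ofReal ?_
      rw [covConst]
      gcongr
      exact le_add_of_nonneg_left (by positivity)
    refine (measure_lt_abs_le (by fun_prop) (by positivity) h2).trans_eq ?_
    congr 1
    rw [pow_mul, show (δ * S.trace) ^ 2 = (δ ^ 2 * S.trace) * S.trace by ring, mul_pow,
      mul_div_mul_right _ _ (by positivity)]
  · refine (hP.lintegral_norm_covLaw_le hS hq).trans ?_
    rw [hm, ← ENNReal.ofReal_pow (by positivity), ← ENNReal.ofReal_mul (by positivity)]
    refine ENNReal.ofReal_le_ofReal ?_
    rw [covConst]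
    gcongr
    refine le_add_of_le_of_nonneg ?_ (by positivity)
    exact le_mul_of_one_le_right (by positivity) (one_le_pow₀ one_le_two)
  · rw [lintegral_covLaw _ _ (by fun_prop)]
    have hsub := hP.linear (sqrtCLM S z)
    have h2 : ∀ w : Fin d → ℝ, Real.exp (4 * (⟪sqrtCLM S (WithLp.toLp 2 w), z⟫ /
        Real.sqrt S.trace)) = Real.exp (4 / Real.sqrt S.trace * ∑ i, sqrtCLM S z i * w i) := by
      intro w
      rw [inner_sqrtCLM_toLp]
      congr 1
      ring
    simp only [h2]
    rw [← ofReal_integral_eq_lintegral_ofReal (hsub.integrable_exp_mul _)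
      (ae_of_all _ fun w => (Real.exp_pos _).le)]
    refine ENNReal.ofReal_le_ofReal ((hsub.mgf_le _).trans (Real.exp_le_exp.2 ?_))
    have h3 := hR z hz
    rw [EuclideanSpace.real_norm_sq_eq] at h3
    have h0 : 0 ≤ ∑ i, sqrtCLM S z i ^ 2 := Finset.sum_nonneg fun _ _ => sq_nonneg _
    rw [NNReal.coe_mul, Real.coe_toNNReal _ h0, div_pow, Real.sq_sqrt hτ0.le]
    have h4 : (4 : ℝ) ^ 2 / S.trace ≤ 16 := by
      rw [div_le_iff₀ hτ0]; linarith
    calc (∑ i, sqrtCLM S z i ^ 2) * c * (4 ^ 2 / S.trace) / 2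
        ≤ 2 * c * 16 / 2 := by gcongr
      _ = 16 * c := by ring

theorem IsConcentrated.measure_norm_sq_lt {A : ℕ → ℝ} {B : ℝ} {Q : Measure (E d)} {τ : ℝ}
    (h : IsConcentrated A B Q τ) (hτ : 0 < τ) {q : ℕ} (hq : q ≠ 0) :
    Q {t | ‖t‖ ^ 2 < τ / 2} ≤ ENNReal.ofReal (4 ^ q * A q / τ ^ q) := by
  refine (measure_mono fun t (ht : ‖t‖ ^ 2 < τ / 2) => ?_).trans
    ((h.norm_tail q hq (1 / 2) (by norm_num) (by norm_num)).trans_eq ?_)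
  · change 1 / 2 * τ < |‖t‖ ^ 2 - τ|
    rw [abs_of_neg (by linarith)]
    linarith
  · congr 1
    rw [show (1 / 2 : ℝ) ^ 2 * τ = τ / 4 by ring, div_pow]
    field_simp

theorem measurable_sphere_map (r : ℝ) : Measurable fun z : E d => (r / ‖z‖) • z := by
  fun_prop

/-- The normalisation can only fail at z = 0, and z = 0 belongs to the rare event ‖z‖² < τ/2. -/
theorem IsSubgaussianLaw.sphereLaw_norm (hP : IsSubgaussianLaw c P) (hS : S.PosSemidef)
    (h1 : opNorm S = 1) (hτ : 1 ≤ S.trace) {q : ℕ} (hq : q ≠ 0) :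
    sphereLaw S P {t | ‖t‖ ^ 2 ≠ S.trace} ≤
      ENNReal.ofReal (4 ^ q * covConst c q / S.trace ^ q) := by
  have hτ0 : 0 < S.trace := by linarith
  have hc := hP.isConcentrated_covLaw hS h1 hτ
  have hmeas : MeasurableSet {t : E d | ‖t‖ ^ 2 ≠ S.trace} :=
    (measurableSet_eq_fun (f := fun t : E d => ‖t‖ ^ 2) (by fun_prop) (by fun_prop)).compl
  rw [sphereLaw, Measure.map_apply (measurable_sphere_map _) hmeas, effDim_eq h1]
  refine (measure_mono fun z hz => ?_).trans (hc.measure_norm_sq_lt hτ0 hq)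
  change ‖z‖ ^ 2 < S.trace / 2
  by_contra hcon
  refine hz ?_
  have hz0 : 0 < ‖z‖ := by
    rcases (norm_nonneg z).eq_or_lt with h | h
    · rw [← h] at hcon
      exact absurd (by simpa using hτ0) hcon
    · exact h
  change ‖(Real.sqrt S.trace / ‖z‖) • z‖ ^ 2 = S.trace
  rw [norm_smul, norm_div, norm_norm, div_mul_cancel₀ _ hz0.ne', Real.norm_eq_abs, sq_abs,
    Real.sq_sqrt hτ0.le]

/-- Unless ‖z‖² < τ/2, the normalising factor √τ/‖z‖ is at most 2, so the tail at `δ` follows from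
that of the unnormalised vector at δ/2. Both events cost a factor 4^q, and 2 · 4^q ≤ 8^q. The
moments are immediate because the norm never exceeds √τ. -/
theorem IsSubgaussianLaw.isConcentrated_sphereLaw (hP : IsSubgaussianLaw c P)
    (hS : S.PosSemidef) (h1 : opNorm S = 1) (hτ : 1 ≤ S.trace) :
    IsConcentrated (fun q => 8 ^ q * covConst c q + 1) (Real.exp 8) (sphereLaw S P) S.trace := by
  have hτ0 : 0 < S.trace := by linarith
  have hc := hP.isConcentrated_covLaw hS h1 hτ
  have hprob := hc.isProbabilityMeasure
  have hmap := measurable_sphere_map (d := d) (Real.sqrt (effDim S))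
  have hnn := covConst_nonneg c
  have hsq : 0 < Real.sqrt S.trace := Real.sqrt_pos.2 hτ0
  have hle : ∀ z : E d, ‖(Real.sqrt (effDim S) / ‖z‖) • z‖ ≤ Real.sqrt S.trace := by
    intro z
    rw [effDim_eq h1, norm_smul, norm_div, norm_norm, Real.norm_of_nonneg (Real.sqrt_nonneg _)]
    rcases (norm_nonneg z).eq_or_lt with h | h
    · rw [← h]; simp
    · rw [div_mul_cancel₀ _ h.ne']
  refine ⟨Measure.isProbabilityMeasure_map hmap.aemeasurable,
    fun q hq z hz δ hδ hδ1 => ?_, fun q hq δ hδ hδ1 => ?_, fun q hq => ?_, fun z hz => ?_⟩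
  · rw [sphereLaw, Measure.map_apply hmap (measurableSet_lt (by fun_prop) (by fun_prop))]
    have hsub : (fun z : E d => (Real.sqrt (effDim S) / ‖z‖) • z) ⁻¹'
        {t | δ * Real.sqrt S.trace < |⟪t, z⟫|} ⊆
        {t | ‖t‖ ^ 2 < S.trace / 2} ∪ {t | δ / 2 * Real.sqrt S.trace < |⟪t, z⟫|} := by
      intro t ht
      by_contra hcon
      rw [Set.mem_union, not_or] at hcon
      obtain ⟨h2, h3⟩ := hcon
      replace h2 : S.trace / 2 ≤ ‖t‖ ^ 2 := not_lt.1 h2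
      replace h3 : |⟪t, z⟫| ≤ δ / 2 * Real.sqrt S.trace := not_lt.1 h3
      replace ht : δ * Real.sqrt S.trace < |⟪(Real.sqrt (effDim S) / ‖t‖) • t, z⟫| := ht
      rw [effDim_eq h1, real_inner_smul_left, abs_mul, abs_div, abs_norm,
        abs_of_pos hsq] at ht
      have h4 : Real.sqrt S.trace ≤ 2 * ‖t‖ := by
        refine Real.sqrt_le_iff.2 ⟨by positivity, ?_⟩
        nlinarith
      have ht0 : 0 < ‖t‖ := by linarith
      have h5 : Real.sqrt S.trace / ‖t‖ ≤ 2 := by rwa [div_le_iff₀ ht0]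
      have h6 : Real.sqrt S.trace / ‖t‖ * |⟪t, z⟫| ≤ 2 * (δ / 2 * Real.sqrt S.trace) :=
        mul_le_mul h5 h3 (abs_nonneg _) (by norm_num)
      linarith
    refine (measure_mono hsub).trans ((measure_union_le _ _).trans ?_)
    refine (add_le_add (hc.measure_norm_sq_lt hτ0 hq)
      (hc.inner_tail q hq z hz (δ / 2) (by positivity) (by linarith))).trans ?_
    rw [← ENNReal.ofReal_add (by have := hnn q; positivity) (by have := hnn q; positivity)]
    refine ENNReal.ofReal_le_ofReal ?_
    have h5 : (δ / 2) ^ 2 * S.trace = δ ^ 2 * S.trace / 4 := by ring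
    have h6 : 4 ^ q * covConst c q / S.trace ^ q ≤ 4 ^ q * covConst c q / (δ ^ 2 * S.trace) ^ q := by
      have := hnn q
      gcongr
      exact mul_le_of_le_one_left hτ0.le (pow_le_one₀ hδ.le hδ1)
    rw [h5, div_pow, div_div_eq_mul_div]
    refine (add_le_add h6 le_rfl).trans ?_
    rw [← add_div]
    refine div_le_div_of_nonneg_right ?_ (by positivity)
    have h7 : (2 : ℝ) * 4 ^ q ≤ 8 ^ q := by
      rw [show (8 : ℝ) = 2 * 4 by norm_num, mul_pow]
      gcongr
      exact le_self_pow₀ one_le_two hq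
    nlinarith [hnn q]
  · refine (measure_mono ?_).trans ((hP.sphereLaw_norm hS h1 hτ hq).trans
      (ENNReal.ofReal_le_ofReal ?_))
    · intro t ht hcon
      replace ht : δ * S.trace < |‖t‖ ^ 2 - S.trace| := ht
      rw [hcon, sub_self, abs_zero] at ht
      have : 0 < δ * S.trace := by positivity
      linarith
    · have := hnn q
      have h7 : (4 : ℝ) ^ q ≤ 8 ^ q := by gcongr; norm_num
      have h8 : 4 ^ q * covConst c q ≤ 8 ^ q * covConst c q + 1 := by nlinarith
      have h9 : (δ ^ 2 * S.trace) ^ q ≤ S.trace ^ q := by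
        gcongr
        exact mul_le_of_le_one_left hτ0.le (pow_le_one₀ hδ.le hδ1)
      exact div_le_div₀ (by positivity) h8 (by positivity) h9
  · rw [sphereLaw, lintegral_map (by fun_prop) hmap]
    have h2 : ∀ z : E d, ‖(Real.sqrt (effDim S) / ‖z‖) • z‖ₑ ^ (2 * q) ≤
        ENNReal.ofReal (S.trace ^ q) := by
      intro z
      rw [← ofReal_norm, ← ENNReal.ofReal_pow (norm_nonneg _)]
      refine ENNReal.ofReal_le_ofReal ?_
      refine (pow_le_pow_left₀ (norm_nonneg _) (hle z) _).trans_eq ?_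
      rw [pow_mul, Real.sq_sqrt hτ0.le]
    refine (lintegral_mono h2).trans ?_
    rw [lintegral_const, measure_univ, mul_one]
    refine ENNReal.ofReal_le_ofReal ?_
    refine le_mul_of_one_le_left (by positivity) ?_
    have := hnn q
    nlinarith [pow_pos (show (0:ℝ) < 8 by norm_num) q]
  · rw [sphereLaw, lintegral_map (by fun_prop) hmap]
    have h2 : ∀ t : E d, ENNReal.ofReal (Real.exp (4 * (⟪(Real.sqrt (effDim S) / ‖t‖) • t, z⟫ /
        Real.sqrt S.trace))) ≤ ENNReal.ofReal (Real.exp 8) := by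
      intro t
      refine ENNReal.ofReal_le_ofReal (Real.exp_le_exp.2 ?_)
      have h3 : ⟪(Real.sqrt (effDim S) / ‖t‖) • t, z⟫ / Real.sqrt S.trace ≤ 2 := by
        rw [div_le_iff₀ hsq]
        refine (real_inner_le_norm _ _).trans ?_
        have hz2 : ‖z‖ ≤ 2 := by nlinarith [norm_nonneg z]
        rw [mul_comm]
        exact mul_le_mul hz2 (hle t) (norm_nonneg _) (by norm_num)
      linarith
    refine (lintegral_mono h2).trans ?_
    rw [lintegral_const, measure_univ, mul_one]

end CovLaw

/-! ### Polynomial approximation of combinations of kernel functions -/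

section Approximation

variable {d : ℕ}

/-- The functions `κ (t / √τ) z` with almost normalised `z` are approximated by polynomials of
degree at most `M` for the almost normalised `t ∈ U` which are almost orthogonal to `z`. -/
def ApproximableOn (C ε : ℝ) (m M : ℕ) (κ : E d → E d → ℝ) (U : Set (E d)) (τ : ℝ) : Prop :=
  ∀ z : E d, |‖z‖ ^ 2 - 1| ≤ ε → ∃ p ∈ polySpace d M,
    (∀ t : E d, |p.eval t| ≤ C * (1 + ‖t‖ ^ 2 / τ) ^ (M + 1)) ∧
    ∀ δ ≤ ε, ∀ t ∈ U, |‖(Real.sqrt τ)⁻¹ • t‖ ^ 2 - 1| ≤ δ → |⟪(Real.sqrt τ)⁻¹ • t, z⟫| ≤ δ →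
      |κ ((Real.sqrt τ)⁻¹ • t) z - p.eval t| ≤ C * δ ^ (m + 1)

/-- Fourth moment bounds for the functions `κ (t / √τ) z`. -/
def HasMomentBound (C : ℝ) (κ : E d → E d → ℝ) (Q : Measure (E d)) (τ : ℝ) : Prop :=
  ∀ z : E d, ‖z‖ ^ 2 ≤ 2 → ∫⁻ t, ‖κ ((Real.sqrt τ)⁻¹ • t) z‖ₑ ^ 4 ∂Q ≤ ENNReal.ofReal C

/-- The constant in the fourth moment bound for the approximation error. -/
noncomputable def errorConst (A : ℕ → ℝ) (C : ℝ) (M : ℕ) : ℝ≥0∞ :=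
  (ENNReal.ofReal C + ENNReal.ofReal C ^ 4 *
    (ENNReal.ofReal (A (4 * (M + 1)) + 1) * 2 ^ (4 * (M + 1)))) * 16

theorem errorConst_ne_top (A : ℕ → ℝ) (C : ℝ) (M : ℕ) : errorConst A C M ≠ ∞ := by
  unfold errorConst
  finiteness

theorem measurable_polynomial_eval (p : MvPolynomial (Fin d) ℝ) :
    Measurable fun t : E d => p.eval t :=
  ((MvPolynomial.continuous_eval p).comp (PiLp.continuous_ofLp 2 _)).measurable

theorem lintegral_one_add_norm_sq_pow_le {A : ℕ → ℝ} {B : ℝ} {Q : Measure (E d)} {τ : ℝ}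
    (hτ : 0 < τ) (hQ : IsConcentrated A B Q τ) {N : ℕ} (hN : N ≠ 0) (hA : 0 ≤ A N) :
    ∫⁻ t, ENNReal.ofReal (1 + ‖t‖ ^ 2 / τ) ^ N ∂Q ≤ ENNReal.ofReal (A N + 1) * 2 ^ N := by
  have := hQ.isProbabilityMeasure
  have h1 : ∀ t : E d, ENNReal.ofReal (1 + ‖t‖ ^ 2 / τ) = 1 + ENNReal.ofReal (‖t‖ ^ 2 / τ) :=
    fun t => by
      rw [ENNReal.ofReal_add zero_le_one (by positivity), ENNReal.ofReal_one]
  simp only [h1]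
  have h := lintegral_add_pow_le (μ := Q) hN (f := fun _ => 1)
    (g := fun t => ENNReal.ofReal (‖t‖ ^ 2 / τ)) (by fun_prop) (by fun_prop)
    (A := ENNReal.ofReal (A N + 1)) (s := 1) ?_ ?_
  · simpa using h
  · simpa using hA
  · have h2 : ∀ t : E d, ENNReal.ofReal (‖t‖ ^ 2 / τ) ^ N =
        ENNReal.ofReal (τ ^ N)⁻¹ * ‖t‖ₑ ^ (2 * N) := by
      intro t
      rw [← ofReal_norm, ← ENNReal.ofReal_pow (norm_nonneg _), ← ENNReal.ofReal_mul (by positivity),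
        ← ENNReal.ofReal_pow (by positivity)]
      congr 1
      rw [div_pow, pow_mul]
      ring
    simp only [h2, one_pow, mul_one]
    rw [lintegral_const_mul _ (by fun_prop)]
    refine (mul_le_mul' le_rfl (hQ.moment N hN)).trans ?_
    rw [← ENNReal.ofReal_mul (by positivity)]
    refine ENNReal.ofReal_le_ofReal ?_
    field_simp
    linarith

/-- The approximant is the combination of the approximants of the single terms. At good test points
the error is at most (∑ |αᵢ|) C δ^(m+1). The bad ones have probability at most (n + 2)b, for the `n`
inner products, the norm and the complement of `U`; there the squared error is controlled by
Cauchy-Schwarz and its fourth moment. -/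
theorem exists_polynomial_sqL2_le {A : ℕ → ℝ} (hA : ∀ q, 0 ≤ A q) {B : ℝ} {Q : Measure (E d)}
    {τ : ℝ} (hτ : 0 < τ) (hQ : IsConcentrated A B Q τ) {κ : E d → E d → ℝ}
    (hκ : ∀ z, Continuous fun t => κ t z) {U : Set (E d)} (hUm : MeasurableSet U) {b : ℝ}
    (hb : 0 ≤ b) (hU : Q Uᶜ ≤ ENNReal.ofReal b) {C ε : ℝ} (hC : 0 ≤ C) (hε : ε ≤ 1) {m M : ℕ}
    (happ : ApproximableOn C ε m M κ U τ) (htail : HasMomentBound C κ Q τ) {n : ℕ}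
    {δ : ℝ} (hδ : 0 < δ) (hδε : δ ≤ ε) {z : Fin n → E d} (hz : AlmostOrthonormal δ z)
    {q : ℕ} (hq : q ≠ 0) (hqb : A q / (δ ^ 2 * τ) ^ q ≤ b) {a : ℝ} (α : Fin n → ℝ)
    (hα : ∑ i, |α i| ≤ a) :
    ∃ p ∈ polySpace d M, sqL2 Q (fun t => ∑ i, α i * κ ((Real.sqrt τ)⁻¹ • t) (z i) - p.eval t) ≤
      ENNReal.ofReal ((a * (C * δ ^ (m + 1))) ^ 2) +
        (ENNReal.ofReal ((n + 2) * b * a ^ 4) * errorConst A C M) ^ (1 / 2 : ℝ) := by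
  have := hQ.isProbabilityMeasure
  have ha : 0 ≤ a := (Finset.sum_nonneg fun i _ => abs_nonneg _).trans hα
  have hsq : 0 < Real.sqrt τ := Real.sqrt_pos.2 hτ
  have hzε : ∀ i, |‖z i‖ ^ 2 - 1| ≤ ε := fun i => (hz.norm_sq i).trans hδε
  have hz2 : ∀ i, ‖z i‖ ^ 2 ≤ 2 := fun i => by
    have := abs_le.1 (hzε i)
    linarith
  choose p hp hpb hpa using fun i => happ (z i) (hzε i)
  set s := (Real.sqrt τ)⁻¹ with hs
  have hnorm : ∀ t : E d, ‖s • t‖ ^ 2 = ‖t‖ ^ 2 / τ := fun t => by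
    rw [norm_smul, mul_pow, hs, norm_inv, Real.norm_of_nonneg hsq.le, inv_pow, Real.sq_sqrt hτ.le]
    ring
  set D : Fin n → E d → ℝ := fun i t => α i * (κ (s • t) (z i) - (p i).eval t) with hD
  have hDm : ∀ i, Measurable (D i) := fun i => by
    have h1 : Measurable fun t : E d => κ (s • t) (z i) :=
      ((hκ (z i)).comp (continuous_const_smul s)).measurable
    exact (h1.sub (measurable_polynomial_eval _)).const_mul _
  refine ⟨∑ i, MvPolynomial.C (α i) * p i, ?_, ?_⟩
  · refine (MvPolynomial.totalDegree_finsetSum _ _).trans (Finset.sup_le fun i _ => ?_)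
    refine (MvPolynomial.totalDegree_mul _ _).trans ?_
    rw [MvPolynomial.totalDegree_C, zero_add]
    exact hp i
  have hsum : ∀ t : E d, ∑ i, α i * κ (s • t) (z i)
      - (∑ i, MvPolynomial.C (α i) * p i).eval t = ∑ i, D i t := by
    intro t
    simp only [map_sum, map_mul, MvPolynomial.eval_C, hD, mul_sub, Finset.sum_sub_distrib]
  simp only [sqL2, hsum]
  -- the good test points
  set G : Set (E d) := U ∩ ({t | δ * τ < |‖t‖ ^ 2 - τ|}ᶜ ∩
    ⋂ i, {t | δ * Real.sqrt τ < |⟪t, z i⟫|}ᶜ) with hG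
  have hGm : MeasurableSet G := by
    refine hUm.inter ((measurableSet_lt (by fun_prop) (by fun_prop)).compl.inter
      (MeasurableSet.iInter fun i => (measurableSet_lt (by fun_prop) (by fun_prop)).compl))
  have hGc : Q Gᶜ ≤ ENNReal.ofReal ((n + 2) * b) := by
    have h1 : Gᶜ = Uᶜ ∪ ({t | δ * τ < |‖t‖ ^ 2 - τ|} ∪
        ⋃ i, {t | δ * Real.sqrt τ < |⟪t, z i⟫|}) := by
      rw [hG, Set.compl_inter, Set.compl_inter, compl_compl, Set.compl_iInter]
      simp only [compl_compl]
    have h2 : ∀ i, Q {t | δ * Real.sqrt τ < |⟪t, z i⟫|} ≤ ENNReal.ofReal b := fun i =>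
      (hQ.inner_tail q hq (z i) (hz2 i) δ hδ (hδε.trans hε)).trans (ENNReal.ofReal_le_ofReal hqb)
    have h3 : Q {t | δ * τ < |‖t‖ ^ 2 - τ|} ≤ ENNReal.ofReal b :=
      (hQ.norm_tail q hq δ hδ (hδε.trans hε)).trans (ENNReal.ofReal_le_ofReal hqb)
    rw [h1]
    refine (measure_union_le _ _).trans ((add_le_add hU ((measure_union_le _ _).trans
      (add_le_add h3 ((measure_iUnion_fintype_le _ _).trans
        (Finset.sum_le_sum fun i _ => h2 i))))).trans_eq ?_)
    rw [Finset.sum_const, Finset.card_univ, Fintype.card_fin, nsmul_eq_mul,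
      ← ENNReal.ofReal_natCast, ← ENNReal.ofReal_mul (by positivity),
      ← ENNReal.ofReal_add hb (by positivity), ← ENNReal.ofReal_add hb (by positivity)]
    congr 1
    ring
  have hgood : ∀ t ∈ G, ENNReal.ofReal ((∑ i, D i t) ^ 2) ≤
      ENNReal.ofReal ((a * (C * δ ^ (m + 1))) ^ 2) := by
    rintro t ⟨htU, htn, hti⟩
    have h1 : |‖s • t‖ ^ 2 - 1| ≤ δ := by
      have h2 : |‖t‖ ^ 2 - τ| ≤ δ * τ := not_lt.1 htn
      rw [hnorm, div_sub_one hτ.ne', abs_div, abs_of_pos hτ]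
      exact (div_le_iff₀ hτ).2 h2
    have h2 : ∀ i, |⟪s • t, z i⟫| ≤ δ := by
      intro i
      have h3 : |⟪t, z i⟫| ≤ δ * Real.sqrt τ := not_lt.1 (Set.mem_iInter.1 hti i)
      rw [real_inner_smul_left, abs_mul, hs, abs_inv, abs_of_pos hsq, inv_mul_le_iff₀ hsq]
      linarith
    refine ENNReal.ofReal_le_ofReal ?_
    rw [← sq_abs (∑ i, D i t)]
    refine pow_le_pow_left₀ (abs_nonneg _) ?_ 2
    refine (Finset.abs_sum_le_sum_abs _ _).trans ?_
    refine (Finset.sum_le_sum fun i _ => ?_).trans (?_ : ∑ i, |α i| * (C * δ ^ (m + 1)) ≤ _)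
    · rw [hD, abs_mul]
      exact mul_le_mul_of_nonneg_left (hpa i δ hδε t htU h1 (h2 i)) (abs_nonneg _)
    · rw [← Finset.sum_mul]
      gcongr
  have hfour : ∫⁻ t, ‖∑ i, D i t‖ₑ ^ 4 ∂Q ≤ errorConst A C M * ENNReal.ofReal a ^ 4 := by
    have hpm := fun i => measurable_polynomial_eval (p i)
    have hkm : ∀ i, Measurable fun t : E d => κ (s • t) (z i) := fun i =>
      ((hκ (z i)).comp (continuous_const_smul s)).measurable
    have h1 : ∀ i, ∫⁻ t : E d, (‖κ (s • t) (z i)‖ₑ + ‖(p i).eval t‖ₑ) ^ 4 ∂Q ≤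
        errorConst A C M := by
      intro i
      have h2 : ∫⁻ t : E d, ‖(p i).eval t‖ₑ ^ 4 ∂Q ≤ ENNReal.ofReal C ^ 4 *
          (ENNReal.ofReal (A (4 * (M + 1)) + 1) * 2 ^ (4 * (M + 1))) := by
        have h3 : ∀ t : E d, ‖(p i).eval t‖ₑ ^ 4 ≤ ENNReal.ofReal C ^ 4 *
            ENNReal.ofReal (1 + ‖t‖ ^ 2 / τ) ^ (4 * (M + 1)) := by
          intro t
          rw [Real.enorm_eq_ofReal_abs, mul_comm 4 (M + 1), pow_mul, ← mul_pow]
          refine pow_le_pow_left' ?_ 4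
          rw [← ENNReal.ofReal_pow (by positivity), ← ENNReal.ofReal_mul hC]
          exact ENNReal.ofReal_le_ofReal (hpb i t)
        refine (lintegral_mono h3).trans ?_
        rw [lintegral_const_mul _ (by fun_prop)]
        gcongr
        exact lintegral_one_add_norm_sq_pow_le hτ hQ (by lia) (hA _)
      have h4 := lintegral_add_pow_le (μ := Q) (p := 4) (by lia)
        (f := fun t : E d => ‖κ (s • t) (z i)‖ₑ) (g := fun t : E d => ‖(p i).eval t‖ₑ)
        (hkm i).enorm.aemeasurable (hpm i).enorm.aemeasurable (A := ENNReal.ofReal C +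
          ENNReal.ofReal C ^ 4 * (ENNReal.ofReal (A (4 * (M + 1)) + 1) * 2 ^ (4 * (M + 1))))
        (s := 1) (by simpa using (htail (z i) (hz2 i)).trans le_self_add)
        (by simpa using h2.trans le_add_self)
      refine h4.trans_eq ?_
      rw [errorConst]
      norm_num
    have h5 := lintegral_finsetSum_pow_le (μ := Q) (p := 4) (by lia) Finset.univ
      (f := fun i t => ‖D i t‖ₑ) (fun i => (hDm i).enorm.aemeasurable) (A := errorConst A C M)
      (s := fun i => ‖α i‖ₑ) (fun i _ => ?_)
    · refine (lintegral_mono fun t => pow_le_pow_left' (enorm_sum_le _ _) 4).trans (h5.trans ?_)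
      gcongr
      simp only [Real.enorm_eq_ofReal_abs]
      rw [← ENNReal.ofReal_sum_of_nonneg fun _ _ => abs_nonneg _]
      exact ENNReal.ofReal_le_ofReal hα
    · refine (lintegral_mono (g := fun t => ‖α i‖ₑ ^ 4 *
        (‖κ (s • t) (z i)‖ₑ + ‖(p i).eval t‖ₑ) ^ 4) fun t => ?_).trans ?_
      · simp only [hD]
        rw [enorm_mul, mul_pow]
        gcongr
        exact enorm_sub_le
      · have hmeas : Measurable fun t : E d =>
            (‖κ (s • t) (z i)‖ₑ + ‖(p i).eval t‖ₑ) ^ 4 :=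
          ((hkm i).enorm.add (hpm i).enorm).pow_const 4
        rw [lintegral_const_mul _ hmeas, mul_comm]
        gcongr
        exact h1 i
  have hDsum : Measurable fun t => ∑ i, D i t := Finset.measurable_sum _ fun i _ => hDm i
  have hbad : ∫⁻ t in Gᶜ, ENNReal.ofReal ((∑ i, D i t) ^ 2) ∂Q ≤
      (ENNReal.ofReal ((n + 2) * b * a ^ 4) * errorConst A C M) ^ (1 / 2 : ℝ) := by
    have h1 : ∫⁻ t in Gᶜ, ENNReal.ofReal ((∑ i, D i t) ^ 2) ∂Q =
        ∫⁻ t, (Gᶜ.indicator 1 t) * ‖∑ i, D i t‖ₑ ^ 2 ∂Q := by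
      rw [← lintegral_indicator hGm.compl]
      refine lintegral_congr fun t => ?_
      rw [Real.enorm_eq_ofReal_abs, ← ENNReal.ofReal_pow (abs_nonneg _), sq_abs]
      by_cases ht : t ∈ Gᶜ <;> simp [ht]
    have h2 := sq_lintegral_mul_le (μ := Q) (f := Gᶜ.indicator 1)
      (g := fun t => ‖∑ i, D i t‖ₑ ^ 2) ((measurable_one.indicator hGm.compl).aemeasurable)
      (hDsum.enorm.pow_const 2).aemeasurable
    have h3 : ∫⁻ t, (Gᶜ.indicator (1 : E d → ℝ≥0∞) t) ^ 2 ∂Q = Q Gᶜ := by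
      rw [← lintegral_indicator_one hGm.compl]
      refine lintegral_congr fun t => ?_
      by_cases ht : t ∈ Gᶜ <;> simp [ht]
    rw [h3] at h2
    simp only [← pow_mul] at h2
    rw [h1]
    have h4 : (∫⁻ t, (Gᶜ.indicator 1 t) * ‖∑ i, D i t‖ₑ ^ 2 ∂Q) ^ 2 ≤
        ENNReal.ofReal ((n + 2) * b * a ^ 4) * errorConst A C M := by
      refine h2.trans ((mul_le_mul' hGc hfour).trans_eq ?_)
      rw [ENNReal.ofReal_mul (p := (n + 2) * b) (by positivity), ENNReal.ofReal_pow ha]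
      ring
    have h5 := ENNReal.rpow_le_rpow h4 (by norm_num : (0 : ℝ) ≤ 1 / 2)
    rw [← ENNReal.rpow_natCast, ← ENNReal.rpow_mul] at h5
    norm_num at h5
    simpa using h5
  rw [← lintegral_add_compl _ hGm]
  refine add_le_add ?_ hbad
  refine (setLIntegral_mono measurable_const hgood).trans ?_
  rw [setLIntegral_const]
  exact mul_le_of_le_one_right' prob_le_one

end Approximation

/-! ### Almost orthonormality of the inputs -/

section Inputs

variable {d n : ℕ} {A : ℕ → ℝ} {B τ : ℝ} {Q : Measure (E d)}

/-- With the second vector `t` fixed, the tail bound for inner products applies with z = t/√τ as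
long as ‖z‖² ≤ 2. The other `t` are covered by the tail bound for the norm, whence the factor 2. -/
theorem IsConcentrated.prod_measure_inner_le (hA : ∀ q, 0 ≤ A q) (hτ : 0 < τ)
    (hQ : IsConcentrated A B Q τ) {q : ℕ} (hq : q ≠ 0) {δ b : ℝ} (hδ : 0 < δ) (hδ1 : δ ≤ 1)
    (hb : A q / (δ ^ 2 * τ) ^ q ≤ b) :
    (Q.prod Q) {v | δ * τ < |⟪v.1, v.2⟫|} ≤ ENNReal.ofReal (2 * b) := by
  have := hQ.isProbabilityMeasure
  have hb0 : 0 ≤ b := le_trans (by have := hA q; positivity) hb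
  have hsq : 0 < Real.sqrt τ := Real.sqrt_pos.2 hτ
  have hmeas : MeasurableSet {v : E d × E d | δ * τ < |⟪v.1, v.2⟫|} :=
    measurableSet_lt (by fun_prop) (by fun_prop)
  rw [Measure.prod_apply_symm hmeas]
  have h1 : ∀ t : E d, Q ((fun s => (s, t)) ⁻¹' {v : E d × E d | δ * τ < |⟪v.1, v.2⟫|}) ≤
      ENNReal.ofReal b + {t : E d | δ * τ < |‖t‖ ^ 2 - τ|}.indicator 1 t := by
    intro t
    by_cases ht : δ * τ < |‖t‖ ^ 2 - τ|
    · rw [Set.indicator_of_mem (by exact ht)]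
      exact prob_le_one.trans le_add_self
    · refine le_trans ?_ le_self_add
      rw [not_lt, abs_le] at ht
      have hz : ‖(Real.sqrt τ)⁻¹ • t‖ ^ 2 ≤ 2 := by
        rw [norm_smul, mul_pow, norm_inv, Real.norm_of_nonneg hsq.le, inv_pow,
          Real.sq_sqrt hτ.le, inv_mul_le_iff₀ hτ]
        nlinarith
      refine le_trans (measure_mono fun s hs => ?_)
        ((hQ.inner_tail q hq _ hz δ hδ hδ1).trans (ENNReal.ofReal_le_ofReal hb))
      change δ * Real.sqrt τ < |⟪s, (Real.sqrt τ)⁻¹ • t⟫|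
      replace hs : δ * τ < |⟪s, t⟫| := hs
      rw [real_inner_smul_right, abs_mul, abs_inv, abs_of_pos hsq, lt_inv_mul_iff₀ hsq]
      calc Real.sqrt τ * (δ * Real.sqrt τ) = δ * (Real.sqrt τ * Real.sqrt τ) := by ring
        _ = δ * τ := by rw [Real.mul_self_sqrt hτ.le]
        _ < _ := hs
  have hm2 : MeasurableSet {t : E d | δ * τ < |‖t‖ ^ 2 - τ|} :=
    measurableSet_lt (by fun_prop) (by fun_prop)
  refine (lintegral_mono h1).trans ?_
  rw [lintegral_add_left measurable_const, lintegral_const, measure_univ, mul_one,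
    lintegral_indicator_one hm2, two_mul, ENNReal.ofReal_add hb0 hb0]
  gcongr
  exact (hQ.norm_tail q hq δ hδ hδ1).trans (ENNReal.ofReal_le_ofReal hb)

theorem IsConcentrated.measure_not_almostOrthonormal_le (hA : ∀ q, 0 ≤ A q) (hτ : 0 < τ)
    (hQ : IsConcentrated A B Q τ) {q : ℕ} (hq : q ≠ 0) {δ b : ℝ} (hδ : 0 < δ) (hδ1 : δ ≤ 1)
    (hb : A q / (δ ^ 2 * τ) ^ q ≤ b) {Ω : Type*} [MeasurableSpace Ω] {μ : Measure Ω}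
    [IsProbabilityMeasure μ] {x : Fin n → Ω → E d} (hx : ∀ i, Measurable (x i))
    (hind : iIndepFun x μ) (hmap : ∀ i, μ.map (x i) = Q) :
    μ {ω | ¬ AlmostOrthonormal δ fun i => (Real.sqrt τ)⁻¹ • x i ω} ≤
      ENNReal.ofReal (3 * n ^ 2 * b) := by
  have := hQ.isProbabilityMeasure
  have hb0 : 0 ≤ b := le_trans (by have := hA q; positivity) hb
  have hsq : 0 < Real.sqrt τ := Real.sqrt_pos.2 hτ
  have hsub : {ω | ¬ AlmostOrthonormal δ fun i => (Real.sqrt τ)⁻¹ • x i ω} ⊆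
      (⋃ i, x i ⁻¹' {t | δ * τ < |‖t‖ ^ 2 - τ|}) ∪
      ⋃ i, ⋃ j, {ω | i ≠ j ∧ δ * τ < |⟪x i ω, x j ω⟫|} := by
    intro ω hω
    by_contra hcon
    simp only [Set.mem_union, Set.mem_iUnion, not_or, not_exists] at hcon
    refine hω ⟨fun i => ?_, fun i j hij => ?_⟩
    · have h1 : |‖x i ω‖ ^ 2 - τ| ≤ δ * τ := not_lt.1 (hcon.1 i)
      rw [norm_smul, mul_pow, norm_inv, Real.norm_of_nonneg hsq.le, inv_pow,
        Real.sq_sqrt hτ.le, show τ⁻¹ * ‖x i ω‖ ^ 2 - 1 = (‖x i ω‖ ^ 2 - τ) / τ by field_simp,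
        abs_div, abs_of_pos hτ]
      exact (div_le_iff₀ hτ).2 h1
    · have h1 : |⟪x i ω, x j ω⟫| ≤ δ * τ := not_lt.1 fun h => hcon.2 i j ⟨hij, h⟩
      rw [real_inner_smul_left, real_inner_smul_right, ← mul_assoc, ← mul_inv,
        Real.mul_self_sqrt hτ.le, abs_mul, abs_inv, abs_of_pos hτ, inv_mul_le_iff₀ hτ]
      linarith
  have h1 : ∀ i, μ (x i ⁻¹' {t | δ * τ < |‖t‖ ^ 2 - τ|}) ≤ ENNReal.ofReal b := by
    intro i
    rw [← Measure.map_apply (hx i) (measurableSet_lt (by fun_prop) (by fun_prop)), hmap i]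
    exact (hQ.norm_tail q hq δ hδ hδ1).trans (ENNReal.ofReal_le_ofReal hb)
  have h2 : ∀ i j, μ {ω | i ≠ j ∧ δ * τ < |⟪x i ω, x j ω⟫|} ≤ ENNReal.ofReal (2 * b) := by
    intro i j
    by_cases hij : i = j
    · simp [hij]
    · have h3 := (indepFun_iff_map_prod_eq_prod_map_map (hx i).aemeasurable
        (hx j).aemeasurable).1 (hind.indepFun hij)
      rw [hmap i, hmap j] at h3
      have h4 := hQ.prod_measure_inner_le hA hτ hq hδ hδ1 hb
      rw [← h3, Measure.map_apply ((hx i).prodMk (hx j))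
        (measurableSet_lt (by fun_prop) (by fun_prop))] at h4
      exact le_trans (measure_mono fun ω hω => hω.2) h4
  refine (measure_mono hsub).trans ((measure_union_le _ _).trans
    ((add_le_add ((measure_iUnion_fintype_le _ _).trans (Finset.sum_le_sum fun i _ => h1 i))
      ((measure_iUnion_fintype_le _ _).trans (Finset.sum_le_sum fun i _ =>
        (measure_iUnion_fintype_le _ _).trans (Finset.sum_le_sum fun j _ => h2 i j)))).trans ?_))
  simp only [Finset.sum_const, Finset.card_univ, Fintype.card_fin, nsmul_eq_mul]
  rw [← ENNReal.ofReal_natCast, ← ENNReal.ofReal_mul (by positivity),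
    ← ENNReal.ofReal_mul (by positivity), ← ENNReal.ofReal_mul (by positivity),
    ← ENNReal.ofReal_add (by positivity) (by positivity)]
  refine ENNReal.ofReal_le_ofReal ?_
  have h3 : (n : ℝ) ≤ n ^ 2 := by exact_mod_cast Nat.le_self_pow two_ne_zero n
  nlinarith [mul_le_mul_of_nonneg_right h3 hb0]

end Inputs

/-! ### The rates -/

/-- The choice is δ = n^(-θ) with 1/(m+1) < θ < β/2, possible because m + 1 > 2/β. The lower bound
on θ gives n δ^(m+1) → 0; the upper bound makes δ²τ grow at least like n^(β-2θ), and a large power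
`q` of it beats any power of `n`. -/
theorem exists_rates {m : ℕ} {β c : ℝ} (hβ : 0 < β) (hm : 2 / β < m + 1) (hc : 0 < c)
    {τ : ℕ → ℝ} (hτ : Tendsto (fun n : ℕ => τ n / (n : ℝ) ^ β) atTop (𝓝 c)) {A : ℕ → ℝ}
    (hA : ∀ q, 0 ≤ A q) :
    ∃ (δ : ℕ → ℝ) (q : ℕ) (K : ℝ), q ≠ 0 ∧ 0 < K ∧ (∀ᶠ n in atTop, 0 < δ n) ∧
      Tendsto δ atTop (𝓝 0) ∧ Tendsto (fun n => n * δ n ^ (m + 1)) atTop (𝓝 0) ∧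
      (∀ᶠ n : ℕ in atTop, A q / (δ n ^ 2 * τ n) ^ q ≤ K / (n : ℝ) ^ 8) ∧
      ∀ᶠ n : ℕ in atTop, 1 ≤ τ n := by
  have hm0 : (0 : ℝ) < m + 1 := by positivity
  have hlt : 1 / ((m : ℝ) + 1) < β / 2 := by
    rw [div_lt_iff₀ hβ] at hm
    rw [div_lt_div_iff₀ hm0 two_pos]
    linarith
  obtain ⟨θ, hθ1, hθ2⟩ := exists_between hlt
  have hθ0 : 0 < θ := lt_trans (by positivity) hθ1
  have hη : 0 < β - 2 * θ := by linarith
  -- The exponent 8 is ample: the probabilities of bad data, of order n² n⁻⁸, have to be summable,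
  -- and the contribution n · n⁻⁸ · n⁴ of the bad test points has to vanish.
  obtain ⟨q, hq⟩ := exists_nat_gt (8 / (β - 2 * θ))
  have hq0 : q ≠ 0 := by
    rintro rfl
    have : (0 : ℝ) < 8 / (β - 2 * θ) := by positivity
    simp at hq
    linarith
  have hτ2 : ∀ᶠ n : ℕ in atTop, c / 2 * (n : ℝ) ^ β ≤ τ n := by
    filter_upwards [hτ.eventually (lt_mem_nhds (half_lt_self hc)), eventually_gt_atTop 0]
      with n hn hn0
    have h0 : (0 : ℝ) < (n : ℝ) ^ β := Real.rpow_pos_of_pos (by exact_mod_cast hn0) _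
    exact ((lt_div_iff₀ h0).1 hn).le
  refine ⟨fun n => (n : ℝ) ^ (-θ), q, A q / (c / 2) ^ q + 1, hq0,
    by have := hA q; positivity, ?_, ?_, ?_, ?_, ?_⟩
  · filter_upwards [eventually_gt_atTop 0] with n hn
    exact Real.rpow_pos_of_pos (by exact_mod_cast hn) _
  · exact (tendsto_rpow_neg_atTop hθ0).comp tendsto_natCast_atTop_atTop
  · have h1 : 0 < θ * (m + 1) - 1 := by
      rw [div_lt_iff₀ hm0] at hθ1
      linarith
    refine ((tendsto_rpow_neg_atTop h1).comp tendsto_natCast_atTop_atTop).congr' ?_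
    filter_upwards [eventually_gt_atTop 0] with n hn
    have hn' : (0 : ℝ) < n := by exact_mod_cast hn
    simp only [Function.comp_apply]
    rw [← Real.rpow_natCast, ← Real.rpow_mul hn'.le]
    nth_rewrite 2 [← Real.rpow_one (n : ℝ)]
    rw [← Real.rpow_add hn']
    congr 1
    push_cast
    ring
  · filter_upwards [hτ2, eventually_ge_atTop 1] with n hn hn1
    have hn' : (1 : ℝ) ≤ n := by exact_mod_cast hn1
    have hn0 : (0 : ℝ) < n := by linarith
    have h1 : (c / 2) * (n : ℝ) ^ (β - 2 * θ) ≤ ((n : ℝ) ^ (-θ)) ^ 2 * τ n := by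
      have h2 : ((n : ℝ) ^ (-θ)) ^ 2 * (c / 2 * (n : ℝ) ^ β) = (c / 2) * (n : ℝ) ^ (β - 2 * θ) := by
        rw [← Real.rpow_natCast, ← Real.rpow_mul hn0.le, mul_left_comm, ← Real.rpow_add hn0]
        congr 2
        push_cast
        ring
      rw [← h2]
      gcongr
    have h3 : (n : ℝ) ^ 8 ≤ ((n : ℝ) ^ (β - 2 * θ)) ^ q := by
      rw [← Real.rpow_natCast _ q, ← Real.rpow_mul hn0.le, ← Real.rpow_natCast]
      refine Real.rpow_le_rpow_of_exponent_le hn' ?_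
      rw [div_lt_iff₀ hη] at hq
      push_cast
      linarith
    have h4 : (c / 2) ^ q * (n : ℝ) ^ 8 ≤ (((n : ℝ) ^ (-θ)) ^ 2 * τ n) ^ q := by
      refine le_trans ?_ (pow_le_pow_left₀ (by positivity) h1 q)
      rw [mul_pow]
      gcongr
    calc A q / (((n : ℝ) ^ (-θ)) ^ 2 * τ n) ^ q ≤ A q / ((c / 2) ^ q * (n : ℝ) ^ 8) := by
          have := hA q
          gcongr
      _ = A q / (c / 2) ^ q / (n : ℝ) ^ 8 := by rw [div_div]
      _ ≤ _ := by gcongr; linarith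
  · have h1 : Tendsto (fun n : ℕ => c / 2 * (n : ℝ) ^ β) atTop atTop :=
      Tendsto.const_mul_atTop (by positivity)
        ((tendsto_rpow_atTop hβ).comp tendsto_natCast_atTop_atTop)
    filter_upwards [hτ2, h1.eventually_ge_atTop 1] with n h2 h3
    linarith

/-! ### The approximation of the averaged estimator by polynomials -/

theorem tendsto_error_zero {m : ℕ} {δ : ℕ → ℝ} {C K a : ℝ} {D : ℝ≥0∞} (hD : D ≠ ∞) (hK : 0 ≤ K)
    (hδ : Tendsto (fun n : ℕ => n * δ n ^ (m + 1)) atTop (𝓝 0)) :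
    Tendsto (fun n : ℕ => ENNReal.ofReal ((n * a * (C * δ n ^ (m + 1))) ^ 2) +
      (ENNReal.ofReal ((n + 2) * (K / (n : ℝ) ^ 8) * (n * a) ^ 4) * D) ^ (1 / 2 : ℝ))
      atTop (𝓝 0) := by
  have h1 : Tendsto (fun n : ℕ => ENNReal.ofReal ((n * a * (C * δ n ^ (m + 1))) ^ 2))
      atTop (𝓝 0) := by
    have : Tendsto (fun n : ℕ => (n * a * (C * δ n ^ (m + 1))) ^ 2) atTop (𝓝 0) := by
      have h := ((hδ.const_mul (a * C)).pow 2)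
      simp only [mul_zero, ne_eq, OfNat.ofNat_ne_zero, not_false_eq_true, zero_pow] at h
      refine h.congr fun n => ?_
      ring
    simpa using ENNReal.tendsto_ofReal this
  have h2 : Tendsto (fun n : ℕ => (n + 2) * (K / (n : ℝ) ^ 8) * (n * a) ^ 4) atTop (𝓝 0) := by
    have h3 : Tendsto (fun n : ℕ => 3 * K * a ^ 4 * (1 / (n : ℝ))) atTop (𝓝 0) := by
      simpa using (tendsto_one_div_atTop_nhds_zero_nat (𝕜 := ℝ)).const_mul (3 * K * a ^ 4)
    refine squeeze_zero' (Eventually.of_forall fun n => by positivity) ?_ h3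
    filter_upwards [eventually_ge_atTop 1] with n hn
    have hn1 : (1 : ℝ) ≤ n := by exact_mod_cast hn
    have hn0 : (0 : ℝ) < n := by linarith
    have h4 : ((n : ℝ) + 2) * (K / (n : ℝ) ^ 8) * (n * a) ^ 4 =
        K * a ^ 4 * ((n + 2) / (n : ℝ) ^ 4) := by
      field_simp
    have h5 : ((n : ℝ) + 2) / (n : ℝ) ^ 4 ≤ 3 * (1 / n) := by
      rw [mul_one_div, div_le_div_iff₀ (by positivity) hn0]
      have h6 : (n : ℝ) ^ 2 ≤ (n : ℝ) ^ 4 := pow_le_pow_right₀ hn1 (by norm_num)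
      nlinarith
    rw [h4]
    calc K * a ^ 4 * (((n : ℝ) + 2) / (n : ℝ) ^ 4) ≤ K * a ^ 4 * (3 * (1 / n)) := by gcongr
      _ = _ := by ring
  have h3 := ENNReal.tendsto_ofReal h2
  rw [ENNReal.ofReal_zero] at h3
  have h4 := ENNReal.Tendsto.mul_const (b := D) h3 (Or.inr hD)
  rw [zero_mul] at h4
  have h5 := (ENNReal.continuous_rpow_const (y := (1 / 2 : ℝ))).tendsto 0 |>.comp h4
  rw [ENNReal.zero_rpow_of_pos (by norm_num)] at h5
  simpa using h1.add h5

section Core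

variable {k : ∀ d : ℕ, E d → E d → ℝ} {m M : ℕ} {β c : ℝ} {d : ℕ → ℕ}
  {Q : ∀ n, Measure (E (d n))} {τ : ℕ → ℝ} {A : ℕ → ℝ} {B C ε : ℝ}

/-- By Borel-Cantelli the scaled inputs are almost orthonormal for all large `n`. From then on
everything is deterministic: the eigenvalue bound controls the weights, and the polynomial
approximation of the kernel sum applies. -/
theorem ae_exists_polynomial (hkc : ∀ d, Continuous fun p : E d × E d => k d p.1 p.2)
    (hkp : ∀ d, IsPSDKernelOn Set.univ (k d)) (heb : HasEigenvalueBound k m) (hβ : 0 < β)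
    (hm : 2 / β < m + 1) (hc : 0 < c)
    (hτ : Tendsto (fun n : ℕ => τ n / (n : ℝ) ^ β) atTop (𝓝 c)) (hA : ∀ q, 0 ≤ A q)
    (hQ : ∀ᶠ n in atTop, IsConcentrated A B (Q n) (τ n)) (hC : 0 ≤ C) (hε : 0 < ε) (hε1 : ε ≤ 1)
    (U : ∀ n, Set (E (d n))) (hUm : ∀ n, MeasurableSet (U n))
    (hU : ∀ᶠ n in atTop, ∀ q, q ≠ 0 → Q n (U n)ᶜ ≤ ENNReal.ofReal (A q / τ n ^ q))
    (happ : ∀ᶠ n in atTop, ApproximableOn C ε m M (k (d n)) (U n) (τ n))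
    (htail : ∀ᶠ n in atTop, HasMomentBound C (k (d n)) (Q n) (τ n))
    {ρ : ∀ n, Kernel (E (d n)) ℝ} (hρ : ∀ n, IsMarkovKernel (ρ n))
    (hρi : ∀ n t, Integrable (fun y => y) (ρ n t)) {F : ℝ}
    (hF : ∀ n t, |groundTruth (ρ n) t| ≤ F) {lam : ℕ → ℝ} (hlam : ∀ n, 0 ≤ lam n)
    {Ω : Type u} [MeasurableSpace Ω] {μ : Measure Ω} [IsProbabilityMeasure μ]
    {x : ∀ n, Fin n → Ω → E (d n)} (hx : ∀ n i, Measurable (x n i))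
    (hind : ∀ n, iIndepFun (x n) μ) (hmap : ∀ n i, μ.map (x n i) = Q n) :
    ∀ᵐ ω ∂μ, (∀ᶠ n in atTop, Measurable fun t => averagedEstimator
        (scaledKernel (k (d n)) (τ n)) (lam n) (ρ n) (fun i => x n i ω) t) ∧
      ∃ p : ∀ n, MvPolynomial (Fin (d n)) ℝ, (∀ n, p n ∈ polySpace (d n) M) ∧
      Tendsto (fun n => sqL2 (Q n) fun t =>
        averagedEstimator (scaledKernel (k (d n)) (τ n)) (lam n) (ρ n) (fun i => x n i ω) t
          - (p n).eval t) atTop (𝓝 0) := by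
  obtain ⟨δ, q, K, hq, hK, hδpos, hδ0, hδn, hb, hτ1⟩ := exists_rates hβ hm hc hτ hA
  obtain ⟨γ, hγ, ε', hε', heb⟩ := heb
  have hδε : ∀ᶠ n in atTop, δ n ≤ min ε ε' :=
    (hδ0.eventually (gt_mem_nhds (lt_min hε hε'))).mono fun n h => h.le
  have hδn' : ∀ᶠ n : ℕ in atTop, n * δ n ^ (m + 1) ≤ ε' :=
    (hδn.eventually (gt_mem_nhds hε')).mono fun n h => h.le
  -- the data are almost orthonormal
  have hao : ∀ᵐ ω ∂μ, ∀ᶠ n in atTop,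
      AlmostOrthonormal (δ n) fun i => (Real.sqrt (τ n))⁻¹ • x n i ω := by
    have h1 : ∀ᶠ n : ℕ in atTop, μ {ω | ¬ AlmostOrthonormal (δ n)
        fun i => (Real.sqrt (τ n))⁻¹ • x n i ω} ≤ ENNReal.ofReal (3 * K * (1 / (n : ℝ) ^ 2)) := by
      filter_upwards [hδpos, hδε, hb, hτ1, hQ, eventually_ge_atTop 1] with n h1 h2 h3 h4 h5 h6
      refine (h5.measure_not_almostOrthonormal_le hA (by linarith) hq h1
        ((h2.trans (min_le_left _ _)).trans hε1) h3 (hx n) (hind n) (hmap n)).trans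
        (ENNReal.ofReal_le_ofReal ?_)
      have h7 : (1 : ℝ) ≤ n := by exact_mod_cast h6
      have h8 : (n : ℝ) ^ 2 / (n : ℝ) ^ 8 ≤ 1 / (n : ℝ) ^ 2 := by
        rw [div_le_div_iff₀ (by positivity) (by positivity), one_mul, ← pow_add]
        exact pow_le_pow_right₀ h7 (by norm_num)
      calc 3 * (n : ℝ) ^ 2 * (K / (n : ℝ) ^ 8) = 3 * K * ((n : ℝ) ^ 2 / (n : ℝ) ^ 8) := by ring
        _ ≤ _ := by gcongr
    obtain ⟨N, hN⟩ := eventually_atTop.1 h1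
    -- The probability bound only holds from `N` on, so the events are made empty before.
    have h2 : ∑' n, μ {ω | N ≤ n ∧ ¬ AlmostOrthonormal (δ n)
        fun i => (Real.sqrt (τ n))⁻¹ • x n i ω} ≠ ∞ := by
      have h3 : Summable fun n : ℕ => 3 * K * (1 / (n : ℝ) ^ 2) :=
        (Real.summable_one_div_nat_pow.2 one_lt_two).mul_left _
      refine ne_top_of_le_ne_top h3.tsum_ofReal_ne_top (ENNReal.tsum_le_tsum fun n => ?_)
      by_cases hn : N ≤ n
      · simpa [hn] using hN n hn
      · simp [hn]
    filter_upwards [ae_eventually_notMem h2] with ω hω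
    filter_upwards [hω, eventually_ge_atTop N] with n hn hnN
    by_contra hcon
    exact hn ⟨hnN, hcon⟩
  filter_upwards [hao] with ω hω
  -- the averaged estimator
  have hest : ∀ᶠ n : ℕ in atTop, ∃ α : Fin n → ℝ, (∀ t, averagedEstimator
      (scaledKernel (k (d n)) (τ n)) (lam n) (ρ n) (fun i => x n i ω) t =
      ∑ i, α i * k (d n) ((Real.sqrt (τ n))⁻¹ • t) ((Real.sqrt (τ n))⁻¹ • x n i ω)) ∧
      ∑ i, |α i| ≤ n * (F / γ) := by
    filter_upwards [hω, hδε, hδn'] with n h1 h2 h3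
    have := hρ n
    obtain ⟨α, hα1, hα2⟩ := exists_averagedEstimator_eq (k := scaledKernel (k (d n)) (τ n))
      ((hkp (d n)).comp (f := fun t => (Real.sqrt (τ n))⁻¹ • t) (Set.mapsTo_univ _ _))
      (hlam n) (ρ n) (hρi n) (fun i => x n i ω) hγ
      (heb (d n) n (δ n) _ (h2.trans (min_le_right _ _)) h3 h1)
    refine ⟨α, hα1, ?_⟩
    have hF0 : 0 ≤ F := (abs_nonneg _).trans (hF n 0)
    refine abs_le_of_sq_le_sq' ?_ (by positivity) |>.2
    -- One factor √n comes from comparing the 1-norm with the 2-norm of the weights, the other from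
    -- ‖(f*(xᵢ))‖ ≤ √n F.
    have h4 := sq_sum_le_card_mul_sum_sq (s := Finset.univ) (f := fun i => |α i|)
    simp only [sq_abs, Finset.card_univ, Fintype.card_fin] at h4
    have h5 : ∑ i : Fin n, groundTruth (ρ n) (x n i ω) ^ 2 ≤ n * F ^ 2 := by
      refine (Finset.sum_le_sum fun i _ => (?_ : _ ≤ F ^ 2)).trans_eq (by simp)
      rw [← sq_abs]
      exact pow_le_pow_left₀ (abs_nonneg _) (hF n _) 2
    have h6 : ∑ i, α i ^ 2 ≤ n * F ^ 2 / γ ^ 2 := by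
      rw [le_div_iff₀ (by positivity)]
      linarith
    calc _ ≤ (n : ℝ) * ∑ i, α i ^ 2 := h4
      _ ≤ n * (n * F ^ 2 / γ ^ 2) := by gcongr
      _ = _ := by ring
  have hcont : ∀ (n : ℕ) (z : E (d n)), Continuous fun t => k (d n) t z := fun n z =>
    (hkc (d n)).comp (continuous_id.prodMk continuous_const)
  refine ⟨?_, ?_⟩
  · filter_upwards [hest] with n ⟨α, hα, _⟩
    simp only [hα]
    refine (continuous_finsetSum _ fun i _ => ?_).measurable
    exact ((hcont n _).comp (continuous_const_smul _)).const_mul _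
  have hpoly : ∀ᶠ n : ℕ in atTop, ∃ p ∈ polySpace (d n) M, (sqL2 (Q n) fun t =>
      averagedEstimator (scaledKernel (k (d n)) (τ n)) (lam n) (ρ n) (fun i => x n i ω) t
        - p.eval t) ≤ ENNReal.ofReal ((n * (F / γ) * (C * δ n ^ (m + 1))) ^ 2) +
      (ENNReal.ofReal ((n + 2) * (K / (n : ℝ) ^ 8) * (n * (F / γ)) ^ 4)
        * errorConst A C M) ^ (1 / 2 : ℝ) := by
    filter_upwards [hest, hω, hδpos, hδε, hb, hτ1, hQ, hU, happ, htail]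
      with n ⟨α, hα, hαs⟩ h1 h2 h3 h4 h5 h6 h7 h8 h9
    have hδε' := h3.trans (min_le_left _ _)
    simp only [hα]
    refine exists_polynomial_sqL2_le hA (by linarith) h6 (hcont n) (hUm n) (by positivity) ?_
      hC hε1 h8 h9 h2 hδε' h1 hq h4 α hαs
    refine (h7 q hq).trans (ENNReal.ofReal_le_ofReal (le_trans ?_ h4))
    have hAq := hA q
    have hτpos : 0 < τ n := by linarith
    gcongr
    exact mul_le_of_le_one_left hτpos.le (pow_le_one₀ h2.le (hδε'.trans hε1))
  classical
  -- The finitely many `n` without a good approximant get the polynomial 0.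
  refine ⟨fun n => if h : ∃ p ∈ polySpace (d n) M, (sqL2 (Q n) fun t =>
      averagedEstimator (scaledKernel (k (d n)) (τ n)) (lam n) (ρ n) (fun i => x n i ω) t
        - p.eval t) ≤ ENNReal.ofReal ((n * (F / γ) * (C * δ n ^ (m + 1))) ^ 2) +
      (ENNReal.ofReal ((n + 2) * (K / (n : ℝ) ^ 8) * (n * (F / γ)) ^ 4)
        * errorConst A C M) ^ (1 / 2 : ℝ) then h.choose else 0, fun n => ?_, ?_⟩
  · beta_reduce
    split_ifs with h
    · exact h.choose_spec.1
    · simp [polySpace]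
  · refine tendsto_of_tendsto_of_tendsto_of_le_of_le' tendsto_const_nhds
      (tendsto_error_zero (a := F / γ) (C := C) (errorConst_ne_top A C M) hK.le hδn)
      (Eventually.of_forall fun n => zero_le) ?_
    filter_upwards [hpoly] with n hn
    rw [dif_pos hn]
    exact hn.choose_spec.2

/-- Weighted Young inequality: (b - a)² ≤ (1 + η)a² + (1 + 1/η)b². With a small `η` the bias, which
takes the place of a², keeps a factor close to one. -/
theorem sqL2_sub_le_add {X : Type} [MeasurableSpace X] {Q : Measure X} {f g p : X → ℝ}
    (hf : Measurable f) (hg : Measurable g) {η : ℝ} (hη : 0 < η) :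
    sqL2 Q (fun t => g t - p t) ≤ ENNReal.ofReal (1 + η) * sqL2 Q (fun t => f t - g t) +
      ENNReal.ofReal (1 + η⁻¹) * sqL2 Q (fun t => f t - p t) := by
  have h1 : ∀ t, ENNReal.ofReal ((g t - p t) ^ 2) ≤ ENNReal.ofReal (1 + η) *
      ENNReal.ofReal ((f t - g t) ^ 2) + ENNReal.ofReal (1 + η⁻¹) *
      ENNReal.ofReal ((f t - p t) ^ 2) := by
    intro t
    rw [← ENNReal.ofReal_mul (by positivity), ← ENNReal.ofReal_mul (by positivity),
      ← ENNReal.ofReal_add (by positivity) (by positivity)]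
    refine ENNReal.ofReal_le_ofReal ?_
    set a := f t - g t
    set b := f t - p t
    have h2 : g t - p t = b - a := by simp only [a, b]; ring
    rw [h2]
    have h3 : (1 + η) * a ^ 2 + (1 + η⁻¹) * b ^ 2 - (b - a) ^ 2 = η⁻¹ * (η * a + b) ^ 2 := by
      field_simp
      ring
    have h4 : 0 ≤ η⁻¹ * (η * a + b) ^ 2 := by positivity
    linarith
  refine (lintegral_mono h1).trans_eq ?_
  have hm : Measurable fun t => ENNReal.ofReal ((f t - g t) ^ 2) := by fun_prop
  rw [lintegral_add_left (hm.const_mul _), lintegral_const_mul' _ _ ENNReal.ofReal_ne_top,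
    lintegral_const_mul' _ _ ENNReal.ofReal_ne_top]
  rfl

theorem measurable_groundTruth {X : Type} [MeasurableSpace X] (ρ : Kernel X ℝ)
    [IsMarkovKernel ρ] : Measurable (groundTruth ρ) :=
  (StronglyMeasurable.integral_kernel (f := fun y : ℝ => y)
    measurable_id.stronglyMeasurable).measurable

/-- If the bias is at least F², which includes an infinite bias, then the polynomial 0 already
satisfies the bound. Otherwise the surplus η · bias is at most ηF² ≤ ε/2, and the distance of the
averaged estimator from its polynomial contributes the other ε/2 once `n` is large. -/
theorem barrierConclusion_of_ae (hQ : ∀ᶠ n in atTop, IsProbabilityMeasure (Q n))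
    {ρ : ∀ n, Kernel (E (d n)) ℝ} (hρ : ∀ n, IsMarkovKernel (ρ n)) {F : ℝ}
    (hF : ∀ n t, |groundTruth (ρ n) t| ≤ F) {lam : ℕ → ℝ}
    {Ω : Type u} [MeasurableSpace Ω] {μ : Measure Ω}
    {x : ∀ n, Fin n → Ω → E (d n)}
    (h : ∀ᵐ ω ∂μ, (∀ᶠ n in atTop, Measurable fun t => averagedEstimator
        (scaledKernel (k (d n)) (τ n)) (lam n) (ρ n) (fun i => x n i ω) t) ∧
      ∃ p : ∀ n, MvPolynomial (Fin (d n)) ℝ, (∀ n, p n ∈ polySpace (d n) M) ∧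
      Tendsto (fun n => sqL2 (Q n) fun t =>
        averagedEstimator (scaledKernel (k (d n)) (τ n)) (lam n) (ρ n) (fun i => x n i ω) t
          - (p n).eval t) atTop (𝓝 0)) :
    BarrierConclusion k M d Q τ ρ lam μ x := by
  refine ⟨fun ε hε => ?_, fun _ => h.mono fun ω hω => hω.2⟩
  filter_upwards [h] with ω ⟨hmeas, p, hp, hlim⟩
  have hF0 : 0 ≤ F := (abs_nonneg _).trans (hF 0 0)
  set η : ℝ := ε / 2 / (F ^ 2 + 1) with hη
  have hηpos : 0 < η := by positivity
  have hηF : η * F ^ 2 ≤ ε / 2 := by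
    rw [hη, div_mul_eq_mul_div, div_le_iff₀ (by positivity)]
    nlinarith
  have hlim2 := ENNReal.Tendsto.const_mul (a := ENNReal.ofReal (1 + η⁻¹)) hlim
    (Or.inr ENNReal.ofReal_ne_top)
  rw [mul_zero] at hlim2
  filter_upwards [hmeas, hlim2.eventually (gt_mem_nhds (ENNReal.ofReal_pos.2 (half_pos hε))), hQ]
    with n hn hn2 hQn
  have := hρ n
  rcases le_or_gt (ENNReal.ofReal (F ^ 2))
    (bias (Q n) (scaledKernel (k (d n)) (τ n)) (lam n) (ρ n) fun i => x n i ω) with hcase | hcase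
  · refine le_trans (iInf₂_le (0 : MvPolynomial (Fin (d n)) ℝ) (by simp [polySpace])) ?_
    refine le_trans ?_ (hcase.trans le_self_add)
    have h1 : ∀ t : E (d n), ENNReal.ofReal ((groundTruth (ρ n) t
        - MvPolynomial.eval t (0 : MvPolynomial (Fin (d n)) ℝ)) ^ 2) ≤
        ENNReal.ofReal (F ^ 2) := by
      intro t
      refine ENNReal.ofReal_le_ofReal ?_
      rw [map_zero, sub_zero, ← sq_abs]
      exact pow_le_pow_left₀ (abs_nonneg _) (hF n t) 2
    refine (lintegral_mono h1).trans ?_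
    rw [lintegral_const, measure_univ, mul_one]
  · refine le_trans (iInf₂_le (p n) (hp n)) ?_
    refine (sqL2_sub_le_add hn (measurable_groundTruth (ρ n)) hηpos).trans ?_
    change ENNReal.ofReal (1 + η) * bias (Q n) (scaledKernel (k (d n)) (τ n)) (lam n) (ρ n)
      (fun i => x n i ω) + _ ≤ _
    rw [ENNReal.ofReal_add zero_le_one hηpos.le, ENNReal.ofReal_one, add_mul, one_mul, add_assoc]
    gcongr
    have h2 : ENNReal.ofReal η * bias (Q n) (scaledKernel (k (d n)) (τ n)) (lam n) (ρ n)
        (fun i => x n i ω) ≤ ENNReal.ofReal (ε / 2) := by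
      refine (mul_le_mul' le_rfl hcase.le).trans ?_
      rw [← ENNReal.ofReal_mul hηpos.le]
      exact ENNReal.ofReal_le_ofReal hηF
    refine (add_le_add h2 hn2.le).trans_eq ?_
    rw [← ENNReal.ofReal_add (by positivity) (by positivity), add_halves]

end Core

/-! ### The barrier for kernels with a Taylor approximation -/

/-- A Taylor approximation of order `m` of `k d t z` in `‖t‖² - 1` and `⟪t, z⟫`, for almost
normalised `t` and `z` which are almost orthogonal. -/
def HasTaylorApproximation (k : ∀ d : ℕ, E d → E d → ℝ) (m : ℕ) : Prop :=
  ∃ (T : Finset (ℕ × ℕ)) (a : ℕ × ℕ → ℝ → ℝ) (C ε : ℝ), (∀ p ∈ T, p.1 + p.2 ≤ m) ∧ 0 ≤ C ∧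
    0 < ε ∧ ε ≤ 1 ∧ (∀ p ∈ T, ∃ K, ∀ v, |v - 1| ≤ ε → |a p v| ≤ K) ∧
    ∀ (d : ℕ) (t z : E d) (δ : ℝ), |‖z‖ ^ 2 - 1| ≤ ε → δ ≤ ε → |‖t‖ ^ 2 - 1| ≤ δ →
      |⟪t, z⟫| ≤ δ →
      |k d t z - ∑ p ∈ T, a p (‖z‖ ^ 2) * ((‖t‖ ^ 2 - 1) ^ p.1 * ⟪t, z⟫ ^ p.2)| ≤ C * δ ^ (m + 1)

/-- Moment bounds for the kernel functions under concentrated laws. -/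
def HasKernelMoments (k : ∀ d : ℕ, E d → E d → ℝ) : Prop :=
  ∀ (A : ℕ → ℝ) (B : ℝ), (∀ q, 0 ≤ A q) → ∃ C : ℝ, 0 ≤ C ∧ ∀ (d : ℕ) (Q : Measure (E d)) (τ : ℝ),
    1 ≤ τ → IsConcentrated A B Q τ → HasMomentBound C (k d) Q τ

section Polynomials

variable {d : ℕ}

/-- The polynomial `‖t‖² / τ - 1`. -/
noncomputable def normPoly (d : ℕ) (τ : ℝ) : MvPolynomial (Fin d) ℝ :=
  (∑ i, MvPolynomial.C τ⁻¹ * MvPolynomial.X i ^ 2) - 1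

/-- The polynomial `⟪t, z⟫ / √τ`. -/
noncomputable def innerPoly (τ : ℝ) (z : E d) : MvPolynomial (Fin d) ℝ :=
  ∑ i, MvPolynomial.C ((Real.sqrt τ)⁻¹ * z i) * MvPolynomial.X i

theorem norm_inv_sqrt_smul_sq {τ : ℝ} (hτ : 0 < τ) (t : E d) :
    ‖(Real.sqrt τ)⁻¹ • t‖ ^ 2 = ‖t‖ ^ 2 / τ := by
  rw [norm_smul, mul_pow, Real.norm_eq_abs, sq_abs, inv_pow, Real.sq_sqrt hτ.le, div_eq_inv_mul]

theorem eval_normPoly {τ : ℝ} (hτ : 0 < τ) (t : E d) :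
    (normPoly d τ).eval t = ‖(Real.sqrt τ)⁻¹ • t‖ ^ 2 - 1 := by
  rw [norm_inv_sqrt_smul_sq hτ, EuclideanSpace.real_norm_sq_eq, div_eq_inv_mul, Finset.mul_sum]
  simp [normPoly]

theorem eval_innerPoly (τ : ℝ) (z t : E d) :
    (innerPoly τ z).eval t = ⟪(Real.sqrt τ)⁻¹ • t, z⟫ := by
  rw [real_inner_smul_left, PiLp.inner_apply, Finset.mul_sum]
  simp only [innerPoly, map_sum, map_mul, MvPolynomial.eval_C, MvPolynomial.eval_X]
  refine Finset.sum_congr rfl fun i _ => ?_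
  simp only [RCLike.inner_apply, conj_trivial]
  ring

theorem totalDegree_normPoly (τ : ℝ) : (normPoly d τ).totalDegree ≤ 2 := by
  refine (MvPolynomial.totalDegree_sub _ _).trans (max_le ?_ (by simp))
  refine MvPolynomial.totalDegree_finsetSum_le fun i _ => ?_
  refine (MvPolynomial.totalDegree_mul _ _).trans ?_
  rw [MvPolynomial.totalDegree_C, zero_add, MvPolynomial.totalDegree_X_pow]

theorem totalDegree_innerPoly (τ : ℝ) (z : E d) : (innerPoly τ z).totalDegree ≤ 1 := by
  refine MvPolynomial.totalDegree_finsetSum_le fun i _ => ?_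
  refine (MvPolynomial.totalDegree_mul _ _).trans ?_
  rw [MvPolynomial.totalDegree_C, zero_add, MvPolynomial.totalDegree_X]

/-- A polynomial in `‖t‖² / τ - 1` and `⟪t, z⟫ / √τ`. -/
noncomputable def taylorPoly (τ : ℝ) (z : E d) (T : Finset (ℕ × ℕ)) (a : ℕ × ℕ → ℝ) :
    MvPolynomial (Fin d) ℝ :=
  ∑ p ∈ T, MvPolynomial.C (a p) * (normPoly d τ ^ p.1 * innerPoly τ z ^ p.2)

theorem eval_taylorPoly {τ : ℝ} (hτ : 0 < τ) (z : E d) (T : Finset (ℕ × ℕ)) (a : ℕ × ℕ → ℝ)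
    (t : E d) : (taylorPoly τ z T a).eval t = ∑ p ∈ T, a p *
      ((‖(Real.sqrt τ)⁻¹ • t‖ ^ 2 - 1) ^ p.1 * ⟪(Real.sqrt τ)⁻¹ • t, z⟫ ^ p.2) := by
  simp only [taylorPoly, map_sum, map_mul, map_pow, MvPolynomial.eval_C, eval_normPoly hτ,
    eval_innerPoly]

theorem totalDegree_taylorPoly (τ : ℝ) (z : E d) {T : Finset (ℕ × ℕ)} (a : ℕ × ℕ → ℝ) {M : ℕ}
    (hT : ∀ p ∈ T, 2 * p.1 + p.2 ≤ M) : taylorPoly τ z T a ∈ polySpace d M := by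
  refine MvPolynomial.totalDegree_finsetSum_le fun p hp => ?_
  refine (MvPolynomial.totalDegree_mul _ _).trans ?_
  rw [MvPolynomial.totalDegree_C, zero_add]
  refine (MvPolynomial.totalDegree_mul _ _).trans ?_
  have h1 := MvPolynomial.totalDegree_pow (normPoly d τ) p.1
  have h2 := MvPolynomial.totalDegree_pow (innerPoly τ z) p.2
  have h3 := Nat.mul_le_mul_left p.1 (totalDegree_normPoly (d := d) τ)
  have h4 := Nat.mul_le_mul_left p.2 (totalDegree_innerPoly τ z)
  have h5 := hT p hp
  omega

theorem abs_eval_taylorPoly_le {τ : ℝ} (hτ : 0 < τ) {z : E d} (hz : ‖z‖ ^ 2 ≤ 2)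
    {T : Finset (ℕ × ℕ)} {a : ℕ × ℕ → ℝ} {K : ℕ × ℕ → ℝ} (ha : ∀ p ∈ T, |a p| ≤ K p) {M : ℕ}
    (hT : ∀ p ∈ T, p.1 + p.2 ≤ M) (t : E d) :
    |(taylorPoly τ z T a).eval t| ≤ (∑ p ∈ T, K p) * (1 + ‖t‖ ^ 2 / τ) ^ M := by
  rw [eval_taylorPoly hτ, Finset.sum_mul]
  refine (Finset.abs_sum_le_sum_abs _ _).trans (Finset.sum_le_sum fun p hp => ?_)
  have hr : 0 ≤ ‖t‖ ^ 2 / τ := by positivity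
  have h1 : |‖(Real.sqrt τ)⁻¹ • t‖ ^ 2 - 1| ≤ 1 + ‖t‖ ^ 2 / τ := by
    rw [norm_inv_sqrt_smul_sq hτ, abs_le]
    constructor <;> linarith
  have h2 : |⟪(Real.sqrt τ)⁻¹ • t, z⟫| ≤ 1 + ‖t‖ ^ 2 / τ := by
    refine (abs_real_inner_le_norm _ _).trans (abs_le_of_sq_le_sq' ?_ (by positivity)).2
    rw [mul_pow, norm_inv_sqrt_smul_sq hτ]
    nlinarith [sq_nonneg (1 - ‖t‖ ^ 2 / τ)]
  rw [abs_mul, abs_mul, abs_pow, abs_pow]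
  have h3 : |‖(Real.sqrt τ)⁻¹ • t‖ ^ 2 - 1| ^ p.1 * |⟪(Real.sqrt τ)⁻¹ • t, z⟫| ^ p.2 ≤
      (1 + ‖t‖ ^ 2 / τ) ^ M := by
    calc _ ≤ (1 + ‖t‖ ^ 2 / τ) ^ p.1 * (1 + ‖t‖ ^ 2 / τ) ^ p.2 := by gcongr
      _ = (1 + ‖t‖ ^ 2 / τ) ^ (p.1 + p.2) := (pow_add _ _ _).symm
      _ ≤ _ := pow_le_pow_right₀ (by linarith) (hT p hp)
  exact mul_le_mul (ha p hp) h3 (by positivity) ((abs_nonneg _).trans (ha p hp))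

/-- The origin of the two degrees. The monomial (‖t‖² - 1)^i ⟨t, z⟩^j with i + j ≤ m has degree 2i +
j ≤ 2m in `t`. Where the norm is exactly √τ, all monomials with i > 0 vanish and may be dropped,
which leaves degree at most m. -/
theorem HasTaylorApproximation.exists_approximableOn {k : ∀ d : ℕ, E d → E d → ℝ} {m : ℕ}
    (h : HasTaylorApproximation k m) : ∃ C ε : ℝ, 0 ≤ C ∧ 0 < ε ∧ ε ≤ 1 ∧
      ∀ (d : ℕ) (τ : ℝ), 0 < τ → ApproximableOn C ε m (2 * m) (k d) Set.univ τ ∧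
        ApproximableOn C ε m m (k d) {t | ‖t‖ ^ 2 = τ} τ := by
  obtain ⟨T, a, C, ε, hT, hC, hε, hε1, ha, happ⟩ := h
  choose! K hK using ha
  have hK0 : ∀ p ∈ T, 0 ≤ K p := fun p hp =>
    (abs_nonneg _).trans (hK p hp 1 (by simpa using hε.le))
  have hS : 0 ≤ ∑ p ∈ T, K p := Finset.sum_nonneg hK0
  refine ⟨C + ∑ p ∈ T, K p, ε, by positivity, hε, hε1, fun d τ hτ => ⟨fun z hz => ?_,
    fun z hz => ?_⟩⟩
  · have hz2 : ‖z‖ ^ 2 ≤ 2 := by linarith [(abs_le.1 hz).2]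
    refine ⟨taylorPoly τ z T fun p => a p (‖z‖ ^ 2),
      totalDegree_taylorPoly τ z _ fun p hp => by have := hT p hp; omega, fun t => ?_,
      fun δ hδ t _ h1 h2 => ?_⟩
    · refine (abs_eval_taylorPoly_le hτ hz2 (fun p hp => hK p hp _ hz)
        (M := 2 * m + 1) (fun p hp => by have := hT p hp; omega) t).trans ?_
      gcongr
      linarith
    · rw [eval_taylorPoly hτ]
      refine (happ d _ z δ hz hδ h1 h2).trans ?_
      have hδ0 : 0 ≤ δ := (abs_nonneg _).trans h1
      gcongr
      linarith
  · have hz2 : ‖z‖ ^ 2 ≤ 2 := by linarith [(abs_le.1 hz).2]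
    refine ⟨taylorPoly τ z (T.filter fun p => p.1 = 0) fun p => a p (‖z‖ ^ 2),
      totalDegree_taylorPoly τ z _ fun p hp => ?_, fun t => ?_,
      fun δ hδ t ht h1 h2 => ?_⟩
    · have := hT p (Finset.mem_filter.1 hp).1
      have := (Finset.mem_filter.1 hp).2
      omega
    · refine (abs_eval_taylorPoly_le hτ hz2
        (fun p hp => hK p (Finset.mem_filter.1 hp).1 _ hz)
        (M := m + 1) (fun p hp => by have := hT p (Finset.mem_filter.1 hp).1; omega) t).trans ?_
      gcongr
      refine (Finset.sum_le_sum_of_subset_of_nonneg (Finset.filter_subset _ _)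
        fun p hp _ => hK0 p hp).trans ?_
      linarith
    · have ht' : ‖(Real.sqrt τ)⁻¹ • t‖ ^ 2 - 1 = 0 := by
        change ‖t‖ ^ 2 = τ at ht
        rw [norm_inv_sqrt_smul_sq hτ, ht, div_self hτ.ne', sub_self]
      have hsum : (taylorPoly τ z (T.filter fun p => p.1 = 0) fun p => a p (‖z‖ ^ 2)).eval t =
          ∑ p ∈ T, a p (‖z‖ ^ 2) * ((‖(Real.sqrt τ)⁻¹ • t‖ ^ 2 - 1) ^ p.1 *
            ⟪(Real.sqrt τ)⁻¹ • t, z⟫ ^ p.2) := by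
        rw [eval_taylorPoly hτ]
        refine Finset.sum_subset (Finset.filter_subset _ _) fun p hp hp' => ?_
        have : p.1 ≠ 0 := fun h => hp' (Finset.mem_filter.2 ⟨hp, h⟩)
        rw [ht', zero_pow this, zero_mul, mul_zero]
      rw [hsum]
      refine (happ d _ z δ hz hδ h1 h2).trans ?_
      have hδ0 : 0 ≤ δ := (abs_nonneg _).trans h1
      gcongr
      linarith

end Polynomials

/-- The constants `A` and `B` serve both input models, which differ only in the set `U` of
admissible test points: the whole space in the first model and the sphere ‖t‖² = τ in the second,
where the complement of `U` has small probability. -/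
theorem polynomialApproximationBarrier {k : ∀ d : ℕ, E d → E d → ℝ} {β : ℝ} (hβ : 0 < β)
    (hkc : ∀ d, Continuous fun p : E d × E d => k d p.1 p.2)
    (hkp : ∀ d, IsPSDKernelOn Set.univ (k d)) (heb : HasEigenvalueBound k ⌊2 / β⌋₊)
    (htay : HasTaylorApproximation k ⌊2 / β⌋₊) (hmom : HasKernelMoments k) :
    PolynomialApproximationBarrier.{u} k β := by
  intro c hc d S hS hS1 hτ P hP Q m hQ ρ hρ hρi ⟨F, hF⟩ lam hlam Ω _ μ _ x hx hind hmap
  obtain ⟨c', hP'⟩ := hP.exists_isSubgaussianLaw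
  have hm : 2 / β < (⌊2 / β⌋₊ : ℝ) + 1 := Nat.lt_floor_add_one _
  have hτ1 : ∀ᶠ n in atTop, 1 ≤ (S n).trace := by
    have h1 : Tendsto (fun n : ℕ => effDim (S n) / (n : ℝ) ^ β * (n : ℝ) ^ β) atTop atTop :=
      hτ.pos_mul_atTop hc ((tendsto_rpow_atTop hβ).comp tendsto_natCast_atTop_atTop)
    filter_upwards [h1.eventually_ge_atTop 1, eventually_ge_atTop 1] with n hn hn1
    have : (0 : ℝ) < (n : ℝ) ^ β := Real.rpow_pos_of_pos (by exact_mod_cast hn1) _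
    rwa [div_mul_cancel₀ _ this.ne', effDim_eq (hS1 n)] at hn
  obtain ⟨C, ε, hC, hε, hε1, happ⟩ := htay.exists_approximableOn
  set A : ℕ → ℝ := fun q => 8 ^ q * covConst c' q + 1 with hA
  have hcov := covConst_nonneg c'
  have hA0 : ∀ q, 0 ≤ A q := fun q => by have := hcov q; positivity
  set B : ℝ := Real.exp (16 * c') + Real.exp 8 with hB
  obtain ⟨C', hC', hmom⟩ := hmom A B hA0
  have hmomC : ∀ (d : ℕ) (Q : Measure (E d)) (τ : ℝ), 1 ≤ τ → IsConcentrated A B Q τ →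
      HasMomentBound (C + C') (k d) Q τ := fun d Q τ h1 h2 z hz =>
    (hmom d Q τ h1 h2 z hz).trans (ENNReal.ofReal_le_ofReal (by linarith))
  have happC : ∀ (d : ℕ) (τ : ℝ) (M : ℕ) (U : Set (E d)), ApproximableOn C ε ⌊2 / β⌋₊ M (k d) U τ →
      0 < τ → ApproximableOn (C + C') ε ⌊2 / β⌋₊ M (k d) U τ := by
    intro d τ M U h hτ0 z hz
    obtain ⟨p, hp, h1, h2⟩ := h z hz
    refine ⟨p, hp, fun t => (h1 t).trans ?_, fun δ hδ t ht h3 h4 => (h2 δ hδ t ht h3 h4).trans ?_⟩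
    · gcongr
      linarith
    · have hδ0 : 0 ≤ δ := (abs_nonneg _).trans h3
      gcongr
      linarith
  have hτ' : Tendsto (fun n : ℕ => (fun n => effDim (S n)) n / (n : ℝ) ^ β) atTop (𝓝 c) := hτ
  rcases hQ with ⟨hQ, rfl⟩ | ⟨hQ, rfl⟩
  · have hconc : ∀ᶠ n in atTop, IsConcentrated A B (Q n) (effDim (S n)) := by
      filter_upwards [hτ1] with n hn
      rw [hQ n, effDim_eq (hS1 n)]
      refine (hP'.isConcentrated_covLaw (hS n) (hS1 n) hn).mono (by linarith) (fun q => ?_)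
        (by rw [hB]; linarith [Real.exp_pos 8])
      have h8 : (1 : ℝ) ≤ 8 ^ q := one_le_pow₀ (by norm_num)
      have := hcov q
      simp only [hA]
      nlinarith
    refine barrierConclusion_of_ae (hconc.mono fun n hn => hn.1) hρ hF ?_
    refine ae_exists_polynomial hkc hkp heb hβ hm hc hτ' hA0 hconc (C := C + C') (by positivity)
      hε hε1 (fun _ => Set.univ) (fun _ => MeasurableSet.univ) (by simp) ?_ ?_ hρ hρi hF hlam hx
      hind hmap
    · filter_upwards [hτ1] with n hn
      rw [effDim_eq (hS1 n)]
      exact happC _ _ _ _ (happ _ _ (by linarith)).1 (by linarith)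
    · filter_upwards [hτ1, hconc] with n hn hn2
      exact hmomC _ _ _ (by rwa [effDim_eq (hS1 n)]) hn2
  · have hconc : ∀ᶠ n in atTop, IsConcentrated A B (Q n) (effDim (S n)) := by
      filter_upwards [hτ1] with n hn
      rw [hQ n, effDim_eq (hS1 n)]
      exact (hP'.isConcentrated_sphereLaw (hS n) (hS1 n) hn).mono (by linarith)
        (fun q => le_rfl) (by rw [hB]; linarith [Real.exp_pos (16 * (c' : ℝ))])
    refine barrierConclusion_of_ae (hconc.mono fun n hn => hn.1) hρ hF ?_
    refine ae_exists_polynomial hkc hkp heb hβ hm hc hτ' hA0 hconc (C := C + C') (by positivity)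
      hε hε1 (fun n => {t | ‖t‖ ^ 2 = effDim (S n)})
      (fun n => measurableSet_eq_fun (f := fun t : E (d n) => ‖t‖ ^ 2) (by fun_prop) (by fun_prop))
      ?_ ?_ ?_ hρ hρi hF hlam hx hind hmap
    · filter_upwards [hτ1] with n hn q hq
      rw [hQ n, effDim_eq (hS1 n)]
      refine (hP'.sphereLaw_norm (hS n) (hS1 n) hn hq).trans (ENNReal.ofReal_le_ofReal ?_)
      have h48 : (4 : ℝ) ^ q ≤ 8 ^ q := by gcongr; norm_num
      have := hcov q
      have hn0 : 0 < (S n).trace := by linarith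
      simp only [hA]
      gcongr
      nlinarith
    · filter_upwards [hτ1] with n hn
      rw [effDim_eq (hS1 n)]
      exact happC _ _ _ _ (happ _ _ (by linarith)).2 (by linarith)
    · filter_upwards [hτ1, hconc] with n hn hn2
      exact hmomC _ _ _ (by rwa [effDim_eq (hS1 n)]) hn2

/-! ### Tools for concrete kernels -/

/-- On the annulus the norms are at most 2, so the squared norm is Lipschitz with constant 4 in
every dimension; `h` contributes its local Lipschitz constant at 1. -/
theorem lipschitzOnWith_diag {k : ∀ d : ℕ, E d → E d → ℝ} {h : ℝ → ℝ}
    (hk : ∀ d (x : E d), x ≠ 0 → k d x x = h (‖x‖ ^ 2)) (hh : ContDiffAt ℝ 1 h 1) :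
    ∃ δ : ℝ, 0 < δ ∧ ∃ K : ℝ≥0, ∀ d : ℕ,
      LipschitzOnWith K (fun p : E d × E d => k d p.1 p.2)
        ((fun x : E d => (x, x)) '' annulus d δ) := by
  obtain ⟨K, t, ht, hK⟩ := hh.exists_lipschitzOnWith
  obtain ⟨ε, hε, hb⟩ := Metric.mem_nhds_iff.1 ht
  refine ⟨min (ε / 2) (1 / 2), by positivity, K * 4, fun d => ?_⟩
  have hmem : ∀ x ∈ annulus d (min (ε / 2) (1 / 2)), x ≠ 0 ∧ ‖x‖ ^ 2 ∈ t ∧ ‖x‖ ≤ 2 := by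
    intro x hx
    have h1 := hx.1
    have h2 := hx.2
    have h3 := min_le_left (ε / 2) (1 / 2)
    have h4 := min_le_right (ε / 2) (1 / 2)
    refine ⟨?_, hb ?_, ?_⟩
    · rintro rfl
      rw [norm_zero] at h1
      linarith
    · rw [Metric.mem_ball, Real.dist_eq, abs_lt]
      constructor <;> linarith
    · nlinarith [norm_nonneg x]
  rw [lipschitzOnWith_iff_dist_le_mul]
  rintro _ ⟨x, hx, rfl⟩ _ ⟨y, hy, rfl⟩
  obtain ⟨hx0, hxt, hx2⟩ := hmem x hx
  obtain ⟨hy0, hyt, hy2⟩ := hmem y hy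
  simp only [hk d x hx0, hk d y hy0]
  refine (hK.dist_le_mul _ hxt _ hyt).trans ?_
  rw [Prod.dist_eq, max_self, NNReal.coe_mul, mul_assoc]
  gcongr
  rw [Real.dist_eq, sq_sub_sq, abs_mul, dist_eq_norm, abs_of_nonneg (by positivity)]
  have h5 := abs_norm_sub_norm_le x y
  have h6 : ‖x‖ + ‖y‖ ≤ 4 := by linarith
  exact mul_le_mul h6 h5 (abs_nonneg _) (by norm_num)

/-- The term of order `j₀` is the one to be removed; its coefficient has to factorise, while the
other terms stay positive semi-definite. -/
theorem HasEigenvalueBound.of_hasSum {k : ∀ d : ℕ, E d → E d → ℝ} {m j₀ : ℕ} (hj : m < j₀)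
    {gc : ℕ → ℝ → ℝ → ℝ} (hgc : ∀ j, IsPSDKernelOn (Set.Ici 0) (gc j))
    (hk : ∀ d : ℕ, ∀ x ∈ annulus d (1 / 2), ∀ x' ∈ annulus d (1 / 2),
      HasSum (fun j : ℕ => gc j (‖x‖ ^ 2) (‖x'‖ ^ 2) * ⟪x, x'⟫ ^ j) (k d x x'))
    {φ : ℝ → ℝ} {lo hi : ℝ} (hlo : 0 < lo)
    (hφ : ∀ u, 1 / 2 ≤ u → u ≤ 3 / 2 → lo ≤ φ u ∧ φ u ≤ hi)
    (hgφ : ∀ u v, 1 / 2 ≤ u → 1 / 2 ≤ v → gc j₀ u v = φ u * φ v) : HasEigenvalueBound k m := by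
  have hann : ∀ d, ∀ x ∈ annulus d (1 / 2), 1 / 2 ≤ ‖x‖ ^ 2 ∧ ‖x‖ ^ 2 ≤ 3 / 2 := by
    intro d x hx
    have h1 := hx.1
    have h2 := hx.2
    constructor <;> linarith
  have h1 := hφ 1 (by norm_num) (by norm_num)
  refine HasEigenvalueBound.of_sub hj hlo (h1.1.trans h1.2) (fun d x => φ (‖x‖ ^ 2))
    (fun d x hx => hφ _ (hann d x hx).1 (hann d x hx).2) fun d => ?_
  have h2 := isPSDKernelOn_sub_of_hasSum (s := annulus d (1 / 2)) (k := k d)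
    (f := fun j x x' => gc j (‖x‖ ^ 2) (‖x'‖ ^ 2) * ⟪x, x'⟫ ^ j) (fun j => ?_) (hk d) j₀
  · refine h2.congr fun x hx y hy => ?_
    rw [hgφ _ _ (hann d x hx).1 (hann d y hy).1]
  · exact ((hgc j).comp (f := fun x : E d => ‖x‖ ^ 2) fun x _ => sq_nonneg ‖x‖).mul
      ((isPSDKernelOn_inner _).pow j)

/-! ### Taylor approximation in one variable -/

/-- Induction on the order: the derivative of the remainder of `F 0` is the remainder of `F 1` of
one order less, and the mean value inequality yields another factor |s - s₀|. No factorial is gained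
in the error, and none is needed. -/
theorem abs_sub_taylor_le {F : ℕ → ℝ → ℝ} {S : Set ℝ} (hS : Convex ℝ S) {C : ℝ} (m : ℕ)
    (hF : ∀ i ≤ m, ∀ s ∈ S, HasDerivAt (F i) (F (i + 1) s) s)
    (hC : ∀ s ∈ S, |F (m + 1) s| ≤ C) {s₀ s : ℝ} (hs₀ : s₀ ∈ S) (hs : s ∈ S) :
    |F 0 s - ∑ i ∈ Finset.range (m + 1), F i s₀ / i.factorial * (s - s₀) ^ i| ≤
      C * |s - s₀| ^ (m + 1) := by
  induction m generalizing F s with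
  | zero =>
    have h := hS.norm_image_sub_le_of_norm_hasDerivWithin_le (f := F 0) (f' := F 1) (C := C)
      (fun x hx => (hF 0 le_rfl x hx).hasDerivWithinAt) hC hs₀ hs
    simpa using h
  | succ m ih =>
    have hC0 : 0 ≤ C := (abs_nonneg _).trans (hC s₀ hs₀)
    have hI : ∀ r ∈ Set.uIcc s₀ s, r ∈ S := fun r hr => hS.segment_subset hs₀ hs (by
      rwa [segment_eq_uIcc])
    have hd : ∀ r ∈ Set.uIcc s₀ s, HasDerivAt
        (fun r => F 0 r - ∑ i ∈ Finset.range (m + 2), F i s₀ / i.factorial * (r - s₀) ^ i)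
        (F 1 r - ∑ i ∈ Finset.range (m + 1), F (i + 1) s₀ / i.factorial * (r - s₀) ^ i) r := by
      intro r hr
      refine (hF 0 (Nat.zero_le _) r (hI r hr)).sub ?_
      have h1 : ∀ i ∈ Finset.range (m + 2), HasDerivAt
          (fun r => F i s₀ / i.factorial * (r - s₀) ^ i)
          (F i s₀ / i.factorial * (i * (r - s₀) ^ (i - 1))) r := by
        intro i _
        have h2 := (((hasDerivAt_id r).sub_const s₀).pow i).const_mul (F i s₀ / i.factorial)
        simpa using h2
      refine (HasDerivAt.fun_sum h1).congr_deriv ?_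
      rw [Finset.sum_range_succ']
      simp only [Nat.cast_zero, zero_mul, mul_zero, add_zero, Nat.add_sub_cancel]
      refine Finset.sum_congr rfl fun i _ => ?_
      rw [Nat.factorial_succ]
      push_cast
      field_simp
    have hb : ∀ r ∈ Set.uIcc s₀ s,
        ‖F 1 r - ∑ i ∈ Finset.range (m + 1), F (i + 1) s₀ / i.factorial * (r - s₀) ^ i‖ ≤
          C * |s - s₀| ^ (m + 1) := by
      intro r hr
      refine (ih (F := fun i => F (i + 1)) (fun i hi => hF (i + 1) (by omega)) hC
        (hI r hr)).trans ?_
      have := Set.abs_sub_left_of_mem_uIcc hr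
      gcongr
    have h := (convex_uIcc s₀ s).norm_image_sub_le_of_norm_hasDerivWithin_le
      (fun r hr => (hd r hr).hasDerivWithinAt) hb Set.left_mem_uIcc Set.right_mem_uIcc
    have h0 : F 0 s₀ - ∑ i ∈ Finset.range (m + 2), F i s₀ / i.factorial * (s₀ - s₀) ^ i = 0 := by
      rw [Finset.sum_range_succ']
      simp
    rw [h0, sub_zero] at h
    rw [pow_succ, ← mul_assoc]
    exact h

/-- Compactness makes the constant uniform in the base point; the sum of the bounds for the single
derivatives serves all orders at once. -/
theorem exists_taylor_bound {f : ℝ → ℝ} (hf : ContDiffOn ℝ ((⊤ : ℕ∞) : WithTop ℕ∞) f (Set.Ioi 0)) (m : ℕ) {lo hi : ℝ}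
    (hlo : 0 < lo) : ∃ C : ℝ, 0 ≤ C ∧ (∀ i ≤ m, ∀ s ∈ Set.Icc lo hi, |iteratedDeriv i f s| ≤ C) ∧
      ∀ s₀ ∈ Set.Icc lo hi, ∀ s ∈ Set.Icc lo hi,
      |f s - ∑ i ∈ Finset.range (m + 1), iteratedDeriv i f s₀ / i.factorial * (s - s₀) ^ i| ≤
        C * |s - s₀| ^ (m + 1) := by
  have hsub : Set.Icc lo hi ⊆ Set.Ioi 0 := fun s hs => hlo.trans_le hs.1
  have hd : ∀ i, ∀ s ∈ Set.Ioi (0 : ℝ),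
      HasDerivAt (iteratedDeriv i f) (iteratedDeriv (i + 1) f s) s := by
    intro i s hs
    rw [iteratedDeriv_succ]
    have h1 := (hf.differentiableOn_iteratedDerivWithin (m := i)
      (by exact_mod_cast ENat.natCast_lt_top i) isOpen_Ioi.uniqueDiffOn).congr
        fun x hx => (iteratedDerivWithin_of_isOpen isOpen_Ioi hx).symm
    exact ((h1 s hs).differentiableAt (Ioi_mem_nhds hs)).hasDerivAt
  have hb : ∀ i, ∃ C, ∀ s ∈ Set.Icc lo hi, |iteratedDeriv i f s| ≤ C := fun i =>
    (isCompact_Icc.exists_bound_of_continuousOn fun s hs =>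
      (hd i s (hsub hs)).continuousAt.continuousWithinAt)
  choose B hB using hb
  refine ⟨∑ i ∈ Finset.range (m + 2), |B i|, by positivity, fun i hi s hs => ?_,
    fun s₀ hs₀ s hs => ?_⟩
  · refine ((hB i s hs).trans (le_abs_self _)).trans ?_
    exact Finset.single_le_sum (f := fun i => |B i|) (fun _ _ => abs_nonneg _)
      (Finset.mem_range.2 (by omega))
  · have h := abs_sub_taylor_le (F := fun i => iteratedDeriv i f) (convex_Icc lo hi) m
      (fun i _ s hs => hd i s (hsub hs)) (hB (m + 1)) hs₀ hs
    simp only [iteratedDeriv_zero] at h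
    refine h.trans ?_
    gcongr
    refine (le_abs_self _).trans ?_
    exact Finset.single_le_sum (f := fun i => |B i|) (fun _ _ => abs_nonneg _)
      (Finset.mem_range.2 (by omega))

/-! ### The exponential inner product kernel -/

theorem expKernel_isRotationallyInvariantKernel : IsRotationallyInvariantKernel expKernel where
  continuous d := by unfold expKernel; fun_prop
  posSemidef d := (isPSDKernelOn_inner (s := Set.univ) (F := E d)).exp
  exists_profile := ⟨fun _ _ c => Real.exp c, fun _ _ _ => rfl⟩

theorem hasSum_expKernel (d : ℕ) (x x' : E d) :
    HasSum (fun j : ℕ => ((j.factorial : ℝ)⁻¹) * ⟪x, x'⟫ ^ j) (expKernel d x x') := by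
  simpa only [div_eq_inv_mul, expKernel] using hasSum_real_exp ⟪x, x'⟫

theorem expKernel_satisfiesKernelAssumptions (β : ℝ) :
    SatisfiesKernelAssumptions expKernel β fun j _ _ => (j.factorial : ℝ)⁻¹ where
  rotInv := expKernel_isRotationallyInvariantKernel
  powerSeries := ⟨1, one_pos, fun d x _ x' _ => hasSum_expKernel d x x'⟩
  coeffPSD j := isPSDKernelOn_const (by positivity)
  lipschitz := lipschitzOnWith_diag (h := Real.exp)
    (fun d x _ => by rw [expKernel, real_inner_self_eq_norm_sq]) Real.contDiff_exp.contDiffAt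
  contDiff _ _ := contDiffAt_const
  exists_pos := ⟨⌊2 / β⌋₊ + 1, Nat.lt_succ_self _, by positivity⟩

theorem expKernel_hasEigenvalueBound (m : ℕ) : HasEigenvalueBound expKernel m := by
  have h0 : (0 : ℝ) < ((m + 1).factorial : ℝ)⁻¹ := by positivity
  refine HasEigenvalueBound.of_hasSum (gc := fun j _ _ => (j.factorial : ℝ)⁻¹)
    (φ := fun _ => Real.sqrt ((m + 1).factorial : ℝ)⁻¹)
    (lo := Real.sqrt ((m + 1).factorial : ℝ)⁻¹) (Nat.lt_succ_self m)
    (fun j => isPSDKernelOn_const (by positivity)) (fun d x _ x' _ => hasSum_expKernel d x x')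
    (Real.sqrt_pos.2 h0) (fun u _ _ => ⟨le_rfl, le_rfl⟩) fun u v _ _ => ?_
  exact (Real.mul_self_sqrt h0.le).symm

theorem expKernel_hasTaylorApproximation (m : ℕ) : HasTaylorApproximation expKernel m := by
  refine ⟨{0} ×ˢ Finset.range (m + 1), fun p _ => (p.2.factorial : ℝ)⁻¹,
    (m + 1).succ / ((m + 1).factorial * (m + 1 : ℕ)), 1, fun p hp => ?_, by positivity, one_pos,
    le_rfl, fun p _ => ⟨_, fun v _ => le_rfl⟩, fun d t z δ _ hδ _ h => ?_⟩
  · simp only [Finset.mem_product, Finset.mem_singleton, Finset.mem_range] at hp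
    omega
  · rw [Finset.sum_product]
    simp only [Finset.sum_singleton, pow_zero, one_mul]
    have h1 := Real.exp_bound (h.trans hδ) (n := m + 1) (Nat.succ_pos m)
    simp only [div_eq_inv_mul (_ ^ _)] at h1
    refine h1.trans ?_
    rw [mul_comm]
    gcongr

/-- The fourth power of the kernel is the exponential in `exp_moment`, hence the factor 4 there. -/
theorem expKernel_hasKernelMoments : HasKernelMoments expKernel := by
  intro A B _
  refine ⟨max B 0, le_max_right _ _, fun d Q τ _ hQ z hz => ?_⟩
  refine le_trans (le_of_eq ?_) ((hQ.exp_moment z hz).trans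
    (ENNReal.ofReal_le_ofReal (le_max_left _ _)))
  refine lintegral_congr fun t => ?_
  rw [expKernel, Real.enorm_eq_ofReal (Real.exp_pos _).le,
    ← ENNReal.ofReal_pow (Real.exp_pos _).le, ← Real.exp_nat_mul, real_inner_smul_left,
    div_eq_inv_mul]
  norm_num

theorem expKernel_barrier {β : ℝ} (hβ : 0 < β) :
    PolynomialApproximationBarrier.{u} expKernel β :=
  polynomialApproximationBarrier hβ expKernel_isRotationallyInvariantKernel.continuous
    expKernel_isRotationallyInvariantKernel.posSemidef (expKernel_hasEigenvalueBound _)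
    (expKernel_hasTaylorApproximation _) expKernel_hasKernelMoments

/-! ### The Gaussian kernel with bandwidth -/

theorem gaussian_eq (w : ℝ) {d : ℕ} (x x' : E d) : Real.exp (-(w * ‖x - x'‖ ^ 2)) =
    Real.exp (-(w * ‖x‖ ^ 2)) * Real.exp (-(w * ‖x'‖ ^ 2)) * Real.exp (2 * w * ⟪x, x'⟫) := by
  rw [← Real.exp_add, ← Real.exp_add, norm_sub_sq_real]
  ring_nf

/-- The coefficients of the expansion of the Gaussian kernel. -/
noncomputable def gaussianCoeff (w : ℝ) (j : ℕ) (u v : ℝ) : ℝ :=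
  Real.exp (-(w * u)) * Real.exp (-(w * v)) * ((2 * w) ^ j / j.factorial)

theorem hasSum_gaussian (w : ℝ) {d : ℕ} (x x' : E d) :
    HasSum (fun j : ℕ => gaussianCoeff w j (‖x‖ ^ 2) (‖x'‖ ^ 2) * ⟪x, x'⟫ ^ j)
      (Real.exp (-(w * ‖x - x'‖ ^ 2))) := by
  rw [gaussian_eq]
  have h := (hasSum_real_exp (2 * w * ⟪x, x'⟫)).mul_left
    (Real.exp (-(w * ‖x‖ ^ 2)) * Real.exp (-(w * ‖x'‖ ^ 2)))
  refine h.congr_fun fun j => ?_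
  rw [gaussianCoeff, mul_pow]
  ring

theorem gaussianCoeff_psd {w : ℝ} (hw : 0 ≤ w) (j : ℕ) (s : Set ℝ) :
    IsPSDKernelOn s (gaussianCoeff w j) :=
  (isPSDKernelOn_rankOne fun u => Real.exp (-(w * u))).mul
    (isPSDKernelOn_const (by positivity))

theorem gaussian_psd {w : ℝ} (hw : 0 ≤ w) (d : ℕ) :
    IsPSDKernelOn Set.univ fun x x' : E d => Real.exp (-(w * ‖x - x'‖ ^ 2)) := by
  refine isPSDKernelOn_of_hasSum (fun j => ?_) fun x _ x' _ => hasSum_gaussian w x x'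
  exact ((gaussianCoeff_psd hw j Set.univ).comp (f := fun x : E d => ‖x‖ ^ 2)
    (Set.mapsTo_univ _ _)).mul ((isPSDKernelOn_inner _).pow j)

/-! ### The `α`-exponential kernels -/

/-- The removed term is the one of order m + 1. The constants are uniform in the bandwidth w ∈ [1,
2], so that the bound can be integrated over `w`: on the annulus w‖x‖² ≤ 3, and 1 ≤ (2w)^(m+1) ≤
4^(m+1). -/
theorem gaussian_eigenvalue_bound (m : ℕ) : ∃ γ : ℝ, 0 < γ ∧ ∃ ε : ℝ, 0 < ε ∧
    ∀ w ∈ Set.Icc (1 : ℝ) 2, ∀ (d n : ℕ) (δ : ℝ) (z : Fin n → E d), δ ≤ ε →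
      n * δ ^ (m + 1) ≤ ε → AlmostOrthonormal δ z → ∀ c : Fin n → ℝ,
      γ * ∑ i, c i ^ 2 ≤ ∑ i, ∑ j, c i * c j * Real.exp (-(w * ‖z i - z j‖ ^ 2)) := by
  set lo : ℝ := Real.exp (-3) * Real.sqrt (1 / (m + 1).factorial) with hlo_def
  set hi : ℝ := Real.sqrt (4 ^ (m + 1) / (m + 1).factorial) with hhi_def
  have hlo : 0 < lo := by positivity
  have hlohi : lo ≤ hi := by
    rw [hlo_def, hhi_def, ← one_mul (Real.sqrt (4 ^ (m + 1) / (m + 1).factorial))]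
    refine mul_le_mul (Real.exp_le_one_iff.2 (by norm_num)) (Real.sqrt_le_sqrt ?_)
      (Real.sqrt_nonneg _) zero_le_one
    gcongr
    exact one_le_pow₀ (by norm_num)
  have hhi : 0 < hi := hlo.trans_le hlohi
  refine ⟨lo ^ 2 * (1 / 2) ^ (m + 1) / 2, by positivity,
    min (1 / 2) (lo ^ 2 * (1 / 2) ^ (m + 1) / (2 * hi ^ 2)), by positivity,
    fun w hw d n δ z hδ hn hz c => ?_⟩
  have hw0 : 0 ≤ w := by linarith [hw.1]
  refine eigenvalue_bound_of_sub (k := fun x x' => Real.exp (-(w * ‖x - x'‖ ^ 2)))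
    (φ := fun x => Real.exp (-(w * ‖x‖ ^ 2)) * Real.sqrt ((2 * w) ^ (m + 1) / (m + 1).factorial))
    (Nat.lt_succ_self m) hlo hlohi (fun x hx => ⟨?_, ?_⟩) ?_ z (hδ.trans (min_le_left _ _))
    (hn.trans (min_le_right _ _)) hz c
  · have h1 : ‖x‖ ^ 2 ≤ 1 + 1 / 2 := hx.2
    have h2 : w * ‖x‖ ^ 2 ≤ 2 * (1 + 1 / 2) := mul_le_mul hw.2 h1 (by positivity) (by norm_num)
    rw [hlo_def]
    gcongr
    · linarith
    · exact one_le_pow₀ (by linarith [hw.1])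
  · rw [hhi_def, ← one_mul (Real.sqrt (4 ^ (m + 1) / (m + 1).factorial))]
    have h1 : 0 ≤ w * ‖x‖ ^ 2 := by positivity
    refine mul_le_mul (Real.exp_le_one_iff.2 (by linarith)) (Real.sqrt_le_sqrt ?_)
      (Real.sqrt_nonneg _) zero_le_one
    have := hw.2
    gcongr
    linarith
  · refine (isPSDKernelOn_sub_of_hasSum (s := annulus d (1 / 2))
      (k := fun x x' => Real.exp (-(w * ‖x - x'‖ ^ 2)))
      (f := fun j x x' => gaussianCoeff w j (‖x‖ ^ 2) (‖x'‖ ^ 2) * ⟪x, x'⟫ ^ j)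
      (fun j => ?_) (fun x _ x' _ => hasSum_gaussian w x x') (m + 1)).congr fun x _ y _ => ?_
    · exact ((gaussianCoeff_psd hw0 j Set.univ).comp (f := fun x : E d => ‖x‖ ^ 2)
        (Set.mapsTo_univ _ _)).mul ((isPSDKernelOn_inner _).pow j)
    · have h1 : 0 ≤ (2 * w) ^ (m + 1) / ((m + 1).factorial : ℝ) := by positivity
      rw [gaussianCoeff, Nat.succ_eq_add_one]
      linear_combination (Real.exp (-(w * ‖x‖ ^ 2)) * Real.exp (-(w * ‖y‖ ^ 2)) *
        ⟪x, y⟫ ^ (m + 1)) * Real.mul_self_sqrt h1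

/-- The integrand in the Lévy–Khintchine representation of `s ↦ s ^ a`. -/
noncomputable def levyFun (a s w : ℝ) : ℝ := (1 - Real.exp (-(w * s))) * w ^ (-1 - a)

theorem measurable_levyFun (a s : ℝ) : Measurable (levyFun a s) := by
  unfold levyFun
  fun_prop

theorem levyFun_nonneg (a : ℝ) {s w : ℝ} (hs : 0 ≤ s) (hw : 0 ≤ w) : 0 ≤ levyFun a s w :=
  mul_nonneg (sub_nonneg.2 (Real.exp_le_one_iff.2 (by linarith [mul_nonneg hw hs])))
    (Real.rpow_nonneg hw _)

section Levy

variable {a : ℝ}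

/-- Near 0 the integrand is at most s w^(-a), as 1 - exp(-ws) ≤ ws; near ∞ it is at most w^(-1-a).
-/
theorem integrableOn_levyFun (ha : 0 < a) (ha1 : a < 1) {s : ℝ} (hs : 0 ≤ s) :
    IntegrableOn (levyFun a s) (Set.Ioi 0) := by
  rw [← Set.Ioc_union_Ioi_eq_Ioi zero_le_one]
  refine IntegrableOn.union ?_ ?_
  · have h1 : IntegrableOn (fun w : ℝ => s * w ^ (-a)) (Set.Ioc 0 1) :=
      ((intervalIntegrable_iff_integrableOn_Ioc_of_le zero_le_one).1
        (intervalIntegral.intervalIntegrable_rpow' (by linarith))).const_mul s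
    refine Integrable.mono' h1 (measurable_levyFun a s).aestronglyMeasurable ?_
    refine (ae_restrict_iff' measurableSet_Ioc).2 (ae_of_all _ fun w hw => ?_)
    rw [Real.norm_of_nonneg (levyFun_nonneg a hs hw.1.le), levyFun]
    have h2 : 1 - Real.exp (-(w * s)) ≤ w * s := by linarith [Real.add_one_le_exp (-(w * s))]
    calc (1 - Real.exp (-(w * s))) * w ^ (-1 - a) ≤ w * s * w ^ (-1 - a) := by
          gcongr
          exact Real.rpow_nonneg hw.1.le _
      _ = s * (w ^ (1 : ℝ) * w ^ (-1 - a)) := by rw [Real.rpow_one]; ring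
      _ = s * w ^ (-a) := by rw [← Real.rpow_add hw.1]; ring_nf
  · refine Integrable.mono' (integrableOn_Ioi_rpow_of_lt (a := -1 - a) (by linarith) one_pos)
      (measurable_levyFun a s).aestronglyMeasurable ?_
    refine (ae_restrict_iff' measurableSet_Ioi).2 (ae_of_all _ fun w hw => ?_)
    have hw0 : (0 : ℝ) ≤ w := zero_le_one.trans (le_of_lt hw)
    rw [Real.norm_of_nonneg (levyFun_nonneg a hs hw0), levyFun]
    refine mul_le_of_le_one_left (Real.rpow_nonneg hw0 _) ?_
    linarith [Real.exp_pos (-(w * s))]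

/-- The part of the Lévy–Khintchine integral over `S`. -/
noncomputable def levyPart (a : ℝ) (S : Set ℝ) (s : ℝ) : ℝ := ∫ w in S, levyFun a s w

theorem levyPart_zero (a : ℝ) (S : Set ℝ) : levyPart a S 0 = 0 := by
  simp [levyPart, levyFun]

/-- Scaling: substitute sw for w. -/
theorem levyPart_Ioi (ha : 0 < a) {s : ℝ} (hs : 0 ≤ s) :
    levyPart a (Set.Ioi 0) s = s ^ a * levyPart a (Set.Ioi 0) 1 := by
  rcases hs.eq_or_lt with rfl | hs
  · rw [levyPart_zero, Real.zero_rpow ha.ne', zero_mul]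
  · have h1 : ∀ w ∈ Set.Ioi (0 : ℝ), levyFun a s w = s ^ (1 + a) * levyFun a 1 (s * w) := by
      intro w hw
      rw [levyFun, levyFun, Real.mul_rpow hs.le (le_of_lt hw), mul_one, mul_comm s w]
      have h2 : s ^ (1 + a) * s ^ (-1 - a) = 1 := by
        rw [← Real.rpow_add hs]
        ring_nf
        exact Real.rpow_zero s
      linear_combination (-(1 - Real.exp (-(w * s))) * w ^ (-1 - a)) * h2
    rw [levyPart, setIntegral_congr_fun measurableSet_Ioi h1, integral_const_mul,
      integral_comp_mul_left_Ioi (levyFun a 1) 0 hs, mul_zero, smul_eq_mul, ← mul_assoc,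
      Real.rpow_add hs, Real.rpow_one, levyPart]
    field_simp

theorem levyPart_one_pos (ha : 0 < a) (ha1 : a < 1) : 0 < levyPart a (Set.Ioi 0) 1 := by
  rw [levyPart, setIntegral_pos_iff_support_of_nonneg_ae
    ((ae_restrict_iff' measurableSet_Ioi).2 (ae_of_all _ fun w hw =>
      levyFun_nonneg a zero_le_one (le_of_lt hw))) (integrableOn_levyFun ha ha1 zero_le_one)]
  have h1 : Set.Ioi (0 : ℝ) ⊆ Function.support (levyFun a 1) ∩ Set.Ioi 0 := by
    refine fun w hw => ⟨?_, hw⟩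
    have hw0 : (0 : ℝ) < w := hw
    refine (mul_pos (sub_pos.2 ((Real.exp_lt_exp.2 (by linarith)).trans_eq Real.exp_zero)) (Real.rpow_pos_of_pos hw _)).ne'
  refine lt_of_lt_of_le ?_ (measure_mono h1)
  simp

theorem isPSDKernelOn_setIntegral {X : Type*} {s : Set X} {S : Set ℝ} (hS : MeasurableSet S)
    {f : ℝ → X → X → ℝ} (hf : ∀ w ∈ S, IsPSDKernelOn s (f w))
    (hi : ∀ x y, IntegrableOn (fun w => f w x y) S) :
    IsPSDKernelOn s fun x y => ∫ w in S, f w x y := by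
  rw [isPSDKernelOn_iff]
  refine ⟨fun x hx y hy => setIntegral_congr_fun hS fun w hw => (hf w hw).symm hx hy,
    fun n x hx c => ?_⟩
  have h1 : ∑ i, ∑ j, c i * c j * ∫ w in S, f w (x i) (x j) =
      ∫ w in S, ∑ i, ∑ j, c i * c j * f w (x i) (x j) := by
    rw [integral_finsetSum _ fun i _ => integrable_finsetSum _ fun j _ => (hi _ _).const_mul _]
    refine Finset.sum_congr rfl fun i _ => ?_
    rw [integral_finsetSum _ fun j _ => (hi _ _).const_mul _]
    simp only [integral_const_mul]
  rw [h1]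
  exact setIntegral_nonneg hS fun w hw => (hf w hw).sum_nonneg hx c

/-- For fixed `w`, with p(x) = exp(-w‖x‖²), the integrand is w^(-1-a) times (1 - p(x))(1 - p(y)) +
p(x) p(y) (exp(2w⟨x, y⟩) - 1). The last factor is the exponential series without its constant term,
hence positive semi-definite. -/
theorem isPSDKernelOn_levyPart (ha : 0 < a) (ha1 : a < 1) {S : Set ℝ} (hS : MeasurableSet S)
    (hS0 : S ⊆ Set.Ioi 0) (d : ℕ) : IsPSDKernelOn Set.univ fun x y : E d =>
      levyPart a S (‖x‖ ^ 2) + levyPart a S (‖y‖ ^ 2) - levyPart a S (‖x - y‖ ^ 2) := by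
  have hi : ∀ x : E d, IntegrableOn (levyFun a (‖x‖ ^ 2)) S := fun x =>
    (integrableOn_levyFun ha ha1 (sq_nonneg _)).mono_set hS0
  refine (isPSDKernelOn_setIntegral (f := fun w (x y : E d) => levyFun a (‖x‖ ^ 2) w +
    levyFun a (‖y‖ ^ 2) w - levyFun a (‖x - y‖ ^ 2) w) hS (fun w hw => ?_) fun x y =>
      ((hi x).add (hi y)).sub (hi (x - y))).congr fun x _ y _ => ?_
  · have hw0 : 0 ≤ w := le_of_lt (hS0 hw)
    have h1 : IsPSDKernelOn Set.univ fun x y : E d => Real.exp (2 * w * ⟪x, y⟫) - 1 := by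
      refine (isPSDKernelOn_sub_of_hasSum (f := fun j (x y : E d) =>
        (2 * w) ^ j / j.factorial * ⟪x, y⟫ ^ j) (k := fun x y => Real.exp (2 * w * ⟪x, y⟫))
        (fun j => ((isPSDKernelOn_inner _).pow j).const_mul (by positivity))
        (fun x _ y _ => ?_) 0).congr fun x _ y _ => by simp
      have h2 := hasSum_real_exp (2 * w * ⟪x, y⟫)
      simpa only [mul_pow _ ⟪x, y⟫, mul_div_right_comm] using h2
    refine ((((isPSDKernelOn_rankOne fun x : E d => Real.exp (-(w * ‖x‖ ^ 2))).mul h1).add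
      (isPSDKernelOn_rankOne fun x : E d => 1 - Real.exp (-(w * ‖x‖ ^ 2)))).const_mul
        (Real.rpow_nonneg hw0 (-1 - a))).congr fun x _ y _ => ?_
    simp only [levyFun, gaussian_eq w x y]
    ring
  · rw [integral_sub, integral_add]
    · rfl
    · exact hi x
    · exact hi y
    · exact (hi x).add (hi y)
    · exact hi (x - y)

/-- Schoenberg's argument: up to a rank one factor the kernel is the exponential of `c` times the
positive semi-definite kernel of `isPSDKernelOn_levyPart`. -/
theorem isPSDKernelOn_exp_neg_levyPart (ha : 0 < a) (ha1 : a < 1) {S : Set ℝ}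
    (hS : MeasurableSet S) (hS0 : S ⊆ Set.Ioi 0) {c : ℝ} (hc : 0 ≤ c) (d : ℕ) :
    IsPSDKernelOn Set.univ fun x y : E d => Real.exp (-(c * levyPart a S (‖x - y‖ ^ 2))) := by
  refine ((isPSDKernelOn_rankOne fun x : E d => Real.exp (-(c * levyPart a S (‖x‖ ^ 2)))).mul
    ((isPSDKernelOn_levyPart ha ha1 hS hS0 d).const_mul hc).exp).congr fun x _ y _ => ?_
  rw [← Real.exp_add, ← Real.exp_add]
  ring_nf

theorem alphaExpKernel_eq (ha : 0 < a) (ha1 : a < 1) (d : ℕ) (x y : E d) :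
    alphaExpKernel (2 * a) d x y = Real.exp (-((levyPart a (Set.Ioi 0) 1)⁻¹ *
      levyPart a (Set.Ioi 0) (‖x - y‖ ^ 2))) := by
  rw [alphaExpKernel, levyPart_Ioi ha (sq_nonneg _), mul_comm (_ ^ a), inv_mul_cancel_left₀
    (levyPart_one_pos ha ha1).ne', Real.rpow_mul (norm_nonneg _), Real.rpow_ofNat]

/-- By Schur's product theorem (M - γI) ∘ N is positive semi-definite, and I ∘ N = I because `N` has
unit diagonal. -/
theorem eigenvalue_bound_mul {n : ℕ} {M N : Fin n → Fin n → ℝ} {γ : ℝ}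
    (hM : ∀ i j, M i j = M j i) (hMγ : ∀ c : Fin n → ℝ, γ * ∑ i, c i ^ 2 ≤
      ∑ i, ∑ j, c i * c j * M i j) (hN : (Matrix.of N).PosSemidef) (hN1 : ∀ i, N i i = 1)
    (c : Fin n → ℝ) : γ * ∑ i, c i ^ 2 ≤ ∑ i, ∑ j, c i * c j * (M i j * N i j) := by
  have h1 : ∀ (c : Fin n → ℝ) (N : Fin n → Fin n → ℝ), (∀ i, N i i = 1) →
      ∑ i, ∑ j, c i * c j * ((M i j - if i = j then γ else 0) * N i j) =
      ∑ i, ∑ j, c i * c j * (M i j * N i j) - γ * ∑ i, c i ^ 2 := by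
    intro c N hN1
    simp only [sub_mul, mul_sub, Finset.sum_sub_distrib, ite_mul, mul_ite, zero_mul, mul_zero,
      Finset.sum_ite_eq, Finset.mem_univ, if_true, hN1, Finset.mul_sum]
    congr 1
    exact Finset.sum_congr rfl fun i _ => by ring
  have h2 : (Matrix.of fun i j => M i j - if i = j then γ else 0).PosSemidef := by
    refine Matrix.PosSemidef.of_dotProduct_mulVec_nonneg ?_ fun c => ?_
    · ext i j
      simp [hM i j, eq_comm]
    · have h3 := h1 c (fun _ _ => 1) fun _ => rfl
      simp only [mul_one] at h3
      have h4 := hMγ c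
      have h5 : star c ⬝ᵥ (Matrix.of fun i j => M i j - if i = j then γ else 0).mulVec c =
          ∑ i, ∑ j, c i * c j * (M i j - if i = j then γ else 0) := by
        simp only [dotProduct, Matrix.mulVec, Finset.mul_sum, Matrix.of_apply, star_trivial]
        exact Finset.sum_congr rfl fun i _ => Finset.sum_congr rfl fun j _ => by ring
      rw [h5, h3]
      linarith
  have h3 := (Matrix.posSemidef_iff_dotProduct_mulVec.mp (h2.hadamard hN)).2 c
  have h5 : star c ⬝ᵥ (Matrix.hadamard (Matrix.of fun i j => M i j - if i = j then γ else 0)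
      (Matrix.of N)).mulVec c =
      ∑ i, ∑ j, c i * c j * ((M i j - if i = j then γ else 0) * N i j) := by
    simp only [dotProduct, Matrix.mulVec, Finset.mul_sum, Matrix.of_apply, star_trivial,
      Matrix.hadamard_apply]
    exact Finset.sum_congr rfl fun i _ => Finset.sum_congr rfl fun j _ => by ring
  rw [h5, h1 c N hN1] at h3
  linarith

/-- On [1, 2] the weight alone is integrable, so the kernel is exp(-cA) exp(cψ) with a mixture ψ of
Gaussian kernels. Removing the linear term from the exponential series shows exp(cψ) ≥ cψ as forms,
and ψ inherits the uniform Gaussian bound by integration. -/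
theorem exp_neg_levyPart_eigenvalue_bound {c : ℝ} (hc : 0 < c) (m : ℕ) : HasEigenvalueBound
      (fun _ x y => Real.exp (-(c * levyPart a (Set.Icc 1 2) (‖x - y‖ ^ 2)))) m := by
  obtain ⟨γ, hγ, ε, hε, h⟩ := gaussian_eigenvalue_bound m
  have hJ0 : Set.Icc (1 : ℝ) 2 ⊆ Set.Ioi 0 := fun w hw => zero_lt_one.trans_le hw.1
  have hcont : ContinuousOn (fun w : ℝ => w ^ (-1 - a)) (Set.Icc 1 2) := fun w hw =>
    (Real.continuousAt_rpow_const w _ (Or.inl (ne_of_gt (hJ0 hw)))).continuousWithinAt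
  have hint : IntegrableOn (fun w : ℝ => w ^ (-1 - a)) (Set.Icc 1 2) :=
    hcont.integrableOn_compact isCompact_Icc
  have hint2 : ∀ s : ℝ, IntegrableOn (fun w : ℝ => Real.exp (-(w * s)) * w ^ (-1 - a))
      (Set.Icc 1 2) := fun s =>
    (ContinuousOn.mul (by fun_prop) hcont).integrableOn_compact isCompact_Icc
  set A : ℝ := ∫ w in Set.Icc (1 : ℝ) 2, w ^ (-1 - a) with hA_def
  have hA : 0 < A := by
    rw [hA_def, setIntegral_pos_iff_support_of_nonneg_ae
      ((ae_restrict_iff' measurableSet_Icc).2 (ae_of_all _ fun w hw =>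
        Real.rpow_nonneg (le_of_lt (hJ0 hw)) _)) hint]
    refine lt_of_lt_of_le ?_ (measure_mono fun w hw =>
      (⟨(Real.rpow_pos_of_pos (hJ0 hw) _).ne', hw⟩ : w ∈ _ ∩ Set.Icc (1 : ℝ) 2))
    simp
  have hlevy : ∀ s, levyPart a (Set.Icc 1 2) s =
      A - ∫ w in Set.Icc (1 : ℝ) 2, Real.exp (-(w * s)) * w ^ (-1 - a) := by
    intro s
    rw [hA_def, ← integral_sub hint (hint2 s), levyPart]
    refine integral_congr_ae (ae_of_all _ fun w => ?_)
    simp only [levyFun]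
    ring
  refine ⟨Real.exp (-(c * A)) * (c * (γ * A)), by positivity, ε, hε,
    fun d n δ z hδ hn hz b => ?_⟩
  set ψ : E d → E d → ℝ := fun x y =>
    ∫ w in Set.Icc (1 : ℝ) 2, Real.exp (-(w * ‖x - y‖ ^ 2)) * w ^ (-1 - a) with hψ
  have hψp : IsPSDKernelOn Set.univ ψ := by
    refine isPSDKernelOn_setIntegral (f := fun w (x y : E d) => Real.exp (-(w * ‖x - y‖ ^ 2)) *
      w ^ (-1 - a)) measurableSet_Icc (fun w hw => ?_) fun x y => hint2 _
    exact (gaussian_psd (le_of_lt (hJ0 hw)) d).mul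
      (isPSDKernelOn_const (Real.rpow_nonneg (le_of_lt (hJ0 hw)) _))
  have h1 : γ * A * ∑ i, b i ^ 2 ≤ ∑ i, ∑ j, b i * b j * ψ (z i) (z j) := by
    have h2 : ∑ i, ∑ j, b i * b j * ψ (z i) (z j) = ∫ w in Set.Icc (1 : ℝ) 2,
        (∑ i, ∑ j, b i * b j * Real.exp (-(w * ‖z i - z j‖ ^ 2))) * w ^ (-1 - a) := by
      simp only [Finset.sum_mul, mul_assoc]
      rw [integral_finsetSum _ fun i _ => integrable_finsetSum _ fun j _ =>
        ((hint2 _).const_mul _).const_mul _]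
      refine Finset.sum_congr rfl fun i _ => ?_
      rw [integral_finsetSum _ fun j _ => ((hint2 _).const_mul _).const_mul _]
      simp only [integral_const_mul, hψ]
    have h3 : γ * A * ∑ i, b i ^ 2 = ∫ w in Set.Icc (1 : ℝ) 2,
        (γ * ∑ i, b i ^ 2) * w ^ (-1 - a) := by
      rw [integral_const_mul, ← hA_def]
      ring
    rw [h2, h3]
    refine setIntegral_mono_on (hint.const_mul _) ?_ measurableSet_Icc fun w hw => ?_
    · simp only [Finset.sum_mul, mul_assoc]
      exact integrable_finsetSum _ fun i _ => integrable_finsetSum _ fun j _ =>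
        ((hint2 _).const_mul _).const_mul _
    · exact mul_le_mul_of_nonneg_right (h w hw d n δ z hδ hn hz b)
        (Real.rpow_nonneg (le_of_lt (hJ0 hw)) _)
  have h2 : IsPSDKernelOn Set.univ fun x y : E d => Real.exp (c * ψ x y) - c * ψ x y := by
    refine (isPSDKernelOn_sub_of_hasSum (f := fun j (x y : E d) =>
      (j.factorial : ℝ)⁻¹ * (c * ψ x y) ^ j) (k := fun x y => Real.exp (c * ψ x y))
      (fun j => ((hψp.const_mul hc.le).pow j).const_mul (by positivity))
      (fun x _ y _ => ?_) 1).congr fun x _ y _ => by simp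
    simpa only [div_eq_inv_mul] using hasSum_real_exp (c * ψ x y)
  have h3 := h2.sum_nonneg (fun i => Set.mem_univ (z i)) b
  have h4 : ∑ i, ∑ j, b i * b j * (Real.exp (c * ψ (z i) (z j)) - c * ψ (z i) (z j)) =
      ∑ i, ∑ j, b i * b j * Real.exp (c * ψ (z i) (z j)) -
        c * ∑ i, ∑ j, b i * b j * ψ (z i) (z j) := by
    simp only [mul_sub, Finset.sum_sub_distrib, Finset.mul_sum]
    congr 1
    exact Finset.sum_congr rfl fun i _ => Finset.sum_congr rfl fun j _ => by ring
  have h5 : ∑ i, ∑ j, b i * b j * Real.exp (-(c * levyPart a (Set.Icc 1 2) (‖z i - z j‖ ^ 2))) =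
      Real.exp (-(c * A)) * ∑ i, ∑ j, b i * b j * Real.exp (c * ψ (z i) (z j)) := by
    simp only [Finset.mul_sum]
    refine Finset.sum_congr rfl fun i _ => Finset.sum_congr rfl fun j _ => ?_
    have h6 : Real.exp (-(c * levyPart a (Set.Icc 1 2) (‖z i - z j‖ ^ 2))) =
        Real.exp (-(c * A)) * Real.exp (c * ψ (z i) (z j)) := by
      rw [← Real.exp_add, hlevy]
      congr 1
      simp only [hψ]
      ring
    rw [h6]
    ring
  rw [h5, mul_assoc]
  refine mul_le_mul_of_nonneg_left ?_ (Real.exp_pos _).le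
  have h6 := mul_le_mul_of_nonneg_left h1 hc.le
  linarith

/-- Splitting the integral over `w` at [1, 2] factorises the kernel. The factor from [1, 2] has the
eigenvalue bound, and the other one is positive semi-definite with unit diagonal, so the product
keeps the bound. The integral representation needs α < 2; for α = 2 the Gaussian bound applies
directly. -/
theorem alphaExpKernel_hasEigenvalueBound {α : ℝ} (hα : 0 < α) (hα2 : α ≤ 2) (m : ℕ) :
    HasEigenvalueBound (alphaExpKernel α) m := by
  rcases hα2.eq_or_lt with rfl | hα2
  · obtain ⟨γ, hγ, ε, hε, h⟩ := gaussian_eigenvalue_bound m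
    refine ⟨γ, hγ, ε, hε, fun d n δ z h1 h2 h3 c => ?_⟩
    simpa [alphaExpKernel] using h 1 (by norm_num) d n δ z h1 h2 h3 c
  · obtain ⟨a, rfl⟩ : ∃ a, α = 2 * a := ⟨α / 2, by ring⟩
    have ha : 0 < a := by linarith
    have ha1 : a < 1 := by linarith
    have hc : 0 < (levyPart a (Set.Ioi 0) 1)⁻¹ := inv_pos.2 (levyPart_one_pos ha ha1)
    obtain ⟨γ, hγ, ε, hε, h⟩ := exp_neg_levyPart_eigenvalue_bound (a := a) hc m
    have hJ0 : Set.Icc (1 : ℝ) 2 ⊆ Set.Ioi 0 := fun w hw => zero_lt_one.trans_le hw.1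
    refine ⟨γ, hγ, ε, hε, fun d n δ z h1 h2 h3 c => ?_⟩
    have hN := isPSDKernelOn_exp_neg_levyPart ha ha1
      (measurableSet_Ioi.diff (measurableSet_Icc (a := (1 : ℝ)) (b := 2)))
      Set.sdiff_subset hc.le d n z fun i => Set.mem_univ _
    refine (eigenvalue_bound_mul (fun i j => by beta_reduce; rw [norm_sub_rev]) (h d n δ z h1 h2 h3) hN
      (fun i => ?_) c).trans_eq ?_
    · beta_reduce
      rw [sub_self, norm_zero, zero_pow two_ne_zero, levyPart_zero, mul_zero, neg_zero,
        Real.exp_zero]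
    · refine Finset.sum_congr rfl fun i _ => Finset.sum_congr rfl fun j _ => ?_
      rw [alphaExpKernel_eq ha ha1, ← Real.exp_add]
      have h4 : levyPart a (Set.Ioi 0) (‖z i - z j‖ ^ 2) =
          levyPart a (Set.Icc 1 2) (‖z i - z j‖ ^ 2) +
            levyPart a (Set.Ioi 0 \ Set.Icc 1 2) (‖z i - z j‖ ^ 2) := by
        have hi := integrableOn_levyFun ha ha1 (sq_nonneg ‖z i - z j‖)
        rw [levyPart, levyPart, levyPart, ← setIntegral_union Set.disjoint_sdiff_right
          (measurableSet_Ioi.diff measurableSet_Icc) (hi.mono_set hJ0)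
          (hi.mono_set Set.sdiff_subset), Set.union_sdiff_cancel hJ0]
      rw [h4]
      ring_nf

end Levy

theorem alphaExpKernel_isRotationallyInvariantKernel {α : ℝ} (hα : 0 < α) (hα2 : α ≤ 2) :
    IsRotationallyInvariantKernel (alphaExpKernel α) where
  continuous d := by
    unfold alphaExpKernel
    exact Real.continuous_exp.comp ((Continuous.rpow_const (by fun_prop)
      fun _ => Or.inr hα.le).neg)
  posSemidef d := by
    rcases hα2.eq_or_lt with rfl | hα2
    · exact (gaussian_psd zero_le_one d).congr fun x _ y _ => by simp [alphaExpKernel]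
    · obtain ⟨a, rfl⟩ : ∃ a, α = 2 * a := ⟨α / 2, by ring⟩
      have ha : 0 < a := by linarith
      have ha1 : a < 1 := by linarith
      exact (isPSDKernelOn_exp_neg_levyPart ha ha1 measurableSet_Ioi subset_rfl
        (inv_nonneg.2 (levyPart_one_pos ha ha1).le) d).congr fun x _ y _ =>
          (alphaExpKernel_eq ha ha1 d x y).symm
  exists_profile := by
    refine ⟨fun u v p => Real.exp (-(Real.sqrt (u - 2 * p + v) ^ α)), fun d x y => ?_⟩
    beta_reduce
    rw [alphaExpKernel, ← norm_sub_sq_real, Real.sqrt_sq (norm_nonneg _)]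

/-- The kernel is a function of ‖t - z‖² that is smooth away from 0. It is expanded at the base
point 1 + ‖z‖² with increment (‖t‖² - 1) - 2⟨t, z⟩, of size at most 3δ, and the powers are expanded
by the binomial theorem. The bound δ ≤ 1/6 keeps the arguments in [1, 3]. -/
theorem alphaExpKernel_hasTaylorApproximation (α : ℝ) (m : ℕ) :
    HasTaylorApproximation (alphaExpKernel α) m := by
  set F : ℝ → ℝ := fun s => Real.exp (-(s ^ (α / 2))) with hF
  have hFs : ContDiffOn ℝ ((⊤ : ℕ∞) : WithTop ℕ∞) F (Set.Ioi 0) := by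
    intro s hs
    exact ((Real.contDiffAt_rpow_const_of_ne (ne_of_gt hs)).neg.exp).contDiffWithinAt
  obtain ⟨C, hC, hC1, hC2⟩ := exists_taylor_bound hFs m (lo := 1) (hi := 3) one_pos
  refine ⟨(Finset.range (m + 1)).biUnion Finset.HasAntidiagonal.antidiagonal,
    fun p v => iteratedDeriv (p.1 + p.2) F (1 + v) / (p.1 + p.2).factorial *
      (((p.1 + p.2).choose p.1 : ℝ) * (-2) ^ p.2), C * 3 ^ (m + 1), 1 / 6, fun p hp => ?_,
    by positivity, by norm_num, by norm_num, fun p hp => ?_, fun d t z δ hz hδ ht htz => ?_⟩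
  · obtain ⟨i, hi, hp⟩ := Finset.mem_biUnion.1 hp
    have h1 := Finset.HasAntidiagonal.mem_antidiagonal.1 hp
    have h2 := Finset.mem_range.1 hi
    omega
  · obtain ⟨i, hi, hp⟩ := Finset.mem_biUnion.1 hp
    have h1 := Finset.HasAntidiagonal.mem_antidiagonal.1 hp
    have h2 := Finset.mem_range.1 hi
    refine ⟨C / (p.1 + p.2).factorial * |((p.1 + p.2).choose p.1 : ℝ) * (-2) ^ p.2|,
      fun v hv => ?_⟩
    rw [abs_mul, abs_div, Nat.abs_cast]
    gcongr
    have h3 := abs_le.1 hv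
    exact hC1 _ (by omega) _ ⟨by linarith, by linarith⟩
  · have hz' := abs_le.1 hz
    have ht' := abs_le.1 ht
    have htz' := abs_le.1 htz
    have hs : ‖t - z‖ ^ 2 = (1 + ‖z‖ ^ 2) + ((‖t‖ ^ 2 - 1) + -2 * ⟪t, z⟫) := by
      rw [norm_sub_sq_real]; ring
    have hk : alphaExpKernel α d t z = F (‖t - z‖ ^ 2) := by
      rw [alphaExpKernel, hF]
      simp only
      rw [← Real.rpow_natCast, ← Real.rpow_mul (norm_nonneg _)]
      congr 3
      push_cast
      ring
    have h1 := hC2 (1 + ‖z‖ ^ 2) ⟨by linarith, by linarith⟩ (‖t - z‖ ^ 2)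
      ⟨by rw [hs]; linarith, by rw [hs]; linarith⟩
    have h2 : ‖t - z‖ ^ 2 - (1 + ‖z‖ ^ 2) = (‖t‖ ^ 2 - 1) + -2 * ⟪t, z⟫ := by rw [hs]; ring
    rw [h2] at h1
    have h3 : |‖t‖ ^ 2 - 1 + -2 * ⟪t, z⟫| ≤ 3 * δ := by
      rw [abs_le]
      constructor <;> linarith
    have h4 : ∑ p ∈ (Finset.range (m + 1)).biUnion Finset.HasAntidiagonal.antidiagonal,
        iteratedDeriv (p.1 + p.2) F (1 + ‖z‖ ^ 2) / (p.1 + p.2).factorial *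
          (((p.1 + p.2).choose p.1 : ℝ) * (-2) ^ p.2) *
            ((‖t‖ ^ 2 - 1) ^ p.1 * ⟪t, z⟫ ^ p.2) =
        ∑ i ∈ Finset.range (m + 1), iteratedDeriv i F (1 + ‖z‖ ^ 2) / i.factorial *
          ((‖t‖ ^ 2 - 1) + -2 * ⟪t, z⟫) ^ i := by
      rw [Finset.sum_biUnion]
      · refine Finset.sum_congr rfl fun i _ => ?_
        rw [(Commute.all (‖t‖ ^ 2 - 1) (-2 * ⟪t, z⟫)).add_pow', Finset.mul_sum]
        refine Finset.sum_congr rfl fun p hp => ?_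
        rw [Finset.HasAntidiagonal.mem_antidiagonal.1 hp, mul_pow, nsmul_eq_mul]
        ring
      · intro i _ j _ hij
        rw [Function.onFun, Finset.disjoint_left]
        intro p hp hq
        exact hij ((Finset.HasAntidiagonal.mem_antidiagonal.1 hp).symm.trans (Finset.HasAntidiagonal.mem_antidiagonal.1 hq))
    rw [h4, hk]
    refine h1.trans ?_
    rw [mul_assoc, ← mul_pow]
    gcongr

theorem alphaExpKernel_hasKernelMoments (α : ℝ) : HasKernelMoments (alphaExpKernel α) := by
  intro A B _
  refine ⟨1, zero_le_one, fun d Q τ _ hQ z _ => ?_⟩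
  have := hQ.isProbabilityMeasure
  have h1 : ∀ t : E d, ‖alphaExpKernel α d ((Real.sqrt τ)⁻¹ • t) z‖ₑ ^ 4 ≤ 1 := by
    intro t
    refine pow_le_one₀ zero_le ?_
    rw [alphaExpKernel, Real.enorm_eq_ofReal (Real.exp_pos _).le, ENNReal.ofReal_le_one,
      Real.exp_le_one_iff]
    exact neg_nonpos.2 (Real.rpow_nonneg (norm_nonneg _) _)
  refine (lintegral_mono h1).trans ?_
  simp

theorem alphaExpKernel_barrier {α β : ℝ} (hα : 0 < α) (hα2 : α ≤ 2) (hβ : 0 < β) :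
    PolynomialApproximationBarrier.{u} (alphaExpKernel α) β :=
  polynomialApproximationBarrier hβ
    (alphaExpKernel_isRotationallyInvariantKernel hα hα2).continuous
    (alphaExpKernel_isRotationallyInvariantKernel hα hα2).posSemidef
    (alphaExpKernel_hasEigenvalueBound hα hα2 _) (alphaExpKernel_hasTaylorApproximation α _)
    (alphaExpKernel_hasKernelMoments α)

theorem gaussianKernel_satisfiesKernelAssumptions (β : ℝ) :
    SatisfiesKernelAssumptions (alphaExpKernel 2) β (gaussianCoeff 1) where
  rotInv := alphaExpKernel_isRotationallyInvariantKernel two_pos le_rfl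
  powerSeries := ⟨1, one_pos, fun d x _ x' _ => by
    simpa [alphaExpKernel] using hasSum_gaussian 1 x x'⟩
  coeffPSD j := gaussianCoeff_psd zero_le_one j _
  lipschitz := lipschitzOnWith_diag (h := fun _ => 1)
    (fun d x _ => by simp [alphaExpKernel]) contDiffAt_const
  contDiff i _ := by
    unfold gaussianCoeff
    fun_prop
  exists_pos := ⟨⌊2 / β⌋₊ + 1, Nat.lt_succ_self _, by unfold gaussianCoeff; positivity⟩

/-! ### Homogeneous kernels with a nonnegative series in the cosine of the angle -/

/-- The kernel `k` is `(‖x‖ ‖x'‖) ^ D` times a power series with the nonnegative summable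
coefficients `γ` in the cosine of the angle between `x` and `x'`. -/
structure HasAngularSeries (k : ∀ d : ℕ, E d → E d → ℝ) (D : ℝ) (γ : ℕ → ℝ) : Prop where
  pos : 0 < D
  nonneg : ∀ j, 0 ≤ γ j
  summable : Summable γ
  hasSum : ∀ (d : ℕ) (x x' : E d), HasSum
    (fun j => (‖x‖ * ‖x'‖) ^ D * (γ j * (⟪x, x'⟫ / (‖x‖ * ‖x'‖)) ^ j)) (k d x x')

/-- The coefficient functions of the expansion in powers of the inner product. -/
noncomputable def angularCoeff (D : ℝ) (γ : ℕ → ℝ) (j : ℕ) (u v : ℝ) : ℝ :=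
  γ j * (u ^ ((D - j) / 2) * v ^ ((D - j) / 2))

namespace HasAngularSeries

variable {k : ∀ d : ℕ, E d → E d → ℝ} {D : ℝ} {γ : ℕ → ℝ}

theorem cos_mem {d : ℕ} (x x' : E d) : ⟪x, x'⟫ / (‖x‖ * ‖x'‖) ∈ Set.Icc (-1 : ℝ) 1 :=
  abs_le.1 (abs_real_inner_div_norm_mul_norm_le_one x x')

theorem abs_coeff_mul_pow_le (h : HasAngularSeries k D γ) {ρ : ℝ} (hρ : ρ ∈ Set.Icc (-1 : ℝ) 1)
    (j : ℕ) : |γ j * ρ ^ j| ≤ γ j := by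
  rw [abs_mul, abs_of_nonneg (h.nonneg j), abs_pow]
  exact mul_le_of_le_one_right (h.nonneg j) (pow_le_one₀ (abs_nonneg _) (abs_le.2 hρ))

theorem summable_mul_pow (h : HasAngularSeries k D γ) {ρ : ℝ} (hρ : ρ ∈ Set.Icc (-1 : ℝ) 1) :
    Summable fun j => γ j * ρ ^ j :=
  Summable.of_norm_bounded h.summable fun j => h.abs_coeff_mul_pow_le hρ j

theorem eq (h : HasAngularSeries k D γ) (d : ℕ) (x x' : E d) :
    k d x x' = (‖x‖ * ‖x'‖) ^ D * ∑' j, γ j * (⟪x, x'⟫ / (‖x‖ * ‖x'‖)) ^ j :=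
  (h.hasSum d x x').unique ((h.summable_mul_pow (cos_mem x x')).hasSum.mul_left _)

theorem abs_le (h : HasAngularSeries k D γ) (d : ℕ) (x x' : E d) :
    |k d x x'| ≤ (‖x‖ * ‖x'‖) ^ D * ∑' j, γ j := by
  rw [h.eq, abs_mul, abs_of_nonneg (Real.rpow_nonneg (by positivity) _)]
  refine mul_le_mul_of_nonneg_left ?_ (Real.rpow_nonneg (by positivity) _)
  have h1 := norm_tsum_le_tsum_norm (h.summable_mul_pow (cos_mem x x')).norm
  exact h1.trans ((h.summable_mul_pow (cos_mem x x')).norm.tsum_le_tsum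
    (h.abs_coeff_mul_pow_le (cos_mem x x')) h.summable)

theorem continuousOn_tsum (h : HasAngularSeries k D γ) :
    ContinuousOn (fun ρ : ℝ => ∑' j, γ j * ρ ^ j) (Set.Icc (-1) 1) :=
  _root_.continuousOn_tsum (fun j => by fun_prop) h.summable
    fun j _ hρ => h.abs_coeff_mul_pow_le hρ j

/-- Away from zero vectors the series converges uniformly in the cosine. At zero vectors the cosine
is discontinuous, but the series stays bounded and the prefactor tends to 0 because D > 0. -/
theorem continuous (h : HasAngularSeries k D γ) (d : ℕ) :
    Continuous fun p : E d × E d => k d p.1 p.2 := by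
  rw [continuous_iff_continuousAt]
  intro p
  have hr : Continuous fun p : E d × E d => (‖p.1‖ * ‖p.2‖) ^ D :=
    Continuous.rpow_const (by fun_prop) fun _ => Or.inr h.pos.le
  by_cases hp : ‖p.1‖ * ‖p.2‖ = 0
  · have h0 : k d p.1 p.2 = 0 := by rw [h.eq, hp, Real.zero_rpow h.pos.ne', zero_mul]
    rw [ContinuousAt, h0]
    refine squeeze_zero_norm (fun q => h.abs_le d q.1 q.2) ?_
    have h1 := (hr.mul_const (∑' j, γ j)).tendsto p
    rwa [hp, Real.zero_rpow h.pos.ne', zero_mul] at h1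
  · have h1 : (fun q : E d × E d => k d q.1 q.2) = fun q => (‖q.1‖ * ‖q.2‖) ^ D *
        ∑' j, γ j * (⟪q.1, q.2⟫ / (‖q.1‖ * ‖q.2‖)) ^ j := by
      ext q
      exact h.eq d q.1 q.2
    rw [h1]
    refine hr.continuousAt.mul ?_
    have h2 : ContinuousAt (fun q : E d × E d => ⟪q.1, q.2⟫ / (‖q.1‖ * ‖q.2‖)) p :=
      ContinuousAt.div (by fun_prop) (by fun_prop) hp
    exact (h.continuousOn_tsum _ (cos_mem p.1 p.2)).tendsto.comp
      (tendsto_nhdsWithin_iff.2 ⟨h2, Eventually.of_forall fun q => cos_mem q.1 q.2⟩)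

theorem isPSDKernelOn (h : HasAngularSeries k D γ) (d : ℕ) : IsPSDKernelOn Set.univ (k d) := by
  refine isPSDKernelOn_of_hasSum (fun j => ?_) fun x _ y _ => h.hasSum d x y
  refine ((isPSDKernelOn_rankOne fun x : E d => ‖x‖ ^ D).mul
    ((((isPSDKernelOn_inner (Set.univ : Set (E d))).comp (f := fun x : E d => ‖x‖⁻¹ • x)
      (Set.mapsTo_univ Set.univ _)).pow j).const_mul (h.nonneg j))).congr fun x _ y _ => ?_
  rw [Real.mul_rpow (norm_nonneg _) (norm_nonneg _), real_inner_smul_left, real_inner_smul_right,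
    div_eq_inv_mul, mul_inv, mul_assoc (‖x‖⁻¹)]

theorem isRotationallyInvariantKernel (h : HasAngularSeries k D γ) :
    IsRotationallyInvariantKernel k where
  continuous := h.continuous
  posSemidef := h.isPSDKernelOn
  exists_profile := ⟨fun u v p => (Real.sqrt u * Real.sqrt v) ^ D *
      ∑' j, γ j * (p / (Real.sqrt u * Real.sqrt v)) ^ j, fun d x x' => by
    beta_reduce
    rw [h.eq, Real.sqrt_sq (norm_nonneg _), Real.sqrt_sq (norm_nonneg _)]⟩

/-- The norms in the denominator of the j-th power of the cosine are moved into the coefficient; its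
exponent becomes negative for j > D. -/
theorem hasGlobalExpansion (h : HasAngularSeries k D γ) :
    HasGlobalExpansion k (angularCoeff D γ) := by
  intro d x x' hx hx'
  have hx0 := norm_pos_iff.2 hx
  have hx0' := norm_pos_iff.2 hx'
  refine (h.hasSum d x x').congr_fun fun j => ?_
  have h1 : ∀ y : E d, 0 < ‖y‖ → (‖y‖ ^ 2) ^ ((D - j) / 2) = ‖y‖ ^ D / ‖y‖ ^ j := by
    intro y hy
    rw [← Real.rpow_natCast ‖y‖ 2, ← Real.rpow_mul hy.le, ← Real.rpow_natCast ‖y‖ j,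
      ← Real.rpow_sub hy]
    congr 1
    push_cast
    ring
  rw [angularCoeff, h1 x hx0, h1 x' hx0', Real.mul_rpow hx0.le hx0'.le, div_pow, mul_pow]
  field_simp

theorem ne_zero_of_mem_annulus {d : ℕ} {x : E d} (hx : x ∈ annulus d (1 / 2)) : x ≠ 0 := by
  rintro rfl
  have := hx.1
  rw [norm_zero] at this
  norm_num at this

theorem isPSDKernelOn_angularCoeff (h : HasAngularSeries k D γ) (j : ℕ) (s : Set ℝ) :
    IsPSDKernelOn s (angularCoeff D γ j) :=
  (isPSDKernelOn_rankOne fun u : ℝ => u ^ ((D - j) / 2)).const_mul (h.nonneg j)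

theorem diag (h : HasAngularSeries k D γ) (d : ℕ) (x : E d) (hx : x ≠ 0) :
    k d x x = (‖x‖ ^ 2) ^ D * ∑' j, γ j := by
  have hx0 := norm_pos_iff.2 hx
  rw [h.eq, real_inner_self_eq_norm_sq, ← sq, div_self (by positivity)]
  simp

theorem satisfiesKernelAssumptions (h : HasAngularSeries k D γ) {β : ℝ} {j₀ : ℕ}
    (hj : ⌊2 / β⌋₊ < j₀) (hj₀ : 0 < γ j₀) :
    SatisfiesKernelAssumptions k β (angularCoeff D γ) where
  rotInv := h.isRotationallyInvariantKernel
  powerSeries := ⟨1 / 2, by norm_num, fun d x hx x' hx' => h.hasGlobalExpansion d x x'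
    (ne_zero_of_mem_annulus hx) (ne_zero_of_mem_annulus hx')⟩
  coeffPSD j := h.isPSDKernelOn_angularCoeff j _
  lipschitz := lipschitzOnWith_diag (h := fun u => u ^ D * ∑' j, γ j) h.diag
    ((Real.contDiffAt_rpow_const_of_ne one_ne_zero).mul contDiffAt_const)
  contDiff i _ := by
    unfold angularCoeff
    refine contDiffAt_const.mul (ContDiffAt.mul ?_ ?_)
    · exact contDiffAt_fst.rpow_const_of_ne one_ne_zero
    · exact contDiffAt_snd.rpow_const_of_ne one_ne_zero
  exists_pos := ⟨j₀, hj, by simpa [angularCoeff] using hj₀⟩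

/-- The j-th coefficient is the single monomial γⱼ (uv)^((N-j)/2), so only l = N - j contributes. -/
theorem hasPuiseuxCoefficients (h : HasAngularSeries k D γ) {N : ℕ} (hN : D = N) :
    HasPuiseuxCoefficients (angularCoeff D γ) := by
  intro j
  refine ⟨fun l => if l = (N : ℤ) - j then γ j else 0, fun l => ?_, fun u v hu hv => ?_⟩
  · beta_reduce
    split_ifs
    exacts [h.nonneg j, le_rfl]
  · have h1 : angularCoeff D γ j u v = (if (N : ℤ) - j = (N : ℤ) - j then γ j else 0) *
        (u * v) ^ ((((N : ℤ) - j : ℤ) : ℝ) / 2) := by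
      rw [if_pos rfl, angularCoeff, Real.mul_rpow hu.le hv.le, hN]
      push_cast
      rfl
    rw [h1]
    refine hasSum_single ((N : ℤ) - j) fun l hl => ?_
    beta_reduce
    rw [if_neg hl, zero_mul]

theorem hasEigenvalueBound (h : HasAngularSeries k D γ) {m j₀ : ℕ} (hj : m < j₀)
    (hj₀ : 0 < γ j₀) : HasEigenvalueBound k m := by
  set φ : ℝ → ℝ := fun u => Real.sqrt (γ j₀) * u ^ ((D - j₀) / 2) with hφ
  have hc : ContinuousOn φ (Set.Icc (1 / 2) (3 / 2)) := fun u hu =>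
    (continuousAt_const.mul (Real.continuousAt_rpow_const u _ (Or.inl (by
      have := hu.1
      linarith)))).continuousWithinAt
  have hne : (Set.Icc (1 / 2 : ℝ) (3 / 2)).Nonempty := ⟨1, by norm_num, by norm_num⟩
  obtain ⟨u₁, hu₁, h1⟩ := isCompact_Icc.exists_isMinOn hne hc
  obtain ⟨u₂, hu₂, h2⟩ := isCompact_Icc.exists_isMaxOn hne hc
  refine HasEigenvalueBound.of_hasSum hj (fun j => h.isPSDKernelOn_angularCoeff j _)
    (fun d x hx x' hx' => h.hasGlobalExpansion d x x'
    (ne_zero_of_mem_annulus hx) (ne_zero_of_mem_annulus hx')) (φ := φ) (lo := φ u₁) (hi := φ u₂) ?_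
    (fun u hu hu' => ⟨h1 ⟨hu, hu'⟩, h2 ⟨hu, hu'⟩⟩) fun u v _ _ => ?_
  · have : 0 < u₁ := by linarith [hu₁.1]
    have h3 := Real.rpow_pos_of_pos this ((D - j₀) / 2)
    have h4 := Real.sqrt_pos.2 hj₀
    exact mul_pos h4 h3
  · rw [angularCoeff, hφ]
    nth_rewrite 1 [← Real.mul_self_sqrt hj₀.le]
    ring

/-- In the terms of order j > m, a power j - (m + 1) of the cosine is split off and bounded by 1.
What remains are the norm factors of order m + 1, whatever `j` is, and ⟨t, z⟩^(m+1); so the tail is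
O(δ^(m+1)). For j ≤ m only the power of ‖t‖² is expanded, to order m - j: its remainder δ^(m-j+1) is
multiplied by |⟨t, z⟩|^j ≤ δ^j. The power of ‖z‖² is kept as a coefficient. -/
theorem hasTaylorApproximation (h : HasAngularSeries k D γ) (m : ℕ) :
    HasTaylorApproximation k m := by
  have hsm : ∀ e : ℝ, ContDiffOn ℝ ((⊤ : ℕ∞) : WithTop ℕ∞) (fun u : ℝ => u ^ e) (Set.Ioi 0) :=
    fun e u hu => (Real.contDiffAt_rpow_const_of_ne (ne_of_gt hu)).contDiffWithinAt
  choose C hC hC1 hC2 using fun j : ℕ =>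
    exists_taylor_bound (hsm ((D - j) / 2)) (m - j) (lo := 1 / 2) (hi := 3 / 2) (by norm_num)
  have hbd : ∀ e : ℝ, ∃ K, 0 ≤ K ∧ ∀ v ∈ Set.Icc (1 / 2 : ℝ) (3 / 2), |v ^ e| ≤ K := by
    intro e
    obtain ⟨C, hC, h1, -⟩ := exists_taylor_bound (hsm e) 0 (lo := 1 / 2) (hi := 3 / 2)
      (by norm_num)
    exact ⟨C, hC, fun v hv => by simpa using h1 0 le_rfl v hv⟩
  choose K hK0 hK using hbd
  set G : ℝ := ∑' j, γ j with hG
  have hG0 : 0 ≤ G := tsum_nonneg h.nonneg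
  set e : ℕ → ℝ := fun j => (D - j) / 2 with he
  set Ctail : ℝ := G * (K (e (m + 1)) * K (e (m + 1))) with hCtail
  refine ⟨(Finset.range (m + 1) ×ˢ Finset.range (m + 1)).filter fun p => p.1 + p.2 ≤ m,
    fun p v => γ p.2 * (v ^ (e p.2) * (iteratedDeriv p.1 (fun u : ℝ => u ^ (e p.2)) 1 /
      p.1.factorial)), Ctail + ∑ j ∈ Finset.range (m + 1), γ j * (K (e j) * C j), 1 / 2,
    fun p hp => (Finset.mem_filter.1 hp).2, ?_, by norm_num, by norm_num, fun p hp => ?_,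
    fun d t z δ hz hδ ht htz => ?_⟩
  · refine add_nonneg (mul_nonneg hG0 (mul_nonneg (hK0 _) (hK0 _))) (Finset.sum_nonneg fun j _ => ?_)
    exact mul_nonneg (h.nonneg j) (mul_nonneg (hK0 _) (hC j))
  · refine ⟨γ p.2 * (K (e p.2) * |iteratedDeriv p.1 (fun u : ℝ => u ^ (e p.2)) 1 /
      p.1.factorial|), fun v hv => ?_⟩
    have hv' := _root_.abs_le.1 hv
    rw [abs_mul, abs_mul, abs_of_nonneg (h.nonneg _)]
    have := hK (e p.2) v ⟨by linarith, by linarith⟩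
    have := h.nonneg p.2
    gcongr
  · set u := ‖t‖ ^ 2 with hu
    set v := ‖z‖ ^ 2 with hv
    set p := ⟪t, z⟫ with hp
    have hδ0 : 0 ≤ δ := (abs_nonneg _).trans ht
    have ht' := _root_.abs_le.1 ht
    have hz' := _root_.abs_le.1 hz
    have huI : u ∈ Set.Icc (1 / 2 : ℝ) (3 / 2) := ⟨by linarith, by linarith⟩
    have hvI : v ∈ Set.Icc (1 / 2 : ℝ) (3 / 2) := ⟨by linarith, by linarith⟩
    have hu0 : 0 < u := by linarith [huI.1]
    have hv0 : 0 < v := by linarith [hvI.1]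
    have htn : 0 < ‖t‖ := by
      rcases (norm_nonneg t).eq_or_lt with h0 | h0
      · rw [hu, ← h0] at hu0; norm_num at hu0
      · exact h0
    have hzn : 0 < ‖z‖ := by
      rcases (norm_nonneg z).eq_or_lt with h0 | h0
      · rw [hv, ← h0] at hv0; norm_num at hv0
      · exact h0
    have hsum := h.hasGlobalExpansion d t z (norm_pos_iff.1 htn) (norm_pos_iff.1 hzn)
    simp only [angularCoeff] at hsum
    -- the tail of the series
    have htail : |k d t z - ∑ j ∈ Finset.range (m + 1),
        γ j * (u ^ (e j) * v ^ (e j)) * p ^ j| ≤ Ctail * δ ^ (m + 1) := by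
      rw [← hsum.tsum_eq, ← hsum.summable.sum_add_tsum_nat_add (m + 1), add_sub_cancel_left]
      have hterm : ∀ i, ‖γ (i + (m + 1)) * (u ^ (e (i + (m + 1))) * v ^ (e (i + (m + 1)))) *
          p ^ (i + (m + 1))‖ ≤ γ (i + (m + 1)) * (K (e (m + 1)) * K (e (m + 1)) * δ ^ (m + 1)) := by
        intro i
        have hsplit : ∀ y : E d, 0 < ‖y‖ → (‖y‖ ^ 2) ^ (e (i + (m + 1))) =
            (‖y‖ ^ 2) ^ (e (m + 1)) / ‖y‖ ^ i := by
          intro y hy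
          rw [← Real.rpow_natCast ‖y‖ 2, ← Real.rpow_mul hy.le, ← Real.rpow_mul hy.le,
            ← Real.rpow_natCast ‖y‖ i, ← Real.rpow_sub hy]
          congr 1
          simp only [he]
          push_cast
          ring
        have h1 : γ (i + (m + 1)) * (u ^ (e (i + (m + 1))) * v ^ (e (i + (m + 1)))) *
          p ^ (i + (m + 1)) = γ (i + (m + 1)) * (u ^ (e (m + 1)) * v ^ (e (m + 1)) *
            p ^ (m + 1)) * (p / (‖t‖ * ‖z‖)) ^ i := by
          rw [hu, hv, hsplit t htn, hsplit z hzn, div_pow, mul_pow, pow_add]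
          field_simp
        rw [h1, Real.norm_eq_abs, abs_mul, abs_mul, abs_mul, abs_mul, abs_of_nonneg (h.nonneg _),
          abs_pow, abs_pow]
        have h2 : |p / (‖t‖ * ‖z‖)| ^ i ≤ 1 :=
          pow_le_one₀ (abs_nonneg _) (_root_.abs_le.2 (cos_mem t z))
        have h3 := hK (e (m + 1)) u huI
        have h4 := hK (e (m + 1)) v hvI
        have h5 := hK0 (e (m + 1))
        have h6 := h.nonneg (i + (m + 1))
        refine (mul_le_of_le_one_right (by positivity) h2).trans ?_
        gcongr
      have hs : Summable fun i => γ (i + (m + 1)) := (summable_nat_add_iff (m + 1)).2 h.summable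
      refine (tsum_of_norm_bounded (hs.hasSum.mul_right _) hterm).trans ?_
      have h7 : ∑' i, γ (i + (m + 1)) ≤ G := by
        rw [hG, ← h.summable.sum_add_tsum_nat_add (m + 1)]
        linarith [Finset.sum_nonneg fun i (_ : i ∈ Finset.range (m + 1)) => h.nonneg i]
      rw [hCtail]
      have h5 := hK0 (e (m + 1))
      calc _ ≤ G * (K (e (m + 1)) * K (e (m + 1)) * δ ^ (m + 1)) := by gcongr
        _ = _ := by ring
    -- the Taylor approximation of the first terms
    have hhead : ∑ p' ∈ (Finset.range (m + 1) ×ˢ Finset.range (m + 1)).filter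
        (fun p => p.1 + p.2 ≤ m), γ p'.2 * (v ^ (e p'.2) * (iteratedDeriv p'.1
          (fun u : ℝ => u ^ (e p'.2)) 1 / p'.1.factorial)) * ((u - 1) ^ p'.1 * p ^ p'.2) =
        ∑ j ∈ Finset.range (m + 1), γ j * v ^ (e j) * p ^ j *
          ∑ i ∈ Finset.range (m - j + 1), iteratedDeriv i (fun u : ℝ => u ^ (e j)) 1 /
            i.factorial * (u - 1) ^ i := by
      rw [Finset.sum_filter, Finset.sum_product_right]
      refine Finset.sum_congr rfl fun j hj => ?_
      rw [← Finset.sum_filter, Finset.mul_sum]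
      refine Finset.sum_congr ?_ fun i _ => by ring
      have := Finset.mem_range.1 hj
      ext i
      simp only [Finset.mem_filter, Finset.mem_range]
      omega
    rw [hhead]
    have hmain : |∑ j ∈ Finset.range (m + 1), γ j * (u ^ (e j) * v ^ (e j)) * p ^ j -
        ∑ j ∈ Finset.range (m + 1), γ j * v ^ (e j) * p ^ j *
          ∑ i ∈ Finset.range (m - j + 1), iteratedDeriv i (fun u : ℝ => u ^ (e j)) 1 /
            i.factorial * (u - 1) ^ i| ≤
        (∑ j ∈ Finset.range (m + 1), γ j * (K (e j) * C j)) * δ ^ (m + 1) := by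
      rw [← Finset.sum_sub_distrib, Finset.sum_mul]
      refine (Finset.abs_sum_le_sum_abs _ _).trans (Finset.sum_le_sum fun j hj => ?_)
      have hjm : j ≤ m := Nat.lt_succ_iff.1 (Finset.mem_range.1 hj)
      have h1 := hC2 j 1 ⟨by norm_num, by norm_num⟩ u huI
      have h2 : γ j * (u ^ (e j) * v ^ (e j)) * p ^ j - γ j * v ^ (e j) * p ^ j *
          ∑ i ∈ Finset.range (m - j + 1), iteratedDeriv i (fun u : ℝ => u ^ (e j)) 1 /
            i.factorial * (u - 1) ^ i = γ j * v ^ (e j) * p ^ j * (u ^ (e j) -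
          ∑ i ∈ Finset.range (m - j + 1), iteratedDeriv i (fun u : ℝ => u ^ (e j)) 1 /
            i.factorial * (u - 1) ^ i) := by ring
      rw [h2, abs_mul, abs_mul, abs_mul, abs_of_nonneg (h.nonneg j), abs_pow]
      have h3 := hK (e j) v hvI
      have h4 := hK0 (e j)
      have h5 := h.nonneg j
      have h6 := hC j
      calc γ j * |v ^ (e j)| * |p| ^ j * _ ≤
            γ j * K (e j) * δ ^ j * (C j * δ ^ (m - j + 1)) := by
            refine mul_le_mul (by gcongr) (h1.trans (by gcongr)) (abs_nonneg _) (by positivity)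
        _ = γ j * (K (e j) * C j) * (δ ^ j * δ ^ (m - j + 1)) := by ring
        _ = _ := by rw [← pow_add, show j + (m - j + 1) = m + 1 by omega]
    rw [add_mul]
    exact (abs_sub_le _ _ _).trans (add_le_add htail hmain)

theorem hasKernelMoments (h : HasAngularSeries k D γ) : HasKernelMoments k := by
  intro A B hA
  set G : ℝ := ∑' j, γ j with hG
  have hG0 : 0 ≤ G := tsum_nonneg h.nonneg
  -- The fourth power of the kernel grows like ‖s‖^(4D), which 1 + ‖s‖^(2q) dominates.
  obtain ⟨q, hq⟩ := exists_nat_gt (2 * D)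
  have hq0 : q ≠ 0 := by
    rintro rfl
    have := h.pos
    norm_num at hq
    linarith
  set R : ℝ := ((2 : ℝ) ^ (D / 2) * G) ^ 4 with hR
  have hR0 : 0 ≤ R := by positivity
  refine ⟨R * (1 + A q), mul_nonneg hR0 (by linarith [hA q]), fun d Q τ hτ hQ z hz => ?_⟩
  have := hQ.isProbabilityMeasure
  have hτ0 : 0 < τ := by linarith
  have h1 : ∀ t : E d, ‖k d ((Real.sqrt τ)⁻¹ • t) z‖ₑ ^ 4 ≤
      ENNReal.ofReal R * (1 + ENNReal.ofReal (τ ^ q)⁻¹ * ‖t‖ₑ ^ (2 * q)) := by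
    intro t
    set s := (Real.sqrt τ)⁻¹ • t with hs
    have h2 : ‖z‖ ^ D ≤ 2 ^ (D / 2) := by
      have h3 : ‖z‖ ^ D = (‖z‖ ^ 2) ^ (D / 2) := by
        rw [← Real.rpow_natCast ‖z‖ 2, ← Real.rpow_mul (norm_nonneg _)]
        congr 1
        push_cast
        ring
      rw [h3]
      exact Real.rpow_le_rpow (by positivity) hz (by linarith [h.pos])
    have h4 : |k d s z| ^ 4 ≤ R * (1 + ‖s‖ ^ (2 * q)) := by
      have h5 : |k d s z| ≤ ‖s‖ ^ D * (2 ^ (D / 2) * G) := by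
        refine (h.abs_le d s z).trans ?_
        rw [Real.mul_rpow (norm_nonneg _) (norm_nonneg _), mul_assoc]
        have := Real.rpow_nonneg (norm_nonneg s) D
        gcongr
      have h6 : (‖s‖ ^ D) ^ 4 ≤ 1 + ‖s‖ ^ (2 * q) := by
        rw [← Real.rpow_mul_natCast (norm_nonneg _)]
        rcases le_total ‖s‖ 1 with h7 | h7
        · have := Real.rpow_le_one (norm_nonneg s) h7 (z := D * (4 : ℕ))
            (by have := h.pos; positivity)
          have := pow_nonneg (norm_nonneg s) (2 * q)
          linarith
        · have h8 := Real.rpow_le_rpow_of_exponent_le h7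
            (show D * (4 : ℕ) ≤ ((2 * q : ℕ) : ℝ) by push_cast; linarith)
          rw [Real.rpow_natCast] at h8
          linarith
      calc |k d s z| ^ 4 ≤ (‖s‖ ^ D * (2 ^ (D / 2) * G)) ^ 4 := by gcongr
        _ = (‖s‖ ^ D) ^ 4 * R := by rw [mul_pow]
        _ ≤ (1 + ‖s‖ ^ (2 * q)) * R := by gcongr
        _ = _ := mul_comm _ _
    have h9 : ‖s‖ ^ (2 * q) = (τ ^ q)⁻¹ * ‖t‖ ^ (2 * q) := by
      rw [pow_mul, hs, norm_inv_sqrt_smul_sq hτ0, div_pow, ← pow_mul, div_eq_inv_mul]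
    rw [h9] at h4
    rw [Real.enorm_eq_ofReal_abs, ← ENNReal.ofReal_pow (abs_nonneg _)]
    refine (ENNReal.ofReal_le_ofReal h4).trans_eq ?_
    rw [ENNReal.ofReal_mul hR0, ENNReal.ofReal_add zero_le_one (by positivity),
      ENNReal.ofReal_mul (by positivity), ENNReal.ofReal_pow (norm_nonneg _), ofReal_norm,
      ENNReal.ofReal_one]
  refine (lintegral_mono h1).trans ?_
  rw [lintegral_const_mul' _ _ ENNReal.ofReal_ne_top, lintegral_add_left measurable_const,
    lintegral_const_mul' _ _ ENNReal.ofReal_ne_top, lintegral_const, measure_univ, mul_one,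
    ENNReal.ofReal_mul hR0, ENNReal.ofReal_add zero_le_one (hA q), ENNReal.ofReal_one]
  gcongr
  refine (mul_le_mul' le_rfl (hQ.moment q hq0)).trans_eq ?_
  rw [← ENNReal.ofReal_mul (by positivity)]
  congr 1
  field_simp

theorem barrier (h : HasAngularSeries k D γ) {β : ℝ} (hβ : 0 < β) {j₀ : ℕ}
    (hj : ⌊2 / β⌋₊ < j₀) (hj₀ : 0 < γ j₀) : PolynomialApproximationBarrier.{u} k β :=
  polynomialApproximationBarrier hβ h.continuous h.isPSDKernelOn (h.hasEigenvalueBound hj hj₀)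
    (h.hasTaylorApproximation _) h.hasKernelMoments

end HasAngularSeries

/-! ### Hermite polynomials -/

section Hermite

open Polynomial

/-- The probabilists' Hermite polynomials with real coefficients. -/
noncomputable def hermiteReal (j : ℕ) : ℝ[X] := (hermite j).map (Int.castRingHom ℝ)

theorem hermiteFun_eq (j : ℕ) (v : ℝ) :
    hermiteFun j v = (hermiteReal j).eval v / Real.sqrt (j.factorial : ℝ) := by
  rw [hermiteFun, hermiteReal, aeval_def, eval₂_eq_eval_map, algebraMap_int_eq]

theorem hermiteReal_zero : hermiteReal 0 = 1 := by simp [hermiteReal]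

theorem hermiteReal_succ (j : ℕ) :
    hermiteReal (j + 1) = X * hermiteReal j - derivative (hermiteReal j) := by
  simp [hermiteReal, hermite_succ, derivative_map]

theorem derivative_hermiteReal_succ (j : ℕ) :
    derivative (hermiteReal (j + 1)) = C ((j : ℝ) + 1) * hermiteReal j := by
  induction j with
  | zero => simp [hermiteReal_succ, hermiteReal_zero]
  | succ j ih =>
    rw [hermiteReal_succ (j + 1), derivative_sub, derivative_mul, derivative_X, one_mul, ih,
      derivative_C_mul, hermiteReal_succ j]
    push_cast
    simp only [C_add, C_1]
    ring

theorem natDegree_hermiteReal (j : ℕ) : (hermiteReal j).natDegree = j := by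
  rw [hermiteReal, (hermite_monic j).natDegree_map, natDegree_hermite]

theorem hermiteReal_monic (j : ℕ) : (hermiteReal j).Monic := (hermite_monic j).map _

theorem integrable_polynomial (p : ℝ[X]) : Integrable (fun v => p.eval v) (gaussianReal 0 1) := by
  induction p using Polynomial.induction_on' with
  | add p q hp hq =>
    simp only [eval_add]
    exact hp.add hq
  | monomial n a =>
    simp only [eval_monomial]
    refine Integrable.const_mul ?_ a
    have h1 : Integrable (fun v : ℝ => ‖id v‖ ^ n) (gaussianReal 0 1) :=
      (memLp_id_gaussianReal' (μ := 0) (v := 1) n (by simp)).integrable_norm_pow'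
    refine (integrable_norm_iff (by fun_prop)).1 ?_
    simpa [norm_pow] using h1

theorem integrable_gaussianReal_iff {f : ℝ → ℝ} : Integrable f (gaussianReal 0 1) ↔
    Integrable fun v => gaussianPDFReal 0 1 v * f v := by
  rw [gaussianReal_of_var_ne_zero 0 one_ne_zero, integrable_withDensity_iff_integrable_smul'
    (measurable_gaussianPDF 0 1) (ae_of_all _ fun _ => gaussianPDF_lt_top)]
  simp only [toReal_gaussianPDF, smul_eq_mul]

theorem hasDerivAt_gaussianPDFReal (v : ℝ) :
    HasDerivAt (gaussianPDFReal 0 1) (-(v * gaussianPDFReal 0 1 v)) v := by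
  have h1 : gaussianPDFReal 0 1 = fun v : ℝ =>
      (Real.sqrt (2 * Real.pi))⁻¹ * Real.exp (-v ^ 2 / 2) := by
    ext v
    simp [gaussianPDFReal_def]
  rw [h1]
  have h2 : HasDerivAt (fun v : ℝ => -v ^ 2 / 2) (-v) v := by
    have := ((hasDerivAt_pow 2 v).neg).div_const 2
    refine this.congr_deriv ?_
    norm_num
    ring
  refine (h2.exp.const_mul _).congr_deriv ?_
  ring

/-- Stein's identity: the derivative of density times polynomial integrates to zero. -/
theorem integral_id_mul_polynomial (p : ℝ[X]) :
    ∫ v, v * p.eval v ∂(gaussianReal 0 1) = ∫ v, p.derivative.eval v ∂(gaussianReal 0 1) := by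
  have h1 := integrable_polynomial (derivative p)
  have h2 := integrable_polynomial (X * p)
  simp only [eval_mul, eval_X] at h2
  rw [← sub_eq_zero, ← integral_sub h2 h1, integral_gaussianReal_eq_integral_smul one_ne_zero,
    ← neg_eq_zero, ← integral_neg]
  refine integral_eq_zero_of_hasDerivAt_of_integrable
    (f := fun v => gaussianPDFReal 0 1 v * p.eval v) (fun v => ?_) ?_
    (integrable_gaussianReal_iff.1 (integrable_polynomial p))
  · refine ((hasDerivAt_gaussianPDFReal v).mul (p.hasDerivAt v)).congr_deriv ?_
    rw [smul_eq_mul]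
    ring
  · exact (integrable_gaussianReal_iff.1 (h2.sub h1)).neg

/-- By Stein's identity, multiplication by v minus differentiation, which raises the index, is
adjoint to differentiation, which lowers it. -/
theorem integral_hermiteReal_mul (i j : ℕ) :
    ∫ v, (hermiteReal i).eval v * (hermiteReal j).eval v ∂(gaussianReal 0 1) =
      if i = j then (j.factorial : ℝ) else 0 := by
  have h0 : ∀ j, ∫ v, (hermiteReal (j + 1)).eval v ∂(gaussianReal 0 1) = 0 := by
    intro j
    have h2 := integrable_polynomial (X * hermiteReal j)
    simp only [eval_mul, eval_X] at h2
    simp only [hermiteReal_succ, eval_sub, eval_mul, eval_X]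
    rw [integral_sub h2 (integrable_polynomial _), integral_id_mul_polynomial, sub_self]
  induction i generalizing j with
  | zero =>
    cases j with
    | zero => simp [hermiteReal_zero]
    | succ j => simpa [hermiteReal_zero] using h0 j
  | succ i ih =>
    cases j with
    | zero => simpa [hermiteReal_zero] using h0 i
    | succ j =>
      have h1 : ∀ v, (hermiteReal (i + 1)).eval v * (hermiteReal (j + 1)).eval v =
          v * (hermiteReal i * hermiteReal (j + 1)).eval v -
            (derivative (hermiteReal i) * hermiteReal (j + 1)).eval v := by
        intro v
        rw [hermiteReal_succ i]
        simp only [eval_sub, eval_mul, eval_X]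
        ring
      have h2 := integrable_polynomial (X * (hermiteReal i * hermiteReal (j + 1)))
      simp only [eval_mul (p := X), eval_X] at h2
      simp only [h1]
      rw [integral_sub h2 (integrable_polynomial _), integral_id_mul_polynomial,
        ← integral_sub (integrable_polynomial _) (integrable_polynomial _)]
      have h3 : ∀ v, (derivative (hermiteReal i * hermiteReal (j + 1))).eval v -
          (derivative (hermiteReal i) * hermiteReal (j + 1)).eval v =
          ((j : ℝ) + 1) * ((hermiteReal i).eval v * (hermiteReal j).eval v) := by
        intro v
        rw [derivative_mul, derivative_hermiteReal_succ]
        simp only [eval_add, eval_mul, eval_C]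
        ring
      simp only [h3]
      rw [integral_const_mul, ih]
      simp only [Nat.add_right_cancel_iff, Nat.factorial_succ]
      split_ifs <;> simp

/-- The Hermite polynomials are eigenfunctions of the Ornstein-Uhlenbeck semigroup. The induction
follows their three-term recursion, with Stein's identity for the term w · q(w). -/
theorem integral_hermiteReal_affine {ρ s : ℝ} (h : ρ ^ 2 + s ^ 2 = 1) (u : ℝ) (j : ℕ) :
    ∫ w, (hermiteReal j).eval (ρ * u + s * w) ∂(gaussianReal 0 1) =
      ρ ^ j * (hermiteReal j).eval u := by
  induction j using Nat.twoStepInduction with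
  | zero => simp [hermiteReal_zero]
  | one =>
    have h1 := integrable_polynomial (C s * X)
    simp only [eval_mul, eval_X, eval_C] at h1
    simp only [hermiteReal_succ, hermiteReal_zero, mul_one, derivative_one, sub_zero, eval_X]
    rw [integral_add (integrable_const _) h1, integral_const_mul s, integral_id_gaussianReal]
    simp
  | more j ih1 ih2 =>
    set q : ℝ[X] := (hermiteReal (j + 1)).comp (C (ρ * u) + C s * X) with hq
    have hqe : ∀ w, q.eval w = (hermiteReal (j + 1)).eval (ρ * u + s * w) := fun w => by
      simp [hq]
    have hqd : ∀ w, q.derivative.eval w =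
        s * ((j + 1) * (hermiteReal j).eval (ρ * u + s * w)) := fun w => by
      simp [hq, derivative_comp, derivative_hermiteReal_succ]
    set r : ℝ[X] := (hermiteReal j).comp (C (ρ * u) + C s * X) with hr
    have hre : ∀ w, r.eval w = (hermiteReal j).eval (ρ * u + s * w) := fun w => by
      simp [hr]
    have h1 : ∀ w, (hermiteReal (j + 2)).eval (ρ * u + s * w) =
        (ρ * u * q.eval w + s * (w * q.eval w)) - ((j : ℝ) + 1) * r.eval w := by
      intro w
      rw [hermiteReal_succ (j + 1), derivative_hermiteReal_succ, hqe, hre]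
      simp only [eval_sub, eval_mul, eval_X, eval_C]
      ring
    have hi1 := integrable_polynomial (X * q)
    simp only [eval_mul, eval_X] at hi1
    have hi2 := integrable_polynomial q
    have hi3 := integrable_polynomial r
    simp only [h1]
    rw [integral_sub (Integrable.fun_add (hi2.const_mul _) (hi1.const_mul _)) (hi3.const_mul _),
      integral_add (hi2.const_mul _) (hi1.const_mul _), integral_const_mul, integral_const_mul,
      integral_const_mul, integral_id_mul_polynomial]
    simp only [hqd, hqe, hre]
    rw [integral_const_mul, integral_const_mul, ih1, ih2, hermiteReal_succ (j + 1),
      derivative_hermiteReal_succ]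
    simp only [eval_sub, eval_mul, eval_X, eval_C]
    linear_combination (((j : ℝ) + 1) * ρ ^ j * (hermiteReal j).eval u) * h

theorem memLp_polynomial (p : ℝ[X]) : MemLp (fun v => p.eval v) 2 (gaussianReal 0 1) := by
  rw [memLp_two_iff_integrable_sq (by fun_prop)]
  have h := integrable_polynomial (p ^ 2)
  simpa only [eval_pow] using h

theorem memLp_hermiteFun (j : ℕ) : MemLp (hermiteFun j) 2 (gaussianReal 0 1) := by
  have h1 : hermiteFun j = fun v => (Real.sqrt (j.factorial : ℝ))⁻¹ * (hermiteReal j).eval v := by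
    ext v
    rw [hermiteFun_eq, div_eq_inv_mul]
  rw [h1]
  exact (memLp_polynomial _).const_mul _

theorem integral_hermiteFun_mul (i j : ℕ) :
    ∫ v, hermiteFun i v * hermiteFun j v ∂(gaussianReal 0 1) = if i = j then 1 else 0 := by
  have h1 : ∀ v, hermiteFun i v * hermiteFun j v = (Real.sqrt (i.factorial : ℝ))⁻¹ *
      (Real.sqrt (j.factorial : ℝ))⁻¹ * ((hermiteReal i).eval v * (hermiteReal j).eval v) := by
    intro v
    rw [hermiteFun_eq, hermiteFun_eq]
    ring
  simp only [h1]
  rw [integral_const_mul, integral_hermiteReal_mul]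
  split_ifs with h
  · subst h
    rw [← mul_inv, Real.mul_self_sqrt (by positivity), inv_mul_cancel₀ (by positivity)]
  · rw [mul_zero]

end Hermite

/-! ### Correlated Gaussian pairs -/

/-- A standard normal variable with correlation `ρ` to the first coordinate. -/
noncomputable def corrMap (ρ : ℝ) (p : ℝ × ℝ) : ℝ := ρ * p.1 + Real.sqrt (1 - ρ ^ 2) * p.2

theorem measurable_corrMap (ρ : ℝ) : Measurable (corrMap ρ) := by
  unfold corrMap
  fun_prop

theorem sq_add_sq_sqrt {ρ : ℝ} (hρ : ρ ∈ Set.Icc (-1 : ℝ) 1) :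
    ρ ^ 2 + Real.sqrt (1 - ρ ^ 2) ^ 2 = 1 := by
  rw [Real.sq_sqrt (by nlinarith [hρ.1, hρ.2])]
  ring

theorem measurePreserving_corrMap {ρ : ℝ} (hρ : ρ ∈ Set.Icc (-1 : ℝ) 1) :
    MeasurePreserving (corrMap ρ) ((gaussianReal 0 1).prod (gaussianReal 0 1))
      (gaussianReal 0 1) := by
  refine ⟨measurable_corrMap ρ, ?_⟩
  have h1 : corrMap ρ = (fun p : ℝ × ℝ => p.1 + p.2) ∘
      Prod.map (fun u => ρ * u) (fun w => Real.sqrt (1 - ρ ^ 2) * w) := rfl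
  rw [h1, ← Measure.map_map (by fun_prop) (by fun_prop),
    ← Measure.map_prod_map _ _ (by fun_prop) (by fun_prop), gaussianReal_map_const_mul,
    gaussianReal_map_const_mul]
  change Measure.conv _ _ = _
  rw [gaussianReal_conv_gaussianReal]
  congr 1
  · simp
  · ext
    simpa using sq_add_sq_sqrt hρ

theorem integral_hermiteFun_corrMap {ρ : ℝ} (hρ : ρ ∈ Set.Icc (-1 : ℝ) 1) (i j : ℕ) :
    ∫ p, hermiteFun i p.1 * hermiteFun j (corrMap ρ p)
      ∂((gaussianReal 0 1).prod (gaussianReal 0 1)) = if i = j then ρ ^ j else 0 := by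
  rw [integral_prod]
  · have h1 : ∀ u, ∫ w, hermiteFun i (u, w).1 * hermiteFun j (corrMap ρ (u, w))
        ∂(gaussianReal 0 1) = ρ ^ j * (hermiteFun i u * hermiteFun j u) := by
      intro u
      simp only [corrMap]
      rw [integral_const_mul]
      simp only [hermiteFun_eq j]
      rw [integral_div, integral_hermiteReal_affine (sq_add_sq_sqrt hρ)]
      ring
    simp only [h1]
    rw [integral_const_mul, integral_hermiteFun_mul]
    split_ifs <;> simp
  · exact ((memLp_hermiteFun i).comp_measurePreserving measurePreserving_fst).integrable_mul
      ((memLp_hermiteFun j).comp_measurePreserving (measurePreserving_corrMap hρ))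

theorem tendsto_integral_mul {Ω : Type*} [MeasurableSpace Ω] {μ : Measure Ω} {f g : Ω → ℝ}
    {fn gn : ℕ → Ω → ℝ} (hf : MemLp f 2 μ) (hg : MemLp g 2 μ) (hfn : ∀ n, MemLp (fn n) 2 μ)
    (hgn : ∀ n, MemLp (gn n) 2 μ)
    (h1 : Tendsto (fun n => eLpNorm (fn n - f) 2 μ) atTop (𝓝 0))
    (h2 : Tendsto (fun n => eLpNorm (gn n - g) 2 μ) atTop (𝓝 0)) :
    Tendsto (fun n => ∫ ω, fn n ω * gn n ω ∂μ) atTop (𝓝 (∫ ω, f ω * g ω ∂μ)) := by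
  have hin : ∀ {a b : Ω → ℝ} (ha : MemLp a 2 μ) (hb : MemLp b 2 μ),
      inner ℝ (ha.toLp a) (hb.toLp b) = ∫ ω, a ω * b ω ∂μ := by
    intro a b ha hb
    rw [L2.inner_def]
    refine integral_congr_ae ?_
    filter_upwards [ha.coeFn_toLp, hb.coeFn_toLp] with ω h3 h4
    rw [h3, h4]
    simp [mul_comm]
  have h3 := ((Lp.tendsto_Lp_iff_tendsto_eLpNorm'' fn hfn f hf).2 h1).inner
    ((Lp.tendsto_Lp_iff_tendsto_eLpNorm'' gn hgn g hg).2 h2) (𝕜 := ℝ)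
  simpa only [hin] using h3

section Expansion

variable {φ : ℝ → ℝ} {a : ℕ → ℝ}

theorem memLp_hermiteSum (a : ℕ → ℝ) (N : ℕ) :
    MemLp (fun v => ∑ j ∈ Finset.range N, a j * hermiteFun j v) 2 (gaussianReal 0 1) :=
  memLp_finsetSum _ fun j _ => (memLp_hermiteFun j).const_mul _

theorem integral_hermiteSum_corrMap (a : ℕ → ℝ) (N : ℕ) {ρ : ℝ} (hρ : ρ ∈ Set.Icc (-1 : ℝ) 1) :
    ∫ p, (∑ j ∈ Finset.range N, a j * hermiteFun j p.1) *
      (∑ j ∈ Finset.range N, a j * hermiteFun j (corrMap ρ p))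
      ∂((gaussianReal 0 1).prod (gaussianReal 0 1)) =
      ∑ j ∈ Finset.range N, a j ^ 2 * ρ ^ j := by
  have hint : ∀ i j : ℕ, Integrable (fun p : ℝ × ℝ => a i * hermiteFun i p.1 *
      (a j * hermiteFun j (corrMap ρ p))) ((gaussianReal 0 1).prod (gaussianReal 0 1)) :=
    fun i j => (((memLp_hermiteFun i).const_mul (a i)).comp_measurePreserving
      measurePreserving_fst).integrable_mul
      (((memLp_hermiteFun j).const_mul (a j)).comp_measurePreserving
        (measurePreserving_corrMap hρ))
  simp only [Finset.sum_mul_sum]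
  rw [integral_finsetSum _ fun i _ => integrable_finsetSum _ fun j _ => hint i j]
  refine Finset.sum_congr rfl fun i hi => ?_
  rw [integral_finsetSum _ fun j _ => hint i j]
  have h1 : ∀ j, ∫ p : ℝ × ℝ, a i * hermiteFun i p.1 * (a j * hermiteFun j (corrMap ρ p))
      ∂((gaussianReal 0 1).prod (gaussianReal 0 1)) =
      if i = j then a i * a j * ρ ^ j else 0 := by
    intro j
    have h2 : ∀ p : ℝ × ℝ, a i * hermiteFun i p.1 * (a j * hermiteFun j (corrMap ρ p)) =
        a i * a j * (hermiteFun i p.1 * hermiteFun j (corrMap ρ p)) := fun p => by ring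
    simp only [h2]
    rw [integral_const_mul, integral_hermiteFun_corrMap hρ]
    split_ifs <;> simp
  simp only [h1]
  rw [Finset.sum_ite_eq, if_pos hi, sq]

/-- The expectation is the L² inner product of φ at two standard normal variables with correlation
ρ, hence continuous in both factors. For the partial sums, the orthogonality relations leave only
the diagonal terms aⱼ² ρʲ. -/
theorem HasHermiteExpansion.tendsto (h : HasHermiteExpansion φ a) {ρ : ℝ}
    (hρ : ρ ∈ Set.Icc (-1 : ℝ) 1) :
    Tendsto (fun N => ∑ j ∈ Finset.range N, a j ^ 2 * ρ ^ j) atTop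
      (𝓝 (∫ p, φ p.1 * φ (corrMap ρ p) ∂((gaussianReal 0 1).prod (gaussianReal 0 1)))) := by
  have hfst : MeasurePreserving Prod.fst ((gaussianReal 0 1).prod (gaussianReal 0 1))
      (gaussianReal 0 1) := measurePreserving_fst
  have hcor := measurePreserving_corrMap hρ
  have h1 : Tendsto (fun N : ℕ => eLpNorm (fun v => ∑ j ∈ Finset.range N, a j * hermiteFun j v
      - φ v) 2 (gaussianReal 0 1)) atTop (𝓝 0) := by
    refine h.2.congr fun N => ?_
    rw [← eLpNorm_neg]
    congr 1
    ext v
    simp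
  have h2 : ∀ {g : ℝ × ℝ → ℝ}, MeasurePreserving g ((gaussianReal 0 1).prod (gaussianReal 0 1))
      (gaussianReal 0 1) → Tendsto (fun N : ℕ => eLpNorm
        ((fun p => ∑ j ∈ Finset.range N, a j * hermiteFun j (g p)) - fun p => φ (g p)) 2
        ((gaussianReal 0 1).prod (gaussianReal 0 1))) atTop (𝓝 0) := by
    intro g hg
    refine h1.congr fun N => ?_
    exact (eLpNorm_comp_measurePreserving ((memLp_hermiteSum a N).sub h.1).1 hg).symm
  have h3 := tendsto_integral_mul (h.1.comp_measurePreserving hfst)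
    (h.1.comp_measurePreserving hcor)
    (fun N => (memLp_hermiteSum a N).comp_measurePreserving hfst)
    (fun N => (memLp_hermiteSum a N).comp_measurePreserving hcor) (h2 hfst) (h2 hcor)
  simpa only [Function.comp_def, integral_hermiteSum_corrMap a _ hρ] using h3

theorem HasHermiteExpansion.hasSum_sq (h : HasHermiteExpansion φ a) :
    HasSum (fun j => a j ^ 2) (∫ v, φ v ^ 2 ∂(gaussianReal 0 1)) := by
  rw [hasSum_iff_tendsto_nat_of_nonneg fun j => sq_nonneg _]
  have h1 := h.tendsto (ρ := 1) ⟨by norm_num, le_rfl⟩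
  have h2 : ∫ p : ℝ × ℝ, φ p.1 * φ (corrMap 1 p) ∂((gaussianReal 0 1).prod (gaussianReal 0 1)) =
      ∫ v, φ v ^ 2 ∂(gaussianReal 0 1) := by
    have h3 : ∀ p : ℝ × ℝ, φ p.1 * φ (corrMap 1 p) = (fun v => φ v ^ 2) p.1 := by
      intro p
      simp [corrMap, sq]
    simp only [h3]
    rw [integral_fun_fst (f := fun v : ℝ => φ v ^ 2)]
    simp
  simpa only [h2, one_pow, mul_one] using h1

theorem HasHermiteExpansion.hasSum (h : HasHermiteExpansion φ a) {ρ : ℝ}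
    (hρ : ρ ∈ Set.Icc (-1 : ℝ) 1) : HasSum (fun j => a j ^ 2 * ρ ^ j)
      (∫ p, φ p.1 * φ (corrMap ρ p) ∂((gaussianReal 0 1).prod (gaussianReal 0 1))) := by
  have h1 : Summable fun j => a j ^ 2 * ρ ^ j := by
    refine Summable.of_norm_bounded h.hasSum_sq.summable fun j => ?_
    rw [norm_mul, norm_pow ρ, Real.norm_of_nonneg (sq_nonneg (a j))]
    exact mul_le_of_le_one_right (sq_nonneg _) (pow_le_one₀ (norm_nonneg _) (abs_le.2 hρ))
  have h2 := tendsto_nhds_unique h1.hasSum.tendsto_sum_nat (h.tendsto hρ)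
  rw [← h2]
  exact h1.hasSum

end Expansion

/-! ### The bivariate Gaussian law -/

/-- Both laws have the same characteristic function. Degenerate covariances, with α or χ zero or ρ =
±1, are included, as the recursion meets them for zero or parallel inputs. -/
theorem map_prod_eq_multivariateGaussian (α χ : ℝ) {ρ : ℝ} (hρ : ρ ∈ Set.Icc (-1 : ℝ) 1) :
    ((gaussianReal 0 1).prod (gaussianReal 0 1)).map
      (fun p => WithLp.toLp 2 ![α * p.1, χ * corrMap ρ p]) =
      multivariateGaussian 0 !![α ^ 2, α * χ * ρ; α * χ * ρ, χ ^ 2] := by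
  set s := Real.sqrt (1 - ρ ^ 2) with hs
  have hs2 : ρ ^ 2 + s ^ 2 = 1 := sq_add_sq_sqrt hρ
  have hquad : ∀ t : Fin 2 → ℝ, t ⬝ᵥ (!![α ^ 2, α * χ * ρ; α * χ * ρ, χ ^ 2]).mulVec t =
      (α * t 0 + χ * ρ * t 1) ^ 2 + (χ * s * t 1) ^ 2 := by
    intro t
    simp only [Matrix.mulVec, dotProduct, Fin.sum_univ_two, Matrix.of_apply, Matrix.cons_val_zero,
      Matrix.cons_val_one, Matrix.cons_val', Matrix.cons_val_fin_one]
    linear_combination (-(χ ^ 2 * t 1 ^ 2)) * hs2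
  have hpsd : (!![α ^ 2, α * χ * ρ; α * χ * ρ, χ ^ 2] : Matrix (Fin 2) (Fin 2) ℝ).PosSemidef := by
    refine Matrix.PosSemidef.of_dotProduct_mulVec_nonneg ?_ fun t => ?_
    · ext i j
      fin_cases i <;> fin_cases j <;> simp
    · rw [star_trivial, hquad]
      positivity
  have hmeas : Measurable fun p : ℝ × ℝ =>
      (WithLp.toLp 2 ![α * p.1, χ * corrMap ρ p] : EuclideanSpace ℝ (Fin 2)) := by
    refine (WithLp.measurable_toLp 2 _).comp (measurable_pi_iff.2 fun i => ?_)
    have := measurable_corrMap ρ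
    fin_cases i <;> simp <;> fun_prop
  have := Measure.isProbabilityMeasure_map (μ := (gaussianReal 0 1).prod (gaussianReal 0 1))
    hmeas.aemeasurable
  refine Measure.ext_of_charFun (funext fun t => ?_)
  rw [charFun_multivariateGaussian hpsd, hquad, charFun_apply, integral_map hmeas.aemeasurable
    (by fun_prop)]
  have h1 : ∀ p : ℝ × ℝ, Complex.exp (((inner ℝ (WithLp.toLp 2 ![α * p.1, χ * corrMap ρ p] :
      EuclideanSpace ℝ (Fin 2)) t : ℝ) : ℂ) * Complex.I) =
      Complex.exp (((α * t 0 + χ * ρ * t 1 : ℝ) : ℂ) * (p.1 : ℂ) * Complex.I) *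
      Complex.exp (((χ * s * t 1 : ℝ) : ℂ) * (p.2 : ℂ) * Complex.I) := by
    intro p
    rw [← Complex.exp_add, PiLp.inner_apply, Fin.sum_univ_two]
    congr 1
    simp only [RCLike.inner_apply, conj_trivial, Matrix.cons_val_zero, Matrix.cons_val_one,
      corrMap, Matrix.cons_val_fin_one]
    push_cast
    ring
  simp only [h1]
  rw [integral_prod_mul (f := fun u : ℝ => Complex.exp (((α * t 0 + χ * ρ * t 1 : ℝ) : ℂ) *
    (u : ℂ) * Complex.I)) (g := fun w : ℝ => Complex.exp (((χ * s * t 1 : ℝ) : ℂ) * (w : ℂ) *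
    Complex.I)), ← charFun_apply_real, ← charFun_apply_real, charFun_gaussianReal,
    charFun_gaussianReal, ← Complex.exp_add]
  congr 1
  simp
  ring

theorem integral_multivariateGaussian_mul {f g : ℝ → ℝ} (hf : Measurable f) (hg : Measurable g)
    (α χ : ℝ) {ρ : ℝ} (hρ : ρ ∈ Set.Icc (-1 : ℝ) 1) :
    ∫ z, f (z 0) * g (z 1) ∂(multivariateGaussian 0
      !![α ^ 2, α * χ * ρ; α * χ * ρ, χ ^ 2]) =
    ∫ p, f (α * p.1) * g (χ * corrMap ρ p) ∂((gaussianReal 0 1).prod (gaussianReal 0 1)) := by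
  rw [← map_prod_eq_multivariateGaussian α χ hρ, integral_map]
  · simp
  · refine Measurable.aemeasurable ?_
    refine (WithLp.measurable_toLp 2 _).comp (measurable_pi_iff.2 fun i => ?_)
    have := measurable_corrMap ρ
    fin_cases i <;> simp <;> fun_prop
  · refine Measurable.aestronglyMeasurable ?_
    exact (hf.comp (by fun_prop)).mul (hg.comp (by fun_prop))

/-! ### Power series with nonnegative summable coefficients -/

/-- On `[-1, 1]`, the function `f` is the sum of a power series with nonnegative summable
coefficients, the one of order `k` being positive. -/
def HasNonnegSeries (f : ℝ → ℝ) (k : ℕ) : Prop :=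
  ∃ γ : ℕ → ℝ, (∀ j, 0 ≤ γ j) ∧ Summable γ ∧ 0 < γ k ∧
    ∀ ρ ∈ Set.Icc (-1 : ℝ) 1, HasSum (fun j => γ j * ρ ^ j) (f ρ)

theorem abs_mul_pow_le {c ρ : ℝ} (hc : 0 ≤ c) (hρ : ρ ∈ Set.Icc (-1 : ℝ) 1) (j : ℕ) :
    ‖c * ρ ^ j‖ ≤ c := by
  rw [norm_mul, norm_pow, Real.norm_of_nonneg hc]
  exact mul_le_of_le_one_right hc (pow_le_one₀ (norm_nonneg _) (abs_le.2 hρ))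

/-- Collecting the terms of equal degree in an absolutely convergent family. Products and
compositions produce double series, which are brought into the form of a power series in this way.
-/
theorem hasNonnegSeries_of_degree {ι : Type} {c : ι → ℝ} (hc : ∀ i, 0 ≤ c i) (hs : Summable c)
    (deg : ι → ℕ) {i₀ : ι} (hi₀ : 0 < c i₀) {f : ℝ → ℝ}
    (hf : ∀ ρ ∈ Set.Icc (-1 : ℝ) 1, HasSum (fun i => c i * ρ ^ deg i) (f ρ)) :
    HasNonnegSeries f (deg i₀) := by
  have hfib : ∀ n, Summable fun i : {i // deg i = n} => c i := fun n => hs.subtype _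
  refine ⟨fun n => ∑' i : {i // deg i = n}, c i, fun n => tsum_nonneg fun i => hc i, ?_, ?_,
    fun ρ hρ => ?_⟩
  · exact ((Equiv.sigmaFiberEquiv deg).summable_iff.2 hs).sigma
  · exact (hfib (deg i₀)).tsum_pos (fun i => hc i) ⟨i₀, rfl⟩ hi₀
  · refine ((Equiv.sigmaFiberEquiv deg).hasSum_iff.2 (hf ρ hρ)).sigma fun n => ?_
    have h1 := (hfib n).hasSum.mul_right (ρ ^ n)
    refine h1.congr_fun fun i => ?_
    simp [Equiv.sigmaFiberEquiv, i.2]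

namespace HasNonnegSeries

variable {f g : ℝ → ℝ} {k l : ℕ}

theorem congr (hf : HasNonnegSeries f k) (h : ∀ ρ ∈ Set.Icc (-1 : ℝ) 1, f ρ = g ρ) :
    HasNonnegSeries g k := by
  obtain ⟨γ, h1, h2, h3, h4⟩ := hf
  exact ⟨γ, h1, h2, h3, fun ρ hρ => h ρ hρ ▸ h4 ρ hρ⟩

theorem one : HasNonnegSeries (fun _ => 1) 0 := by
  refine hasNonnegSeries_of_degree (ι := Unit) (c := fun _ => 1) (fun _ => zero_le_one)
    (Summable.of_finite) (fun _ => 0) (i₀ := ()) one_pos fun ρ _ => ?_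
  simp

theorem id : HasNonnegSeries (fun ρ => ρ) 1 := by
  refine hasNonnegSeries_of_degree (ι := Unit) (c := fun _ => 1) (fun _ => zero_le_one)
    (Summable.of_finite) (fun _ => 1) (i₀ := ()) one_pos fun ρ _ => ?_
  simp

theorem add {l' : ℕ} (hf : HasNonnegSeries f k) (hg : HasNonnegSeries g l') :
    HasNonnegSeries (fun ρ => g ρ + f ρ) k := by
  obtain ⟨a, h1, h2, h3, h4⟩ := hf
  obtain ⟨b, h1', h2', -, h4'⟩ := hg
  exact ⟨fun j => b j + a j, fun j => add_nonneg (h1' j) (h1 j), h2'.add h2,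
    add_pos_of_nonneg_of_pos (h1' k) h3, fun ρ hρ => by
      simpa only [add_mul] using (h4' ρ hρ).add (h4 ρ hρ)⟩

theorem mul (hf : HasNonnegSeries f k) (hg : HasNonnegSeries g l) :
    HasNonnegSeries (fun ρ => f ρ * g ρ) (k + l) := by
  obtain ⟨a, h1, h2, h3, h4⟩ := hf
  obtain ⟨b, h1', h2', h3', h4'⟩ := hg
  have hs : Summable fun p : ℕ × ℕ => a p.1 * b p.2 := h2.mul_of_nonneg h2' h1 h1'
  refine hasNonnegSeries_of_degree (ι := ℕ × ℕ) (c := fun p => a p.1 * b p.2)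
    (fun p => mul_nonneg (h1 _) (h1' _)) hs (fun p => p.1 + p.2) (i₀ := (k, l))
    (mul_pos h3 h3') fun ρ hρ => ?_
  have h5 : (fun p : ℕ × ℕ => a p.1 * b p.2 * ρ ^ (p.1 + p.2)) =
      fun p => (a p.1 * ρ ^ p.1) * (b p.2 * ρ ^ p.2) := by
    ext p
    rw [pow_add]
    ring
  have h6 : Summable fun p : ℕ × ℕ => a p.1 * b p.2 * ρ ^ (p.1 + p.2) :=
    Summable.of_norm_bounded hs fun p => abs_mul_pow_le (mul_nonneg (h1 _) (h1' _)) hρ _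
  rw [h5] at h6 ⊢
  exact (h4 ρ hρ).mul (h4' ρ hρ) h6

theorem pow (hf : HasNonnegSeries f k) (j : ℕ) : HasNonnegSeries (fun ρ => f ρ ^ j) (k * j) := by
  induction j with
  | zero => simpa using one
  | succ j ih => simpa only [pow_succ, mul_add, mul_one] using ih.mul hf

theorem abs_le (hf : HasNonnegSeries f k) {ρ : ℝ} (hρ : ρ ∈ Set.Icc (-1 : ℝ) 1) :
    |f ρ| ≤ f 1 := by
  obtain ⟨a, h1, h2, -, h4⟩ := hf
  have h5 : HasSum a (f 1) := by simpa using h4 1 ⟨by norm_num, le_rfl⟩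
  rw [← (h4 ρ hρ).tsum_eq]
  exact tsum_of_norm_bounded h5 fun j => abs_mul_pow_le (h1 j) hρ j

/-- The double series is obtained by expanding each power of `g`. It is summable because at ρ = 1
its inner sums are g(1)^j and g(1) ≤ 1. The positive terms of order `k` of `f` and of order `l * k`
of g^k give the positive one. -/
theorem comp (hf : HasNonnegSeries f k) (hg : HasNonnegSeries g l) (hg1 : g 1 ≤ 1) :
    HasNonnegSeries (fun ρ => f (g ρ)) (l * k) := by
  obtain ⟨a, h1, h2, h3, h4⟩ := hf
  choose b hb1 hb2 hb3 hb4 using fun j => hg.pow j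
  have hgmem : ∀ ρ ∈ Set.Icc (-1 : ℝ) 1, g ρ ∈ Set.Icc (-1 : ℝ) 1 := fun ρ hρ =>
    _root_.abs_le.1 ((hg.abs_le hρ).trans hg1)
  have hone : (1 : ℝ) ∈ Set.Icc (-1 : ℝ) 1 := ⟨by norm_num, le_rfl⟩
  have hnn : ∀ p : ℕ × ℕ, 0 ≤ a p.1 * b p.1 p.2 := fun p => mul_nonneg (h1 _) (hb1 _ _)
  have hs : Summable fun p : ℕ × ℕ => a p.1 * b p.1 p.2 := by
    rw [summable_prod_of_nonneg hnn]
    have h6 : ∀ j, Summable fun i => a j * b j i := fun j => (hb2 j).mul_left (a j)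
    refine ⟨h6, ?_⟩
    have h5 : ∀ j, ∑' i, a j * b j i = a j * g 1 ^ j := by
      intro j
      rw [tsum_mul_left]
      congr 1
      simpa using (hb4 j 1 hone).tsum_eq
    simp only [h5]
    exact (h4 _ (hgmem 1 hone)).summable
  refine hasNonnegSeries_of_degree (ι := ℕ × ℕ) (c := fun p => a p.1 * b p.1 p.2) hnn hs
    (fun p => p.2) (i₀ := (k, l * k)) (mul_pos h3 (hb3 k)) fun ρ hρ => ?_
  have h6 : Summable fun p : ℕ × ℕ => a p.1 * b p.1 p.2 * ρ ^ p.2 :=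
    Summable.of_norm_bounded hs fun p => abs_mul_pow_le (hnn p) hρ _
  have h7 := h6.hasSum.prod_fiberwise (g := fun j => a j * g ρ ^ j) fun j => by
    simpa only [mul_assoc] using (hb4 j ρ hρ).mul_left (a j)
  rw [(h4 _ (hgmem ρ hρ)).unique h7]
  exact h6.hasSum

theorem finset_prod {s : Finset ℕ} {F : ℕ → ℝ → ℝ}
    (h : ∀ i ∈ s, ∃ k, HasNonnegSeries (F i) k) :
    ∃ k, HasNonnegSeries (fun ρ => ∏ i ∈ s, F i ρ) k := by
  induction s using Finset.induction_on with
  | empty => exact ⟨0, by simpa using one⟩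
  | insert i s hi ih =>
    obtain ⟨k, hk⟩ := ih fun j hj => h j (Finset.mem_insert_of_mem hj)
    obtain ⟨l, hl⟩ := h i (Finset.mem_insert_self i s)
    exact ⟨l + k, (hl.mul hk).congr fun ρ _ => (Finset.prod_insert (f := fun i => F i ρ) hi).symm⟩

theorem finset_sum_add (hf : HasNonnegSeries f k) {s : Finset ℕ} {F : ℕ → ℝ → ℝ}
    (h : ∀ i ∈ s, ∃ k, HasNonnegSeries (F i) k) :
    HasNonnegSeries (fun ρ => ∑ i ∈ s, F i ρ + f ρ) k := by
  induction s using Finset.induction_on with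
  | empty => simpa using hf
  | insert i s hi ih =>
    obtain ⟨l, hl⟩ := h i (Finset.mem_insert_self i s)
    refine ((ih fun j hj => h j (Finset.mem_insert_of_mem hj)).add hl).congr fun ρ _ => ?_
    rw [Finset.sum_insert hi]
    ring

end HasNonnegSeries

/-! ### Dual activations of homogeneous functions -/

/-- The normalised dual activation as a function of the correlation. -/
noncomputable def dualFun (φ : ℝ → ℝ) (ρ : ℝ) : ℝ :=
  normConst φ * ∫ p, φ p.1 * φ (corrMap ρ p) ∂((gaussianReal 0 1).prod (gaussianReal 0 1))

section Dual

variable {φ : ℝ → ℝ} {a : ℕ → ℝ}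

theorem HasHermiteExpansion.hasNonnegSeries_dualFun (h : HasHermiteExpansion φ a) {j : ℕ}
    (hj : a j ≠ 0) : HasNonnegSeries (dualFun φ) j := by
  have h1 : 0 < ∫ v, φ v ^ 2 ∂(gaussianReal 0 1) := by
    rw [← h.hasSum_sq.tsum_eq]
    exact h.hasSum_sq.summable.tsum_pos (fun i => sq_nonneg _) j (by positivity)
  have h2 : 0 < normConst φ := inv_pos.2 h1
  refine ⟨fun j => normConst φ * a j ^ 2, fun j => by positivity,
    h.hasSum_sq.summable.mul_left _, by positivity, fun ρ hρ => ?_⟩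
  simpa only [mul_assoc, dualFun] using (h.hasSum hρ).mul_left (normConst φ)

theorem dualFun_one (h : ∫ v, φ v ^ 2 ∂(gaussianReal 0 1) ≠ 0) : dualFun φ 1 = 1 := by
  have h3 : ∀ p : ℝ × ℝ, φ p.1 * φ (corrMap 1 p) = (fun v => φ v ^ 2) p.1 := by
    intro p
    simp [corrMap, sq]
  rw [dualFun]
  simp only [h3]
  rw [integral_fun_fst (f := fun v : ℝ => φ v ^ 2)]
  simp [normConst, h]

theorem HasHermiteExpansion.exists_ne_zero (h : HasHermiteExpansion φ a)
    (hφ : ∫ v, φ v ^ 2 ∂(gaussianReal 0 1) ≠ 0) : ∃ j, a j ≠ 0 := by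
  by_contra! hcon
  refine hφ (h.hasSum_sq.unique ?_)
  simp [hcon]

/-- Homogeneity pulls the two standard deviations out of the expectation. It is only required at α
and χ, so that for suitable functions these may be zero. -/
theorem dualActivation_eq (hφ : Measurable φ) {κ α χ : ℝ} (hα : ∀ v, φ (α * v) = α ^ κ * φ v)
    (hχ : ∀ v, φ (χ * v) = χ ^ κ * φ v) {ρ : ℝ} (hρ : ρ ∈ Set.Icc (-1 : ℝ) 1) :
    dualActivation φ (α ^ 2) (α * χ * ρ) (χ ^ 2) = α ^ κ * χ ^ κ * dualFun φ ρ := by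
  rw [dualActivation, integral_multivariateGaussian_mul hφ hφ α χ hρ, dualFun]
  simp only [hα, hχ]
  have h1 : ∀ p : ℝ × ℝ, α ^ κ * φ p.1 * (χ ^ κ * φ (corrMap ρ p)) =
      α ^ κ * χ ^ κ * (φ p.1 * φ (corrMap ρ p)) := fun p => by ring
  simp only [h1]
  rw [integral_const_mul]
  ring

end Dual

/-! ### Homogeneous functions -/

section Homogeneous

variable {φ : ℝ → ℝ} {κ : ℝ}

/-- The function is determined by its values at 1, -1 and 0. -/
theorem measurable_of_homogeneous (h : ∀ v a : ℝ, 0 < a → φ (a * v) = a ^ κ * φ v) :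
    Measurable φ := by
  have h1 : φ = fun v => if 0 < v then v ^ κ * φ 1 else if v < 0 then (-v) ^ κ * φ (-1)
      else φ 0 := by
    ext v
    split_ifs with h1 h2
    · rw [← h 1 v h1, mul_one]
    · rw [← h (-1) (-v) (by linarith)]
      simp
    · rw [le_antisymm (not_lt.1 h1) (not_lt.1 h2)]
  rw [h1]
  refine Measurable.ite (measurableSet_lt measurable_const measurable_id) (by fun_prop) ?_
  exact Measurable.ite (measurableSet_lt measurable_id measurable_const) (by fun_prop)
    measurable_const

theorem deriv_homogeneous (h : ∀ v a : ℝ, 0 < a → φ (a * v) = a ^ κ * φ v) (v a : ℝ)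
    (ha : 0 < a) : deriv φ (a * v) = a ^ (κ - 1) * deriv φ v := by
  have h1 : deriv (fun v => φ (a * v)) v = a ^ κ * deriv φ v := by
    rw [funext fun v => h v a ha, deriv_const_mul_field]
  rw [deriv_comp_mul_left, smul_eq_mul] at h1
  rw [Real.rpow_sub_one ha.ne', div_mul_eq_mul_div, eq_div_iff ha.ne', mul_comm, h1]

/-- On (0, 1) the normal density is bounded from below, while v^(2κ) is not integrable there. -/
theorem eq_zero_of_homogeneous_of_memLp (h : ∀ v a : ℝ, 0 < a → φ (a * v) = a ^ κ * φ v)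
    (hκ : κ ≤ -1) (hL : MemLp φ 2 (gaussianReal 0 1)) : φ 1 = 0 := by
  by_contra hne
  have hm := measurable_of_homogeneous h
  have h1 := integrable_gaussianReal_iff.1 ((memLp_two_iff_integrable_sq
    hm.aestronglyMeasurable).1 hL)
  have hpdf : 0 < gaussianPDFReal 0 1 1 := gaussianPDFReal_pos 0 1 1 one_ne_zero
  have h2 : IntegrableOn (fun v : ℝ => v ^ (κ + κ)) (Set.Ioo 0 1) := by
    refine Integrable.mono' (g := fun v => (gaussianPDFReal 0 1 1 * φ 1 ^ 2)⁻¹ *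
      (gaussianPDFReal 0 1 v * φ v ^ 2)) (h1.const_mul _).integrableOn
      (by fun_prop) ?_
    refine (ae_restrict_iff' measurableSet_Ioo).2 (ae_of_all _ fun v hv => ?_)
    have hv0 : 0 < v := hv.1
    have h3 : gaussianPDFReal 0 1 1 ≤ gaussianPDFReal 0 1 v := by
      simp only [gaussianPDFReal_def, sub_zero]
      gcongr
      nlinarith [hv.1, hv.2]
    have h4 : φ v = v ^ κ * φ 1 := by rw [← h 1 v hv0, mul_one]
    have h5 : 0 < φ 1 ^ 2 := by positivity
    have h6 : (v ^ κ) ^ 2 = v ^ (κ + κ) := by rw [sq, Real.rpow_add hv0]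
    have h7 := Real.rpow_pos_of_pos hv0 (κ + κ)
    rw [Real.norm_of_nonneg h7.le, h4, mul_pow, h6, inv_mul_eq_div, le_div_iff₀ (by positivity)]
    nlinarith [mul_le_mul_of_nonneg_right h3 (mul_pos h7 h5).le]
  rw [intervalIntegral.integrableOn_Ioo_rpow_iff one_pos] at h2
  linarith

/-- The derivative is homogeneous of degree κ - 1. For κ ≤ 0, square integrability at the origin
would make it vanish on both half-lines. -/
theorem IsRegularActivation.pos {σ : ℝ → ℝ} {κ β : ℝ} (h : IsRegularActivation σ κ β) :
    0 < κ := by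
  by_contra! hκ
  obtain ⟨a, b, -, hb, -⟩ := h.expansion
  have hd := deriv_homogeneous h.homogeneous
  have h1 : deriv σ 1 = 0 := eq_zero_of_homogeneous_of_memLp hd (by linarith) hb.1
  have hneg : MeasurePreserving (fun v : ℝ => -v) (gaussianReal 0 1) (gaussianReal 0 1) :=
    ⟨measurable_neg, by simpa using gaussianReal_map_neg (μ := 0) (v := 1)⟩
  have h2 : deriv σ (-1) = 0 := eq_zero_of_homogeneous_of_memLp (φ := fun v => deriv σ (-v))
    (fun v a ha => by rw [← hd (-v) a ha, mul_neg]) (by linarith)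
    (hb.1.comp_measurePreserving hneg)
  refine h.deriv_ne_zero (integral_eq_zero_of_ae ?_)
  have h3 : ∀ᵐ v ∂(gaussianReal 0 1), v ≠ 0 :=
    (gaussianReal_absolutelyContinuous 0 one_ne_zero).ae_le
      (compl_mem_ae_iff.2 (measure_singleton 0))
  filter_upwards [h3] with v hv
  rcases lt_or_gt_of_ne hv with hv | hv
  · have h4 := hd (-1) (-v) (by linarith)
    rw [neg_mul_neg, mul_one, h2, mul_zero] at h4
    simp [h4]
  · have h4 := hd 1 v hv
    rw [mul_one, h1, mul_zero] at h4
    simp [h4]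

end Homogeneous

/-! ### Neural tangent kernels -/

/-- The recursion for the kernels `Σ^(i)` in terms of the cosine of the angle. -/
noncomputable def angleFun (σ : ℝ → ℝ) : ℕ → ℝ → ℝ
  | 0 => fun ρ => ρ
  | i + 1 => fun ρ => dualFun σ (angleFun σ i ρ)

/-- The profile of the neural tangent kernel in terms of the cosine of the angle. -/
noncomputable def ntkAngleFun (σ : ℝ → ℝ) (L top : ℕ) (ρ : ℝ) : ℝ :=
  ∑ i ∈ Finset.Icc 1 (L + 1), angleFun σ (i - 1) ρ *
    ∏ j ∈ Finset.Icc i top, dualFun (deriv σ) (angleFun σ (j - 1) ρ)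

namespace IsRegularActivation

variable {σ : ℝ → ℝ} {κ β : ℝ}

theorem homogeneous_of_nonneg (h : IsRegularActivation σ κ β) {a : ℝ} (ha : 0 ≤ a) (v : ℝ) :
    σ (a * v) = a ^ κ * σ v := by
  rcases ha.eq_or_lt with rfl | ha
  -- Since 2^κ ≠ 1, homogeneity at v = 0 forces σ(0) = 0; this covers zero inputs.
  · have h1 := h.homogeneous 0 2 two_pos
    have h2 : (1 : ℝ) < 2 ^ κ := Real.one_lt_rpow one_lt_two h.pos
    rw [mul_zero] at h1
    have h3 : (2 ^ κ - 1) * σ 0 = 0 := by linarith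
    rw [zero_mul, Real.zero_rpow h.pos.ne', zero_mul]
    exact (mul_eq_zero.1 h3).resolve_left (by linarith)
  · exact h.homogeneous v a ha

theorem dualFun_one_eq (h : IsRegularActivation σ κ β) : dualFun σ 1 = 1 := by
  obtain ⟨a, b, ha, hb, j, -, hj⟩ := h.expansion
  refine dualFun_one ?_
  rw [← ha.hasSum_sq.tsum_eq]
  exact (ha.hasSum_sq.summable.tsum_pos (fun i => sq_nonneg _) j (by positivity)).ne'

theorem angleFun_one (h : IsRegularActivation σ κ β) (i : ℕ) : angleFun σ i 1 = 1 := by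
  induction i with
  | zero => rfl
  | succ i ih =>
    rw [angleFun]
    beta_reduce
    rw [ih, h.dualFun_one_eq]

/-- Orders multiply under composition, so i compositions of the dual of `σ`, with a positive
coefficient of order `j`, have one of order j^i. -/
theorem exists_hasNonnegSeries_angleFun (h : IsRegularActivation σ κ β) :
    ∃ j, ⌊2 / β⌋₊ < j ∧ ∀ i, HasNonnegSeries (angleFun σ i) (j ^ i) := by
  obtain ⟨a, b, ha, -, j, hj, haj⟩ := h.expansion
  refine ⟨j, hj, fun i => ?_⟩
  induction i with
  | zero => simpa [angleFun] using HasNonnegSeries.id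
  | succ i ih =>
    rw [pow_succ]
    exact (ha.hasNonnegSeries_dualFun haj).comp ih (h.angleFun_one i).le

theorem exists_hasNonnegSeries_deriv (h : IsRegularActivation σ κ β) (i : ℕ) :
    ∃ k, HasNonnegSeries (fun ρ => dualFun (deriv σ) (angleFun σ i ρ)) k := by
  obtain ⟨a, b, -, hb, -⟩ := h.expansion
  obtain ⟨j, -, hj⟩ := h.exists_hasNonnegSeries_angleFun
  obtain ⟨l, hl⟩ := hb.exists_ne_zero h.deriv_ne_zero
  exact ⟨_, (hb.hasNonnegSeries_dualFun hl).comp (hj i) (h.angleFun_one i).le⟩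

theorem exists_hasNonnegSeries_ntkAngleFun (h : IsRegularActivation σ κ β) {L : ℕ} (hL : 1 ≤ L)
    (top : ℕ) : ∃ k, ⌊2 / β⌋₊ < k ∧ HasNonnegSeries (ntkAngleFun σ L top) k := by
  obtain ⟨j, hj, hang⟩ := h.exists_hasNonnegSeries_angleFun
  have hprod : ∀ i, ∃ k, HasNonnegSeries (fun ρ => ∏ j ∈ Finset.Icc i top,
      dualFun (deriv σ) (angleFun σ (j - 1) ρ)) k := fun i =>
    HasNonnegSeries.finset_prod fun j _ => h.exists_hasNonnegSeries_deriv (j - 1)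
  choose k hk using hprod
  -- The summand of index L + 1 alone has a positive coefficient of order at least j^L ≥ j, as L ≥
  -- 1; the other summands only add nonnegative coefficients.
  refine ⟨j ^ L + k (L + 1), ?_, ?_⟩
  · have : j ≤ j ^ L := Nat.le_self_pow (by omega) j
    omega
  · refine (((hang L).mul (hk (L + 1))).finset_sum_add (s := Finset.Icc 1 L)
      (F := fun i ρ => angleFun σ (i - 1) ρ * ∏ j ∈ Finset.Icc i top,
        dualFun (deriv σ) (angleFun σ (j - 1) ρ)) fun i _ =>
          ⟨_, (hang (i - 1)).mul (hk i)⟩).congr fun ρ _ => ?_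
    rw [ntkAngleFun, Finset.sum_Icc_succ_top (by omega)]
    simp

theorem angleFun_mem (h : IsRegularActivation σ κ β) (i : ℕ) {ρ : ℝ}
    (hρ : ρ ∈ Set.Icc (-1 : ℝ) 1) : angleFun σ i ρ ∈ Set.Icc (-1 : ℝ) 1 := by
  obtain ⟨j, -, hj⟩ := h.exists_hasNonnegSeries_angleFun
  exact abs_le.1 (((hj i).abs_le hρ).trans (h.angleFun_one i).le)

/-- Each level raises the norms to the power κ and composes the angular part with the dual of `σ`.
The diagonal values are needed alongside, as squares, because they are the variances at the next
level. -/
theorem nngp_eq (h : IsRegularActivation σ κ β) (d i : ℕ) (x x' : E d) :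
    nngp σ d i x x' = ‖x‖ ^ (κ ^ i) * ‖x'‖ ^ (κ ^ i) *
        angleFun σ i (⟪x, x'⟫ / (‖x‖ * ‖x'‖)) ∧
      nngp σ d i x x = (‖x‖ ^ (κ ^ i)) ^ 2 := by
  have hdiag : ∀ (i : ℕ) (x : E d), ‖x‖ ^ (κ ^ i) * ‖x‖ ^ (κ ^ i) *
      angleFun σ i (⟪x, x⟫ / (‖x‖ * ‖x‖)) = (‖x‖ ^ (κ ^ i)) ^ 2 := by
    intro i x
    rcases (norm_nonneg x).eq_or_lt with h0 | h0
    · rw [← h0, Real.zero_rpow (pow_pos h.pos i).ne']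
      simp
    · rw [real_inner_self_eq_norm_sq, ← sq ‖x‖, div_self (by positivity), h.angleFun_one]
      ring
  suffices hmain : ∀ x x' : E d, nngp σ d i x x' = ‖x‖ ^ (κ ^ i) * ‖x'‖ ^ (κ ^ i) *
      angleFun σ i (⟪x, x'⟫ / (‖x‖ * ‖x'‖)) from
    ⟨hmain x x', (hmain x x).trans (hdiag i x)⟩
  induction i with
  | zero =>
    intro x x'
    simp only [nngp, pow_zero, Real.rpow_one, angleFun]
    rcases eq_or_ne (‖x‖ * ‖x'‖) 0 with h0 | h0
    · have := abs_real_inner_le_norm x x'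
      rw [h0] at this ⊢
      rw [zero_mul]
      exact abs_nonpos_iff.1 this
    · rw [mul_div_cancel₀ _ h0]
  | succ i ih =>
    intro x x'
    have hp : ∀ x : E d, 0 ≤ ‖x‖ ^ (κ ^ i) := fun x => Real.rpow_nonneg (norm_nonneg _) _
    rw [nngp]
    beta_reduce
    rw [ih x x, ih x x', ih x' x', hdiag, hdiag,
      dualActivation_eq (measurable_of_homogeneous h.homogeneous)
        (h.homogeneous_of_nonneg (hp x)) (h.homogeneous_of_nonneg (hp x'))
        (h.angleFun_mem i (HasAngularSeries.cos_mem x x')),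
      ← Real.rpow_mul (norm_nonneg _), ← Real.rpow_mul (norm_nonneg _), ← pow_succ]
    rfl

/-- The derivative has degree κ - 1, so the degree in the norms is κ^i (κ - 1). It may be negative,
which is why the inputs are nonzero. -/
theorem nngpDeriv_eq (h : IsRegularActivation σ κ β) (d i : ℕ) {x x' : E d} (hx : x ≠ 0)
    (hx' : x' ≠ 0) : nngpDeriv σ d i x x' = (‖x‖ * ‖x'‖) ^ (κ ^ (i + 1) - κ ^ i) *
      dualFun (deriv σ) (angleFun σ i (⟪x, x'⟫ / (‖x‖ * ‖x'‖))) := by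
  have hx0 := norm_pos_iff.2 hx
  have hx0' := norm_pos_iff.2 hx'
  have hd := deriv_homogeneous h.homogeneous
  rw [nngpDeriv, (h.nngp_eq d i x x').2, (h.nngp_eq d i x x').1, (h.nngp_eq d i x' x').2,
    dualActivation_eq (measurable_deriv σ)
      (fun v => hd v _ (Real.rpow_pos_of_pos hx0 _)) (fun v => hd v _ (Real.rpow_pos_of_pos hx0' _))
      (h.angleFun_mem i (HasAngularSeries.cos_mem x x')),
    ← Real.rpow_mul hx0.le, ← Real.rpow_mul hx0'.le, ← Real.mul_rpow hx0.le hx0'.le]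
  congr 2
  ring

/-- The degrees κ^j - κ^(j-1) of the derivative kernels telescope. Hence all summands of the tangent
kernel have the same degree κ^top. -/
theorem mul_prod_nngpDeriv_eq (h : IsRegularActivation σ κ β) (d : ℕ) {x x' : E d} (hx : x ≠ 0)
    (hx' : x' ≠ 0) {i top : ℕ} (hi : i ≤ top) :
    (‖x‖ * ‖x'‖) ^ (κ ^ i) * ∏ j ∈ Finset.Icc (i + 1) top, nngpDeriv σ d (j - 1) x x' =
      (‖x‖ * ‖x'‖) ^ (κ ^ top) * ∏ j ∈ Finset.Icc (i + 1) top,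
        dualFun (deriv σ) (angleFun σ (j - 1) (⟪x, x'⟫ / (‖x‖ * ‖x'‖))) := by
  have hr : 0 < ‖x‖ * ‖x'‖ := mul_pos (norm_pos_iff.2 hx) (norm_pos_iff.2 hx')
  induction top, hi using Nat.le_induction with
  | base => simp
  | succ top hi ih =>
    rw [Finset.prod_Icc_succ_top (by omega), Finset.prod_Icc_succ_top (by omega), ← mul_assoc, ih,
      Nat.add_sub_cancel, h.nngpDeriv_eq d top hx hx',
      show κ ^ (top + 1) = κ ^ top + (κ ^ (top + 1) - κ ^ top) by ring, Real.rpow_add hr]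
    ring_nf

theorem ntk_eq (h : IsRegularActivation σ κ β) {L top : ℕ} (htop : L ≤ top) (d : ℕ)
    (x x' : E d) : ntk σ L top d x x' =
      (‖x‖ * ‖x'‖) ^ (κ ^ top) * ntkAngleFun σ L top (⟪x, x'⟫ / (‖x‖ * ‖x'‖)) := by
  have hterm : ∀ i ∈ Finset.Icc 1 (L + 1), nngp σ d (i - 1) x x' *
      ∏ j ∈ Finset.Icc i top, nngpDeriv σ d (j - 1) x x' =
      (‖x‖ * ‖x'‖) ^ (κ ^ top) * (angleFun σ (i - 1) (⟪x, x'⟫ / (‖x‖ * ‖x'‖)) *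
        ∏ j ∈ Finset.Icc i top, dualFun (deriv σ)
          (angleFun σ (j - 1) (⟪x, x'⟫ / (‖x‖ * ‖x'‖)))) := by
    intro i hi
    obtain ⟨i, rfl⟩ := Nat.exists_eq_add_of_le' (Finset.mem_Icc.1 hi).1
    have hi2 := (Finset.mem_Icc.1 hi).2
    rw [Nat.add_sub_cancel, (h.nngp_eq d i x x').1,
      ← Real.mul_rpow (norm_nonneg _) (norm_nonneg _)]
    -- If an input is zero, both sides vanish through the first factor, whatever the derivative
    -- kernels are.
    by_cases h0 : ‖x‖ * ‖x'‖ = 0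
    · rw [h0, Real.zero_rpow (pow_pos h.pos i).ne', Real.zero_rpow (pow_pos h.pos top).ne']
      simp
    · have hx : x ≠ 0 := fun hx => h0 (by simp [hx])
      have hx' : x' ≠ 0 := fun hx => h0 (by simp [hx])
      rw [mul_right_comm, h.mul_prod_nngpDeriv_eq d hx hx' (by omega)]
      ring
  rw [ntk, Finset.sum_congr rfl hterm, ← Finset.mul_sum, ntkAngleFun]

theorem exists_hasAngularSeries (h : IsRegularActivation σ κ β) {L top : ℕ} (hL : 1 ≤ L)
    (htop : L ≤ top) : ∃ γ k, ⌊2 / β⌋₊ < k ∧ 0 < γ k ∧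
      HasAngularSeries (ntk σ L top) (κ ^ top) γ := by
  obtain ⟨k, hk, γ, h1, h2, h3, h4⟩ := h.exists_hasNonnegSeries_ntkAngleFun hL top
  refine ⟨γ, k, hk, h3, pow_pos h.pos top, h1, h2, fun d x x' => ?_⟩
  rw [h.ntk_eq htop]
  exact (h4 _ (HasAngularSeries.cos_mem x x')).mul_left _

end IsRegularActivation

/-! ### Completeness of the Hermite functions -/

section HermiteComplete

open Polynomial

/-- Finite measures on the line all of whose exponential moments are finite are determined by
their moments. -/
theorem ext_of_integral_pow_eq {μ ν : Measure ℝ} [IsFiniteMeasure μ] [IsFiniteMeasure ν]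
    (hμ : ∀ t : ℝ, Integrable (fun v => Real.exp (t * v)) μ)
    (hν : ∀ t : ℝ, Integrable (fun v => Real.exp (t * v)) ν)
    (h : ∀ n : ℕ, ∫ v, v ^ n ∂μ = ∫ v, v ^ n ∂ν) : μ = ν := by
  have hset : ∀ {ρ : Measure ℝ}, (∀ t : ℝ, Integrable (fun v => Real.exp (t * v)) ρ) →
      interior (integrableExpSet id ρ) = Set.univ := by
    intro ρ hρ
    rw [show integrableExpSet id ρ = Set.univ from Set.eq_univ_of_forall hρ, interior_univ]
  have hdiff : ∀ {ρ : Measure ℝ}, (∀ t : ℝ, Integrable (fun v => Real.exp (t * v)) ρ) →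
      Differentiable ℂ (complexMGF id ρ) := by
    intro ρ hρ
    have h1 := differentiableOn_complexMGF (X := id) (μ := ρ)
    rw [hset hρ] at h1
    simpa [differentiableOn_univ] using h1
  have hiter : ∀ {ρ : Measure ℝ}, (∀ t : ℝ, Integrable (fun v => Real.exp (t * v)) ρ) →
      ∀ n : ℕ, iteratedDeriv n (complexMGF id ρ) 0 = ((∫ v, v ^ n ∂ρ : ℝ) : ℂ) := by
    intro ρ hρ n
    rw [iteratedDeriv_complexMGF (by rw [hset hρ]; trivial), ← integral_complex_ofReal]
    simp
  -- Both complex moment generating functions are entire, and their Taylor coefficients at 0 are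
  -- given by the moments.
  refine Measure.ext_of_complexMGF_id_eq (funext fun z => ?_)
  rw [← Complex.taylorSeries_eq_of_entire' 0 z (hdiff hμ),
    ← Complex.taylorSeries_eq_of_entire' 0 z (hdiff hν)]
  simp only [hiter hμ, hiter hν, h]

theorem memLp_exp_mul (t : ℝ) : MemLp (fun v => Real.exp (t * v)) 2 (gaussianReal 0 1) := by
  rw [memLp_two_iff_integrable_sq (by fun_prop)]
  refine (integrable_exp_mul_gaussianReal (2 * t)).congr (ae_of_all _ fun v => ?_)
  beta_reduce
  rw [← Real.exp_nat_mul]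
  push_cast
  ring_nf

/-- The positive and the negative part of `f`, taken as densities, define two finite measures with
equal moments. Their exponential moments are finite by Cauchy-Schwarz, so the measures coincide, and
so do the two parts. -/
theorem ae_eq_zero_of_integral_pow_mul_eq_zero {f : ℝ → ℝ} (hf : MemLp f 2 (gaussianReal 0 1))
    (h : ∀ n : ℕ, ∫ v, v ^ n * f v ∂(gaussianReal 0 1) = 0) : f =ᵐ[gaussianReal 0 1] 0 := by
  have hint : Integrable f (gaussianReal 0 1) := hf.integrable one_le_two
  have hm : ∀ {g : ℝ → ℝ}, Integrable g (gaussianReal 0 1) →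
      AEMeasurable (fun v => ENNReal.ofReal (g v)) (gaussianReal 0 1) :=
    fun hg => hg.aemeasurable.ennreal_ofReal
  have hexp : ∀ {g : ℝ → ℝ}, MemLp g 2 (gaussianReal 0 1) → ∀ t : ℝ,
      Integrable (fun v => Real.exp (t * v))
        ((gaussianReal 0 1).withDensity fun v => ENNReal.ofReal (g v)) := by
    intro g hg t
    rw [integrable_withDensity_iff_integrable_smul₀' (hm (hg.integrable one_le_two))
      (ae_of_all _ fun _ => ENNReal.ofReal_lt_top)]
    simp only [ENNReal.toReal_ofReal', smul_eq_mul]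
    exact hg.pos_part.integrable_mul (memLp_exp_mul t)
  have hpow : ∀ {g : ℝ → ℝ}, Integrable g (gaussianReal 0 1) → ∀ n : ℕ,
      ∫ v, v ^ n ∂((gaussianReal 0 1).withDensity fun v => ENNReal.ofReal (g v)) =
        ∫ v, max (g v) 0 * v ^ n ∂(gaussianReal 0 1) := by
    intro g hg n
    rw [integral_withDensity_eq_integral_toReal_smul₀ (hm hg)
      (ae_of_all _ fun _ => ENNReal.ofReal_lt_top)]
    simp only [ENNReal.toReal_ofReal', smul_eq_mul]
  have := isFiniteMeasure_withDensity_ofReal hint.2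
  have := isFiniteMeasure_withDensity_ofReal hint.neg.2
  have hmem : ∀ n : ℕ, MemLp (fun v : ℝ => v ^ n) 2 (gaussianReal 0 1) := by
    intro n
    have h1 := memLp_polynomial (X ^ n)
    simpa only [eval_pow, eval_X] using h1
  have hmul : ∀ {g : ℝ → ℝ}, MemLp g 2 (gaussianReal 0 1) → ∀ n : ℕ,
      Integrable (fun v => max (g v) 0 * v ^ n) (gaussianReal 0 1) :=
    fun hg n => hg.pos_part.integrable_mul (hmem n)
  have heq := ext_of_integral_pow_eq (hexp hf) (hexp hf.neg) (fun n => by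
    rw [hpow hint, hpow hint.neg, ← sub_eq_zero, ← integral_sub (hmul hf n) (hmul hf.neg n)]
    refine Eq.trans (integral_congr_ae (ae_of_all _ fun v => ?_)) (h n)
    have h1 := max_zero_sub_max_neg_zero_eq_self (f v)
    simp only [Pi.neg_apply]
    rw [← sub_mul, h1, mul_comm])
  rw [withDensity_eq_iff (hm hint) (hm hint.neg) hint.lintegral_lt_top.ne] at heq
  filter_upwards [heq] with v hv
  have h1 := congrArg ENNReal.toReal hv
  simp only [ENNReal.toReal_ofReal', Pi.neg_apply] at h1
  have h2 := max_zero_sub_max_neg_zero_eq_self (f v)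
  rw [h1, sub_self] at h2
  exact h2.symm

theorem ae_eq_zero_of_integral_hermiteFun_mul_eq_zero {f : ℝ → ℝ}
    (hf : MemLp f 2 (gaussianReal 0 1))
    (h : ∀ j : ℕ, ∫ v, hermiteFun j v * f v ∂(gaussianReal 0 1) = 0) :
    f =ᵐ[gaussianReal 0 1] 0 := by
  have hint : ∀ p : ℝ[X], Integrable (fun v => p.eval v * f v) (gaussianReal 0 1) :=
    fun p => (memLp_polynomial p).integrable_mul hf
  have hj : ∀ j : ℕ, ∫ v, (hermiteReal j).eval v * f v ∂(gaussianReal 0 1) = 0 := by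
    intro j
    have hs : Real.sqrt (j.factorial : ℝ) ≠ 0 := by positivity
    have h1 : ∀ v, (hermiteReal j).eval v * f v =
        Real.sqrt (j.factorial : ℝ) * (hermiteFun j v * f v) := by
      intro v
      rw [hermiteFun_eq]
      field_simp
    simp only [h1]
    rw [integral_const_mul, h j, mul_zero]
  have key : ∀ n : ℕ, ∀ p : ℝ[X], p.degree < n →
      ∫ v, p.eval v * f v ∂(gaussianReal 0 1) = 0 := by
    intro n
    induction n with
    | zero =>
      intro p hp
      have : p = 0 := by simpa using hp
      simp [this]
    | succ n ih =>
      intro p hp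
      -- The Hermite polynomials are monic, so subtracting a multiple of the n-th one removes the
      -- top coefficient.
      have hdeg : (p - C (p.coeff n) * hermiteReal n).degree < n := by
        rw [degree_lt_iff_coeff_zero]
        intro m hm
        rw [coeff_sub, coeff_C_mul]
        rcases hm.eq_or_lt with rfl | hm
        · have h1 := (hermiteReal_monic n).coeff_natDegree
          rw [natDegree_hermiteReal] at h1
          rw [h1, mul_one, sub_self]
        · have h1 : (hermiteReal n).coeff m = 0 :=
            coeff_eq_zero_of_natDegree_lt (by rwa [natDegree_hermiteReal])
          rw [(degree_lt_iff_coeff_zero _ _).1 hp m hm, h1, mul_zero, sub_zero]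
      have h1 := ih _ hdeg
      simp only [eval_sub, eval_mul, eval_C, sub_mul, mul_assoc] at h1
      rwa [integral_sub (hint p) ((hint _).const_mul _), integral_const_mul, hj, mul_zero,
        sub_zero] at h1
  refine ae_eq_zero_of_integral_pow_mul_eq_zero hf fun n => ?_
  simpa using key (n + 1) (X ^ n) (by
    rw [degree_X_pow]
    exact_mod_cast n.lt_succ_self)

/-- Square integrable functions are the sums of their Hermite expansions. -/
theorem hasHermiteExpansion_of_memLp {φ : ℝ → ℝ} (hφ : MemLp φ 2 (gaussianReal 0 1)) :
    ∃ a : ℕ → ℝ, HasHermiteExpansion φ a := by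
  set h : ℕ → Lp ℝ 2 (gaussianReal 0 1) := fun j => (memLp_hermiteFun j).toLp (hermiteFun j)
    with h_def
  have hinner : ∀ (j : ℕ) (f : Lp ℝ 2 (gaussianReal 0 1)),
      ⟪h j, f⟫ = ∫ v, hermiteFun j v * f v ∂(gaussianReal 0 1) := by
    intro j f
    rw [L2.inner_def]
    refine integral_congr_ae ?_
    filter_upwards [(memLp_hermiteFun j).coeFn_toLp] with v hv
    rw [h_def, hv, Real.inner_apply]
  have hon : Orthonormal ℝ h := by
    rw [orthonormal_iff_ite]
    intro i j
    rw [hinner, ← integral_hermiteFun_mul i j]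
    refine integral_congr_ae ?_
    filter_upwards [(memLp_hermiteFun j).coeFn_toLp] with v hv
    rw [h_def, hv]
  have hbot : (Submodule.span ℝ (Set.range h))ᗮ = ⊥ := by
    rw [eq_bot_iff]
    intro f hf
    rw [Submodule.mem_orthogonal] at hf
    have h1 := ae_eq_zero_of_integral_hermiteFun_mul_eq_zero (Lp.memLp f) fun j => by
      rw [← hinner]
      exact hf _ (Submodule.subset_span ⟨j, rfl⟩)
    exact (Lp.eq_zero_iff_ae_eq_zero).2 h1
  set b := HilbertBasis.mkOfOrthogonalEqBot hon hbot
  have hb : ∀ j, b j = h j := fun j => by simp [b]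
  have hsum := (b.hasSum_repr (hφ.toLp φ)).tendsto_sum_nat
  refine ⟨fun j => b.repr (hφ.toLp φ) j, hφ, ?_⟩
  have hpart : ∀ N : ℕ, ∑ j ∈ Finset.range N, b.repr (hφ.toLp φ) j • b j =
      (memLp_hermiteSum (fun j => b.repr (hφ.toLp φ) j) N).toLp _ := by
    intro N
    induction N with
    | zero =>
      simp only [Finset.range_zero, Finset.sum_empty]
      exact (MemLp.toLp_zero _).symm
    | succ N ih =>
      rw [Finset.sum_range_succ, ih, hb, h_def, ← MemLp.toLp_const_smul, ← MemLp.toLp_add]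
      congr 1
      ext v
      simp [Finset.sum_range_succ]
  simp only [hpart] at hsum
  rw [Lp.tendsto_Lp_iff_tendsto_eLpNorm''] at hsum
  refine hsum.congr fun N => ?_
  rw [← eLpNorm_neg]
  congr 1
  ext v
  simp

end HermiteComplete

/-! ### The ReLU activation function -/

theorem lipschitzWith_relu : LipschitzWith 1 relu :=
  LipschitzWith.id.max_const 0

theorem memLp_relu : MemLp relu 2 (gaussianReal 0 1) := by
  have h1 : MemLp (fun v : ℝ => v) 2 (gaussianReal 0 1) := memLp_id_gaussianReal' 2 (by simp)
  exact h1.pos_part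

theorem memLp_deriv_relu : MemLp (deriv relu) 2 (gaussianReal 0 1) := by
  refine MemLp.of_bound (measurable_deriv _).aestronglyMeasurable 1 (ae_of_all _ fun v => ?_)
  simpa using norm_deriv_le_of_lipschitz (x₀ := v) lipschitzWith_relu

theorem deriv_relu_of_pos {v : ℝ} (hv : 0 < v) : deriv relu v = 1 := by
  have h1 : relu =ᶠ[𝓝 v] fun v => v := by
    filter_upwards [lt_mem_nhds hv] with w hw
    exact max_eq_left hw.le
  rw [h1.deriv_eq, deriv_id'']

theorem ae_of_ae_gaussianReal {p : ℝ → Prop} (h : ∀ᵐ v ∂(gaussianReal 0 1), p v) : ∀ᵐ v, p v :=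
  (gaussianReal_absolutelyContinuous' 0 one_ne_zero).ae_le h

theorem integral_deriv_relu_sq_ne_zero : ∫ v, deriv relu v ^ 2 ∂(gaussianReal 0 1) ≠ 0 := by
  intro h
  rw [integral_eq_zero_iff_of_nonneg (fun v => sq_nonneg _) memLp_deriv_relu.integrable_sq] at h
  have h1 : ∀ᵐ v : ℝ, v ∉ Set.Ioi (0 : ℝ) := by
    filter_upwards [ae_of_ae_gaussianReal h] with v hv hv0
    simp [deriv_relu_of_pos hv0] at hv
  rw [← measure_eq_zero_iff_ae_notMem] at h1
  simp at h1

theorem relu_ne_polynomial (p : Polynomial ℝ) : relu ≠ fun v => p.eval v := by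
  intro h
  have h0 : p = 0 := Polynomial.eq_zero_of_infinite_isRoot p
    ((Set.Iio_infinite (0 : ℝ)).mono fun v hv => by
      have h1 := congrFun h v
      rw [relu, max_eq_right (Set.mem_Iio.1 hv).le] at h1
      exact h1.symm)
  have h1 := congrFun h 1
  simp [relu, h0] at h1

/-- If the coefficients vanished beyond `m`, then ReLU would be almost everywhere, hence by
continuity everywhere, equal to a polynomial. -/
theorem HasHermiteExpansion.exists_relu_coeff_ne_zero {a : ℕ → ℝ} (h : HasHermiteExpansion relu a)
    (m : ℕ) : ∃ j, m < j ∧ a j ≠ 0 := by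
  by_contra! hz
  have hconst : ∀ N, m + 1 ≤ N → ∀ v, ∑ j ∈ Finset.range N, a j * hermiteFun j v =
      ∑ j ∈ Finset.range (m + 1), a j * hermiteFun j v := by
    intro N hN v
    refine (Finset.sum_subset (Finset.range_mono hN) fun j _ hj => ?_).symm
    rw [hz j (by simpa using hj), zero_mul]
  have h0 : eLpNorm (fun v => relu v - ∑ j ∈ Finset.range (m + 1), a j * hermiteFun j v) 2
      (gaussianReal 0 1) = 0 := by
    refine tendsto_nhds_unique (tendsto_const_nhds.congr' ?_) h.2
    filter_upwards [eventually_ge_atTop (m + 1)] with N hN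
    simp only [hconst N hN]
  set p : Polynomial ℝ := ∑ j ∈ Finset.range (m + 1),
    Polynomial.C (a j / Real.sqrt (j.factorial : ℝ)) * hermiteReal j with hp
  have hpe : ∀ v, p.eval v = ∑ j ∈ Finset.range (m + 1), a j * hermiteFun j v := by
    intro v
    rw [hp, Polynomial.eval_finsetSum]
    refine Finset.sum_congr rfl fun j _ => ?_
    rw [Polynomial.eval_mul, Polynomial.eval_C, hermiteFun_eq]
    ring
  replace h0 := (eLpNorm_eq_zero_iff (memLp_relu.sub (memLp_hermiteSum a (m + 1))).1
    two_ne_zero).1 h0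
  refine relu_ne_polynomial p ((Continuous.ae_eq_iff_eq volume lipschitzWith_relu.continuous
    p.continuous).1 ?_)
  filter_upwards [ae_of_ae_gaussianReal h0] with v hv
  rw [hpe v]
  exact sub_eq_zero.1 hv

theorem isRegularActivation_relu (β : ℝ) : IsRegularActivation relu 1 β where
  homogeneous v a ha := by
    rw [Real.rpow_one, relu, relu, mul_max_of_nonneg _ _ ha.le, mul_zero]
  deriv_ne_zero := integral_deriv_relu_sq_ne_zero
  expansion := by
    obtain ⟨a, ha⟩ := hasHermiteExpansion_of_memLp memLp_relu
    obtain ⟨b, hb⟩ := hasHermiteExpansion_of_memLp memLp_deriv_relu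
    exact ⟨a, b, ha, hb, ha.exists_relu_coeff_ne_zero _⟩

end PolyBarrier

theorem corollary1 (β : ℝ) (hβ : 0 < β) :
    -- the exponential inner product kernel
    ((∃ gc, SatisfiesKernelAssumptions expKernel β gc) ∧
      PolynomialApproximationBarrier.{u} expKernel β) ∧
    -- the `α`-exponential kernels, including the Laplace and the Gaussian kernel
    (∀ α : ℝ, 0 < α → α ≤ 2 →
      IsRotationallyInvariantKernel (alphaExpKernel α) ∧
      PolynomialApproximationBarrier.{u} (alphaExpKernel α) β) ∧
    (∃ gc, SatisfiesKernelAssumptions (alphaExpKernel 2) β gc) ∧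
    -- the neural tangent kernels of depth `L ≥ 1`
    (∀ (σ : ℝ → ℝ) (κ : ℝ), IsRegularActivation σ κ β →
      ∀ L top : ℕ, 1 ≤ L → (top = L + 1 ∨ top = L) →
        (∃ gc, SatisfiesKernelAssumptions (ntk σ L top) β gc ∧
          HasGlobalExpansion (ntk σ L top) gc ∧
          ((∃ N : ℕ, κ = N) → HasPuiseuxCoefficients gc)) ∧
        PolynomialApproximationBarrier.{u} (ntk σ L top) β) ∧
    -- the ReLU activation function is regular
    IsRegularActivation relu 1 β := by
  refine ⟨⟨⟨_, expKernel_satisfiesKernelAssumptions β⟩, expKernel_barrier hβ⟩,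
    fun α hα hα2 => ⟨alphaExpKernel_isRotationallyInvariantKernel hα hα2,
      alphaExpKernel_barrier hα hα2 hβ⟩,
    ⟨_, gaussianKernel_satisfiesKernelAssumptions β⟩, fun σ κ hσ L top hL htop => ?_,
    isRegularActivation_relu β⟩
  obtain ⟨γ, k, hk, hγ, h⟩ := hσ.exists_hasAngularSeries hL (top := top)
    (by rcases htop with rfl | rfl <;> omega)
  -- The degree of the tangent kernel is κ^top, which is a natural number if κ is one.
  refine ⟨⟨_, h.satisfiesKernelAssumptions hk hγ, h.hasGlobalExpansion, fun ⟨N, hN⟩ =>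
    h.hasPuiseuxCoefficients (N := N ^ top) (by rw [hN, Nat.cast_pow])⟩, h.barrier hβ hk hγ⟩
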